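/- **Setting.** Individual names, concept names, role names and standpoint symbols are taken from countable sets. Role names are divided into simple ones and non-simple ones; the latter contain the universal role $\mathtt u$ and carry a strict order $\prec$. Simple role expressions are built from simple role names and their inverses with $\cup,\cap,\setminus$; role expressions are the simple ones and the non-simple role names, and $\prec$ is extended by putting every simple role expression below every non-simple role name. $\mathcal{SROIQ}b_s$ concepts are built from concept names, nominals, $\top,\bot,\neg,\sqcap,\sqcup,\forall r.C,\exists r.C$ and, for simple $r$ only, $\exists r.\mathit{Self}$, $\leqslant n\,r.C$, $\geqslant n\,r.C$. Axioms are $C(a)$, $r(a,b)$, $a\doteq b$, $a\not\doteq b$, $C\sqsubseteq D$, and role inclusion axioms (RIAs) $r_1\circ\dots\circ r_n\sqsubseteq \mathtt r$, $\ r_1\circ\dots\circ r_n\circ \mathtt r\sqsubseteq \mathtt r$, $\ \mathtt r\circ r_1\circ\dots\circ r_n\sqsubseteq \mathtt r$, $\ \mathtt r\circ \mathtt r\sqsubseteq \mathtt r$ with $n\ge 1$, $\mathtt r$ a non-simple role name and all $r_i\prec \mathtt r$. A set of axioms is a valid $\mathcal{SROIQ}b_s$ knowledge base if it is finite and its axioms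 are well-formed in this sense for a strict order on the non-simple role names. The semantics is the standard one, with non-empty domains. Sentential Standpoint-$\mathcal{SROIQ}b_s$ sentences are built from axioms with $\neg,\wedge,\vee,\Box_e,\Diamond_e$, where $e$ is built from $*$ and standpoint symbols with $\cup,\cap,\setminus$. A standpoint structure consists of a non-empty domain $\Delta$, a non-empty set $\Pi$ of precisifications, a set $\sigma(s)\subseteq\Pi$ for each standpoint symbol ($\sigma(*)=\Pi$), and an interpretation $\gamma(\pi)$ over $\Delta$ for each $\pi\in\Pi$, where individual names do not depend on $\pi$; $\Box_e\psi$ ($\Diamond_e\psi$) holds if $\psi$ holds at all (some) $\pi\in\sigma(e)$, and a model of $\varphi$ satisfies $\varphi$ at every $\pi\in\Pi$. **The translation.** Let $|\varphi|$ be the number of subsentences of $\varphi$ and $\Pi_\varphi=\{0,\dots,|\varphi|-1\}$. Bring $\varphi$ into negation normal form and, if it contains nested modalities, replace the resulting sentence $\chi$ by $L_\chi$ conjoined with all $\neg L_{\psi\wedge\xi}\vee(L_\psi\wedge L_\xi)$, $\neg L_{\psi\vee\xi}\vee(L_\psi\vee L_\xi)$, $\neg L_{\Box_e\psi}\vee\Box_eL_\psi$,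 $\neg L_{\Diamond_e\psi}\vee\Diamond_eL_\psi$ for the compound subsentences of $\chi$, where $L_\psi=\psi$ for possibly negated axioms and $L_\psi=(\top\sqsubseteq P_\psi)$ with $P_\psi$ fresh otherwise. Call the result $\varphi'$. For $\pi\in\Pi_\varphi$ introduce a copy $\mathtt A^\pi$ of every concept name, a copy $\mathtt s^\pi$ of every simple role name, a copy $\mathtt r^\pi$ and a further non-simple role name $\underline{\mathtt r}^\pi$ for every non-simple $\mathtt r\ne\mathtt u$, a simple role name $\mathtt s_\rho^\pi$ and an individual name $a_\rho^\pi$ for every RIA $\rho$, and concept names $\mathtt M^s_\pi$ for $s=*$ and for every standpoint symbol $s$. The new order compares non-simple role names like their originals, and in addition $\underline{\mathtt r}^\pi\prec\mathtt r^\pi$. Write $r^\pi$ for the result of replacing all role names except $\mathtt u$ in $r$ by their $\pi$-copies, and $\underline r^\pi=\underline{\mathtt r}^\pi$ if $r=\mathtt r\ne\mathtt u$ is a non-simple role name and $\underline r^\pi=r^\pi$ otherwise. $C^\pi$ is obtained from the negation normal form of $C$ by replacing names by their $\pi$-copies and every $\exists r$ by $\exists\underline r^\pi$; inside the fillers of an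 odd number of restrictions $\leqslant n\,r'.D$, instead $\exists r$ becomes $\exists r^\pi$ and $\forall r$ becomes $\forall\underline r^\pi$. Then $\mathrm{Trans}(\varphi)$ consists of 1. $\underline{\mathtt r}^\pi\sqsubseteq\mathtt r^\pi$ for every non-simple $\mathtt r\neq\mathtt u$ occurring in $\varphi$ and every $\pi\in\Pi_\varphi$; 2. for every $\pi\in\Pi_\varphi$ and every RIA $\rho$ occurring unnegated in $\varphi'$ with right-hand side $\mathtt r\ne\mathtt u$, the RIA $\mathtt s_\rho^\pi\circ r_1^\pi\circ\dots\circ r_n^\pi\sqsubseteq\underline{\mathtt r}^\pi$, $\ \mathtt s_\rho^\pi\circ r_1^\pi\circ\dots\circ r_n^\pi\circ\underline{\mathtt r}^\pi\sqsubseteq\underline{\mathtt r}^\pi$, $\ \underline{\mathtt r}^\pi\circ r_1^\pi\circ\dots\circ r_n^\pi\circ\mathtt s_\rho^\pi\sqsubseteq\underline{\mathtt r}^\pi$ or $\ \mathtt s_\rho^\pi\circ\underline{\mathtt r}^\pi\circ\mathtt r^\pi\sqsubseteq\mathtt r^\pi$, according to which of the four shapes above $\rho$ has; 3. $\top\sqsubseteq\bigsqcap_{\pi\in\Pi_\varphi}\mathrm{trans}(\pi,\varphi')\sqcap\bigsqcap_{\pi\in\Pi_\varphi}\forall\mathtt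 u.\mathtt M^*_\pi$. Here $\mathrm{trans}(\pi,\cdot)$ turns $\wedge,\vee$ into $\sqcap,\sqcup$, $\ \mathrm{trans}(\pi',\Box_e\psi)=\bigsqcap_{\pi}(\neg\mathrm{tr}(\pi,e)\sqcup\mathrm{trans}(\pi,\psi))$, $\ \mathrm{trans}(\pi',\Diamond_e\psi)=\bigsqcup_{\pi}(\mathrm{tr}(\pi,e)\sqcap\mathrm{trans}(\pi,\psi))$, with $\mathrm{tr}(\pi,s)=\forall\mathtt u.\mathtt M^s_\pi$ and $\cup,\cap,\setminus$ translated to the corresponding Boolean combinations. Unnegated axioms become: $\rho\mapsto\forall\mathtt u.\exists\mathtt s^\pi_\rho.\mathit{Self}$; $\ C\sqsubseteq D\mapsto\forall\mathtt u.(\neg C\sqcup D)^\pi$; $\ C(a)\mapsto\exists\mathtt u.(\{a\}\sqcap C^\pi)$; $\ r(a,b)\mapsto\exists\mathtt u.(\{a\}\sqcap\exists\underline r^\pi.\{b\})$; $\ a\doteq b\mapsto\exists\mathtt u.(\{a\}\sqcap\{b\})$; $\ a\not\doteq b\mapsto\exists\mathtt u.(\{a\}\sqcap\neg\{b\})$.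 Negated axioms become, where $r_1\circ\dots\circ r_m$ is the whole left-hand side of $\rho$ and $\mathtt r$ its right-hand side: $\rho\mapsto\exists\mathtt u.\big((\forall\mathtt r^\pi.\neg\{a^\pi_\rho\})\sqcap\exists\underline r_1^\pi\dots\exists\underline r_m^\pi.\{a^\pi_\rho\}\big)$; $\ C\sqsubseteq D\mapsto\exists\mathtt u.(C\sqcap\neg D)^\pi$; $\ C(a)\mapsto\exists\mathtt u.(\{a\}\sqcap(\neg C)^\pi)$; $\ r(a,b)\mapsto\exists\mathtt u.(\{a\}\sqcap\forall r^\pi.\neg\{b\})$; $\ a\doteq b\mapsto\exists\mathtt u.(\{a\}\sqcap\neg\{b\})$; $\ a\not\doteq b\mapsto\exists\mathtt u.(\{a\}\sqcap\{b\})$. **Theorem.** For every sentential Standpoint-$\mathcal{SROIQ}b_s$ sentence $\varphi$: (i) $\mathrm{Trans}(\varphi)$ is a valid $\mathcal{SROIQ}b_s$ knowledge base with respect to the new simple and non-simple role names and the new strict order $\prec$; (ii) $\mathrm{Trans}(\varphi)$ is satisfiable if and only if $\varphi$ is satisfiable; (iii) the size of $\mathrm{Trans}(\varphi)$ is bounded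 by a polynomial in the size of $\varphi$; and (iv) $\mathrm{Trans}(\varphi)$ can be computed from $\varphi$ in polynomial time. In (iii) and (iv), size means the length of a standard encoding of the syntax, with the numbers in number restrictions written in binary. -/

import Mathlib

universe u v

namespace SROIQ

/-! ## Vocabularies, roles, role inclusion axioms -/

/-- A vocabulary: individual names, concept names, simple role names, and non-simple role names
other than the universal role. -/
structure Sig where
  Ind : Type
  Con : Type
  Simp : Type
  NonSimp : Type

/-- Non-simple role names: the declared ones and the universal role. -/
inductive NName (N : Type) where
  | named (r : N)
  | univ

/-- Role names. -/
inductive RName (S N : Type) where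
  | simple (s : S)
  | nonsimple (r : NName N)

/-- Raw role expressions; `Role.Simple` and `Role.Valid` single out the well-formed ones. -/
inductive Role (S N : Type) where
  | name (r : RName S N)
  | inv (r : RName S N)
  | union (r₁ r₂ : Role S N)
  | inter (r₁ r₂ : Role S N)
  | diff (r₁ r₂ : Role S N)

/-- The universal role as a role expression. -/
abbrev Role.univ {S N : Type} : Role S N := .name (.nonsimple .univ)

/-- Role inclusion axioms. With `ws = [r₁, …, rₙ]` the four shapes are
`r₁ ∘ … ∘ rₙ ⊑ r`, `r₁ ∘ … ∘ rₙ ∘ r ⊑ r`, `r ∘ r₁ ∘ … ∘ rₙ ⊑ r` and `r ∘ r ⊑ r`. -/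
inductive RIA (S N : Type) where
  | plain (ws : List (Role S N)) (r : RName S N)
  | right (ws : List (Role S N)) (r : RName S N)
  | left (ws : List (Role S N)) (r : RName S N)
  | trans (r : RName S N)

/-- The role on the right-hand side. -/
def RIA.head {S N : Type} : RIA S N → RName S N
  | .plain _ r => r
  | .right _ r => r
  | .left _ r => r
  | .trans r => r

/-- The whole role chain on the left-hand side. -/
def RIA.body {S N : Type} : RIA S N → List (Role S N)
  | .plain ws _ => ws
  | .right ws r => ws ++ [.name r]
  | .left ws r => .name r :: ws
  | .trans r => [.name r, .name r]

/-! ## Concepts, axioms, standpoint sentences -/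

/-- Raw concept expressions. -/
inductive Concept (σ : Sig) where
  | atom (A : σ.Con)
  | nominal (a : σ.Ind)
  | top
  | bot
  | neg (C : Concept σ)
  | inf (C D : Concept σ)
  | sup (C D : Concept σ)
  | all (r : Role σ.Simp σ.NonSimp) (C : Concept σ)
  | ex (r : Role σ.Simp σ.NonSimp) (C : Concept σ)
  | self (r : Role σ.Simp σ.NonSimp)
  | atMost (n : ℕ) (r : Role σ.Simp σ.NonSimp) (C : Concept σ)
  | atLeast (n : ℕ) (r : Role σ.Simp σ.NonSimp) (C : Concept σ)

/-- Axioms: assertions, (in)equalities, general concept inclusions, role inclusion axioms. -/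
inductive Axm (σ : Sig) where
  | inst (C : Concept σ) (a : σ.Ind)
  | link (r : Role σ.Simp σ.NonSimp) (a b : σ.Ind)
  | eq (a b : σ.Ind)
  | ne (a b : σ.Ind)
  | gci (C D : Concept σ)
  | ria (ρ : RIA σ.Simp σ.NonSimp)

/-- The universal standpoint `*` and the standpoint symbols. -/
inductive StName where
  | star
  | sym (s : ℕ)

/-- Standpoint expressions. -/
inductive StExpr where
  | base (s : StName)
  | union (e₁ e₂ : StExpr)
  | inter (e₁ e₂ : StExpr)
  | diff (e₁ e₂ : StExpr)

/-- Sentential standpoint sentences over the axioms of a vocabulary. -/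
inductive Sent (σ : Sig) where
  | ax (α : Axm σ)
  | neg (φ : Sent σ)
  | and (φ ψ : Sent σ)
  | or (φ ψ : Sent σ)
  | box (e : StExpr) (φ : Sent σ)
  | dia (e : StExpr) (φ : Sent σ)

/-- A knowledge base is a finite set of axioms, given by listing its elements. -/
abbrev KB (σ : Sig) := List (Axm σ)

/-! ## Well-formedness: simplicity and regularity -/

section Validity

variable {S N : Type} {σ : Sig}

def RName.IsSimple : RName S N → Prop
  | .simple _ => True
  | .nonsimple _ => False

/-- Simple role expressions: safe Boolean combinations of simple role names and their inverses. -/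
def Role.Simple : Role S N → Prop
  | .name r => r.IsSimple
  | .inv r => r.IsSimple
  | .union r₁ r₂ => r₁.Simple ∧ r₂.Simple
  | .inter r₁ r₂ => r₁.Simple ∧ r₂.Simple
  | .diff r₁ r₂ => r₁.Simple ∧ r₂.Simple

/-- Role expressions: the simple ones and the non-simple role names. -/
def Role.Valid (r : Role S N) : Prop :=
  r.Simple ∨ ∃ h, r = .name (.nonsimple h)

/-- The order on non-simple role names, extended to role expressions by putting the simple ones
below all non-simple role names. -/
def Role.Below (prec : NName N → NName N → Prop) (r : Role S N) (h : NName N) : Prop :=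
  r.Simple ∨ ∃ k, r = .name (.nonsimple k) ∧ prec k h

/-- The right-hand side is a non-simple role name `r`, and all `rᵢ` satisfy `rᵢ ≺ r`. -/
def RIA.Valid (prec : NName N → NName N → Prop) : RIA S N → Prop
  | .plain ws r => ws ≠ [] ∧ ∃ h, r = .nonsimple h ∧ ∀ w ∈ ws, w.Below prec h
  | .right ws r => ws ≠ [] ∧ ∃ h, r = .nonsimple h ∧ ∀ w ∈ ws, w.Below prec h
  | .left ws r => ws ≠ [] ∧ ∃ h, r = .nonsimple h ∧ ∀ w ∈ ws, w.Below prec h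
  | .trans r => ∃ h, r = .nonsimple h

/-- Only simple roles in `Self` concepts and number restrictions. -/
def Concept.Valid : Concept σ → Prop
  | .atom _ => True
  | .nominal _ => True
  | .top => True
  | .bot => True
  | .neg C => C.Valid
  | .inf C D => C.Valid ∧ D.Valid
  | .sup C D => C.Valid ∧ D.Valid
  | .all r C => r.Valid ∧ C.Valid
  | .ex r C => r.Valid ∧ C.Valid
  | .self r => r.Simple
  | .atMost _ r C => r.Simple ∧ C.Valid
  | .atLeast _ r C => r.Simple ∧ C.Valid

def Axm.Valid (prec : NName σ.NonSimp → NName σ.NonSimp → Prop) : Axm σ → Prop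
  | .inst C _ => C.Valid
  | .link r _ _ => r.Valid
  | .eq _ _ => True
  | .ne _ _ => True
  | .gci C D => C.Valid ∧ D.Valid
  | .ria ρ => ρ.Valid prec

def Sent.Valid (prec : NName σ.NonSimp → NName σ.NonSimp → Prop) : Sent σ → Prop
  | .ax α => α.Valid prec
  | .neg φ => φ.Valid prec
  | .and φ ψ => φ.Valid prec ∧ ψ.Valid prec
  | .or φ ψ => φ.Valid prec ∧ ψ.Valid prec
  | .box _ φ => φ.Valid prec
  | .dia _ φ => φ.Valid prec

/-- A valid knowledge base over non-simple role names ordered by `prec`: the order is a strict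
order and all axioms are well-formed with respect to it. -/
def KB.Valid (prec : NName σ.NonSimp → NName σ.NonSimp → Prop) (K : KB σ) : Prop :=
  IsStrictOrder (NName σ.NonSimp) prec ∧ ∀ α ∈ K, α.Valid prec

end Validity

/-! ## Semantics -/

/-- Interpretations with domain `Δ`; the universal role is not interpreted freely. -/
structure Interp (σ : Sig) (Δ : Type u) where
  ind : σ.Ind → Δ
  con : σ.Con → Set Δ
  simp : σ.Simp → Δ → Δ → Prop
  nonsimp : σ.NonSimp → Δ → Δ → Prop

section Semantics

variable {σ : Sig} {Δ : Type u}

def Interp.rname (I : Interp σ Δ) : RName σ.Simp σ.NonSimp → Δ → Δ → Prop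
  | .simple s => I.simp s
  | .nonsimple (.named r) => I.nonsimp r
  | .nonsimple .univ => fun _ _ => True

def Interp.role (I : Interp σ Δ) : Role σ.Simp σ.NonSimp → Δ → Δ → Prop
  | .name r => I.rname r
  | .inv r => fun x y => I.rname r y x
  | .union r₁ r₂ => fun x y => I.role r₁ x y ∨ I.role r₂ x y
  | .inter r₁ r₂ => fun x y => I.role r₁ x y ∧ I.role r₂ x y
  | .diff r₁ r₂ => fun x y => I.role r₁ x y ∧ ¬ I.role r₂ x y

/-- Composition of a chain of roles. -/
def Interp.chain (I : Interp σ Δ) : List (Role σ.Simp σ.NonSimp) → Δ → Δ → Prop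
  | [] => fun x y => x = y
  | r :: rs => fun x y => ∃ z, I.role r x z ∧ I.chain rs z y

def Interp.concept (I : Interp σ Δ) : Concept σ → Set Δ
  | .atom A => I.con A
  | .nominal a => {I.ind a}
  | .top => Set.univ
  | .bot => ∅
  | .neg C => (I.concept C)ᶜ
  | .inf C D => I.concept C ∩ I.concept D
  | .sup C D => I.concept C ∪ I.concept D
  | .all r C => {x | ∀ y, I.role r x y → y ∈ I.concept C}
  | .ex r C => {x | ∃ y, I.role r x y ∧ y ∈ I.concept C}
  | .self r => {x | I.role r x x}
  | .atMost n r C => {x | Set.encard {y | y ∈ I.concept C ∧ I.role r x y} ≤ n}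
  | .atLeast n r C => {x | (n : ℕ∞) ≤ Set.encard {y | y ∈ I.concept C ∧ I.role r x y}}

/-- Satisfaction of an axiom. -/
def Interp.Sat (I : Interp σ Δ) : Axm σ → Prop
  | .inst C a => I.ind a ∈ I.concept C
  | .link r a b => I.role r (I.ind a) (I.ind b)
  | .eq a b => I.ind a = I.ind b
  | .ne a b => I.ind a ≠ I.ind b
  | .gci C D => I.concept C ⊆ I.concept D
  | .ria ρ => ∀ x y, I.chain ρ.body x y → I.rname ρ.head x y

/-- A knowledge base is satisfiable if it has a model with a non-empty domain. -/
def KB.Satisfiable (K : KB σ) : Prop :=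
  ∃ (Δ : Type u) (_ : Nonempty Δ) (I : Interp σ Δ), ∀ α ∈ K, I.Sat α

/-- Standpoint structures with domain `Δ` and set of precisifications `P`
(constant domain, rigid individual names). -/
structure StandStr (σ : Sig) (Δ : Type u) (P : Type v) where
  stand : ℕ → Set P
  interp : P → Interp σ Δ
  rigid : ∀ (p q : P) (a : σ.Ind), (interp p).ind a = (interp q).ind a

variable {P : Type v}

/-- The set of precisifications denoted by a standpoint expression. -/
def StandStr.expr (M : StandStr σ Δ P) : StExpr → Set P
  | .base .star => Set.univ
  | .base (.sym s) => M.stand s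
  | .union e₁ e₂ => M.expr e₁ ∪ M.expr e₂
  | .inter e₁ e₂ => M.expr e₁ ∩ M.expr e₂
  | .diff e₁ e₂ => M.expr e₁ \ M.expr e₂

/-- Satisfaction of a sentence at a precisification. -/
def StandStr.SatAt (M : StandStr σ Δ P) : P → Sent σ → Prop
  | p, .ax α => (M.interp p).Sat α
  | p, .neg φ => ¬ M.SatAt p φ
  | p, .and φ ψ => M.SatAt p φ ∧ M.SatAt p ψ
  | p, .or φ ψ => M.SatAt p φ ∨ M.SatAt p ψ
  | _, .box e φ => ∀ q ∈ M.expr e, M.SatAt q φ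
  | _, .dia e φ => ∃ q ∈ M.expr e, M.SatAt q φ

/-- A sentence is satisfiable if some standpoint structure with non-empty domain and non-empty set
of precisifications satisfies it at all precisifications. -/
def Sent.Satisfiable (φ : Sent σ) : Prop :=
  ∃ (Δ : Type u) (P : Type v) (_ : Nonempty Δ) (_ : Nonempty P) (M : StandStr σ Δ P),
    ∀ p, M.SatAt p φ

end Semantics

/-! ## Size and normal forms of sentences -/

section NormalForms

variable {σ : Sig}

/-- The set of subsentences (axioms are atomic). -/
def Sent.sub : Sent σ → Set (Sent σ)
  | .ax α => {.ax α}
  | .neg φ => {.neg φ} ∪ φ.sub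
  | .and φ ψ => {.and φ ψ} ∪ (φ.sub ∪ ψ.sub)
  | .or φ ψ => {.or φ ψ} ∪ (φ.sub ∪ ψ.sub)
  | .box e φ => {.box e φ} ∪ φ.sub
  | .dia e φ => {.dia e φ} ∪ φ.sub

/-- The number of subsentences; it fixes how many precisifications the translation uses. -/
noncomputable def Sent.card (φ : Sent σ) : ℕ := φ.sub.ncard

/-- Negation normal form of `φ` (`pos = true`) or of `¬φ` (`pos = false`). -/
def Sent.nnf : Bool → Sent σ → Sent σ
  | true, .ax α => .ax α
  | false, .ax α => .neg (.ax α)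
  | pos, .neg φ => φ.nnf (!pos)
  | true, .and φ ψ => .and (φ.nnf true) (ψ.nnf true)
  | false, .and φ ψ => .or (φ.nnf false) (ψ.nnf false)
  | true, .or φ ψ => .or (φ.nnf true) (ψ.nnf true)
  | false, .or φ ψ => .and (φ.nnf false) (ψ.nnf false)
  | true, .box e φ => .box e (φ.nnf true)
  | false, .box e φ => .dia e (φ.nnf false)
  | true, .dia e φ => .dia e (φ.nnf true)
  | false, .dia e φ => .box e (φ.nnf false)

/-- The nesting depth of modal operators. -/
def Sent.degree : Sent σ → ℕ
  | .ax _ => 0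
  | .neg φ => φ.degree
  | .and φ ψ => max φ.degree ψ.degree
  | .or φ ψ => max φ.degree ψ.degree
  | .box _ φ => φ.degree + 1
  | .dia _ φ => φ.degree + 1

/-- The vocabulary extended by a fresh concept name for every sentence. -/
abbrev Sig.ext (σ : Sig) : Sig := ⟨σ.Ind, σ.Con ⊕ Sent σ, σ.Simp, σ.NonSimp⟩

/-- Reading concepts, axioms and sentences in the extended vocabulary. -/
def Concept.lift : Concept σ → Concept σ.ext
  | .atom A => .atom (.inl A)
  | .nominal a => .nominal a
  | .top => .top
  | .bot => .bot
  | .neg C => .neg C.lift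
  | .inf C D => .inf C.lift D.lift
  | .sup C D => .sup C.lift D.lift
  | .all r C => .all r C.lift
  | .ex r C => .ex r C.lift
  | .self r => .self r
  | .atMost n r C => .atMost n r C.lift
  | .atLeast n r C => .atLeast n r C.lift

def Axm.lift : Axm σ → Axm σ.ext
  | .inst C a => .inst C.lift a
  | .link r a b => .link r a b
  | .eq a b => .eq a b
  | .ne a b => .ne a b
  | .gci C D => .gci C.lift D.lift
  | .ria ρ => .ria ρ

def Sent.lift : Sent σ → Sent σ.ext
  | .ax α => .ax α.lift
  | .neg φ => .neg φ.lift
  | .and φ ψ => .and φ.lift ψ.lift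
  | .or φ ψ => .or φ.lift ψ.lift
  | .box e φ => .box e φ.lift
  | .dia e φ => .dia e φ.lift

/-- The literal standing for a sentence in negation normal form: possibly negated axioms stand
for themselves, any other `ψ` is represented by the axiom `⊤ ⊑ P_ψ` with `P_ψ` fresh. -/
def Sent.lit : Sent σ → Sent σ.ext
  | .ax α => .ax α.lift
  | .neg (.ax α) => .neg (.ax α.lift)
  | ψ => .ax (.gci .top (.atom (.inr ψ)))

/-- The conjuncts `L_ψ → …` that define the literals `L_ψ` of the subsentences `ψ` of a sentence in
negation normal form (so only positive polarity occurs). -/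
def Sent.defs : Sent σ → List (Sent σ.ext)
  | .ax _ => []
  | .neg _ => []
  | .and φ ψ => .or (.neg (Sent.and φ ψ).lit) (.and φ.lit ψ.lit) :: (φ.defs ++ ψ.defs)
  | .or φ ψ => .or (.neg (Sent.or φ ψ).lit) (.or φ.lit ψ.lit) :: (φ.defs ++ ψ.defs)
  | .box e φ => .or (.neg (Sent.box e φ).lit) (.box e φ.lit) :: φ.defs
  | .dia e φ => .or (.neg (Sent.dia e φ).lit) (.dia e φ.lit) :: φ.defs

/-- The structure-preserving transformation of a sentence in negation normal form into one without
nested modalities. -/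
def Sent.structural (φ : Sent σ) : Sent σ.ext := φ.defs.foldl .and φ.lit

/-- Negation normal form without nested modalities. The structural transformation is applied only
where there are nested modalities to remove. -/
def Sent.normal (φ : Sent σ) : Sent σ.ext :=
  if φ.degree ≤ 1 then (φ.nnf true).lift else (φ.nnf true).structural

end NormalForms

/-- Negation normal form of `C` (`pos = true`) or of `¬C` (`pos = false`): negation only in front
of concept names, nominals and `Self` concepts. -/
def Concept.nnf {σ : Sig} : Bool → Concept σ → Concept σ
  | true, .atom A => .atom A
  | false, .atom A => .neg (.atom A)
  | true, .nominal a => .nominal a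
  | false, .nominal a => .neg (.nominal a)
  | true, .top => .top
  | false, .top => .bot
  | true, .bot => .bot
  | false, .bot => .top
  | pos, .neg C => C.nnf (!pos)
  | true, .inf C D => .inf (C.nnf true) (D.nnf true)
  | false, .inf C D => .sup (C.nnf false) (D.nnf false)
  | true, .sup C D => .sup (C.nnf true) (D.nnf true)
  | false, .sup C D => .inf (C.nnf false) (D.nnf false)
  | true, .all r C => .all r (C.nnf true)
  | false, .all r C => .ex r (C.nnf false)
  | true, .ex r C => .ex r (C.nnf true)
  | false, .ex r C => .all r (C.nnf false)
  | true, .self r => .self r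
  | false, .self r => .neg (.self r)
  | true, .atMost n r C => .atMost n r (C.nnf true)
  | false, .atMost n r C => .atLeast (n + 1) r (C.nnf true)
  | true, .atLeast n r C => .atLeast n r (C.nnf true)
  | false, .atLeast 0 _ _ => .bot
  | false, .atLeast (n + 1) r C => .atMost n r (C.nnf true)

/-! ## The vocabulary of the translation

Precisifications are the numbers `0, …, n - 1`. -/

/-- The original individual names, and fresh names for role inclusion axioms. -/
inductive TInd (σ : Sig) where
  | orig (a : σ.Ind)
  | fresh (ρ : RIA σ.Simp σ.NonSimp) (π : ℕ)

/-- The copies of the concept names, and the names `M^s_π`. -/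
inductive TCon (σ : Sig) where
  | copy (A : σ.Con) (π : ℕ)
  | stand (s : StName) (π : ℕ)

/-- The copies of the simple role names, and the guard roles. -/
inductive TSimp (σ : Sig) where
  | copy (s : σ.Simp) (π : ℕ)
  | guard (ρ : RIA σ.Simp σ.NonSimp) (π : ℕ)

/-- The copies of the non-simple role names, and their lower approximations. -/
inductive TNonSimp (σ : Sig) where
  | copy (r : σ.NonSimp) (π : ℕ)
  | lower (r : σ.NonSimp) (π : ℕ)

abbrev Sig.trans (σ : Sig) : Sig := ⟨TInd σ, TCon σ, TSimp σ, TNonSimp σ⟩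

/-- The original of a non-simple role name. -/
def origName {σ : Sig} : NName (TNonSimp σ) → NName σ.NonSimp
  | .named (.copy r _) => .named r
  | .named (.lower r _) => .named r
  | .univ => .univ

/-- The order on the new non-simple role names: inherited from the originals, and the lower
approximation of a copy is below that copy. -/
def transPrec {σ : Sig} (prec : NName σ.NonSimp → NName σ.NonSimp → Prop)
    (x y : NName (TNonSimp σ)) : Prop :=
  prec (origName x) (origName y) ∨
    ∃ r π, x = .named (.lower r π) ∧ y = .named (.copy r π)

/-! ## The translation -/

section Translation

variable {σ : Sig}

/-- `r ↦ r^π` on role names. -/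
def RName.at (π : ℕ) : RName σ.Simp σ.NonSimp → RName (TSimp σ) (TNonSimp σ)
  | .simple s => .simple (.copy s π)
  | .nonsimple (.named r) => .nonsimple (.named (.copy r π))
  | .nonsimple .univ => .nonsimple .univ

/-- `r ↦ r^π` on role expressions. -/
def Role.at (π : ℕ) : Role σ.Simp σ.NonSimp → Role (TSimp σ) (TNonSimp σ)
  | .name r => .name (RName.at π r)
  | .inv r => .inv (RName.at π r)
  | .union r₁ r₂ => .union (Role.at π r₁) (Role.at π r₂)
  | .inter r₁ r₂ => .inter (Role.at π r₁) (Role.at π r₂)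
  | .diff r₁ r₂ => .diff (Role.at π r₁) (Role.at π r₂)

/-- The lower approximation of `r^π`: it differs from `r^π` only for non-simple role names other
than the universal role. -/
def Role.lowerAt (π : ℕ) : Role σ.Simp σ.NonSimp → Role (TSimp σ) (TNonSimp σ)
  | .name (.nonsimple (.named r)) => .name (.nonsimple (.named (.lower r π)))
  | r => Role.at π r

/-- Replacing names by their `π`-copies, and non-simple roles by their lower approximation in
existential restrictions. Fillers of `≤ n` are antitone positions; for those (`pos = false`) the
lower approximation is used dually, in universal restrictions. -/
def Concept.replace (π : ℕ) : Bool → Concept σ → Concept σ.trans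
  | _, .atom A => .atom (.copy A π)
  | _, .nominal a => .nominal (.orig a)
  | _, .top => .top
  | _, .bot => .bot
  | pos, .neg C => .neg (C.replace π (!pos))
  | pos, .inf C D => .inf (C.replace π pos) (D.replace π pos)
  | pos, .sup C D => .sup (C.replace π pos) (D.replace π pos)
  | true, .all r C => .all (Role.at π r) (C.replace π true)
  | false, .all r C => .all (Role.lowerAt π r) (C.replace π false)
  | true, .ex r C => .ex (Role.lowerAt π r) (C.replace π true)
  | false, .ex r C => .ex (Role.at π r) (C.replace π false)
  | _, .self r => .self (Role.at π r)
  | pos, .atMost n r C => .atMost n (Role.at π r) (C.replace π (!pos))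
  | pos, .atLeast n r C => .atLeast n (Role.at π r) (C.replace π pos)

/-- `C ↦ C^π`. -/
def Concept.at (π : ℕ) (C : Concept σ) : Concept σ.trans := (C.nnf true).replace π true

/-- Finite conjunctions and disjunctions of concepts. -/
def bigInf (l : List (Concept σ)) : Concept σ := l.foldr .inf .top

def bigSup (l : List (Concept σ)) : Concept σ := l.foldr .sup .bot

/-- The translation of a standpoint expression at `π`. -/
def StExpr.trans (σ : Sig) (π : ℕ) : StExpr → Concept σ.trans
  | .base s => .all .univ (.atom (.stand s π))
  | .union e₁ e₂ => .sup (e₁.trans σ π) (e₂.trans σ π)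
  | .inter e₁ e₂ => .inf (e₁.trans σ π) (e₂.trans σ π)
  | .diff e₁ e₂ => .inf (e₁.trans σ π) (.neg (e₂.trans σ π))

/-- `∃ r₁. … ∃ rₘ. C` -/
def exChain (rs : List (Role σ.Simp σ.NonSimp)) (C : Concept σ) : Concept σ := rs.foldr .ex C

/-- The translation of an unnegated axiom. -/
def Axm.transPos (π : ℕ) : Axm σ → Concept σ.trans
  | .ria ρ => .all .univ (.self (.name (.simple (.guard ρ π))))
  | .gci C D => .all .univ ((Concept.sup (.neg C) D).at π)
  | .inst C a => .ex .univ (.inf (.nominal (.orig a)) (C.at π))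
  | .link r a b =>
      .ex .univ (.inf (.nominal (.orig a)) (.ex (Role.lowerAt π r) (.nominal (.orig b))))
  | .eq a b => .ex .univ (.inf (.nominal (.orig a)) (.nominal (.orig b)))
  | .ne a b => .ex .univ (.inf (.nominal (.orig a)) (.neg (.nominal (.orig b))))

/-- The translation of a negated axiom. -/
def Axm.transNeg (π : ℕ) : Axm σ → Concept σ.trans
  | .ria ρ => .ex .univ (.inf
      (.all (.name (RName.at π ρ.head)) (.neg (.nominal (.fresh ρ π))))
      (exChain (ρ.body.map (Role.lowerAt π)) (.nominal (.fresh ρ π))))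
  | .gci C D => .ex .univ ((Concept.inf C (.neg D)).at π)
  | .inst C a => .ex .univ (.inf (.nominal (.orig a)) ((Concept.neg C).at π))
  | .link r a b =>
      .ex .univ (.inf (.nominal (.orig a)) (.all (Role.at π r) (.neg (.nominal (.orig b)))))
  | .eq a b => .ex .univ (.inf (.nominal (.orig a)) (.neg (.nominal (.orig b))))
  | .ne a b => .ex .univ (.inf (.nominal (.orig a)) (.nominal (.orig b)))

/-- The translation at `π` of a sentence in negation normal form, for the `n` precisifications
`0, …, n - 1`. Negations of compound sentences do not occur in negation normal form. -/
def Sent.transAt (n : ℕ) : ℕ → Sent σ → Concept σ.trans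
  | π, .ax α => α.transPos π
  | π, .neg (.ax α) => α.transNeg π
  | _, .neg _ => .bot
  | π, .and φ ψ => .inf (φ.transAt n π) (ψ.transAt n π)
  | π, .or φ ψ => .sup (φ.transAt n π) (ψ.transAt n π)
  | _, .box e φ =>
      bigInf ((List.range n).map fun π => .sup (.neg (e.trans σ π)) (φ.transAt n π))
  | _, .dia e φ =>
      bigSup ((List.range n).map fun π => .inf (e.trans σ π) (φ.transAt n π))

/-- The guarded version of a role inclusion axiom at `π`. Axioms with the universal role on the
right-hand side are tautologies and have no guarded version. -/
def RIA.guarded (π : ℕ) (ρ : RIA σ.Simp σ.NonSimp) : Option (RIA (TSimp σ) (TNonSimp σ)) :=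
  let g : Role (TSimp σ) (TNonSimp σ) := .name (.simple (.guard ρ π))
  match ρ with
  | .plain ws (.nonsimple (.named r)) =>
      some (.plain (g :: ws.map (Role.at π)) (.nonsimple (.named (.lower r π))))
  | .right ws (.nonsimple (.named r)) =>
      some (.right (g :: ws.map (Role.at π)) (.nonsimple (.named (.lower r π))))
  | .left ws (.nonsimple (.named r)) =>
      some (.left (ws.map (Role.at π) ++ [g]) (.nonsimple (.named (.lower r π))))
  | .trans (.nonsimple (.named r)) =>
      some (.right [g, .name (.nonsimple (.named (.lower r π)))]
        (.nonsimple (.named (.copy r π))))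
  | _ => none

/-- The role inclusion axioms occurring unnegated in a sentence in negation normal form. -/
def Sent.posRIAs : Sent σ → List (RIA σ.Simp σ.NonSimp)
  | .ax (.ria ρ) => [ρ]
  | .ax _ => []
  | .neg _ => []
  | .and φ ψ => φ.posRIAs ++ ψ.posRIAs
  | .or φ ψ => φ.posRIAs ++ ψ.posRIAs
  | .box _ φ => φ.posRIAs
  | .dia _ φ => φ.posRIAs

end Translation

/-! The non-simple role names, other than the universal role, that occur in an expression. -/

section Occurrences

variable {S N : Type} {σ : Sig}

def RName.nonsimples : RName S N → List N
  | .nonsimple (.named r) => [r]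
  | _ => []

def Role.nonsimples : Role S N → List N
  | .name r => r.nonsimples
  | .inv r => r.nonsimples
  | .union r₁ r₂ => r₁.nonsimples ++ r₂.nonsimples
  | .inter r₁ r₂ => r₁.nonsimples ++ r₂.nonsimples
  | .diff r₁ r₂ => r₁.nonsimples ++ r₂.nonsimples

def RIA.nonsimples (ρ : RIA S N) : List N :=
  ρ.body.flatMap Role.nonsimples ++ ρ.head.nonsimples

def Concept.nonsimples : Concept σ → List σ.NonSimp
  | .atom _ => []
  | .nominal _ => []
  | .top => []
  | .bot => []
  | .neg C => C.nonsimples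
  | .inf C D => C.nonsimples ++ D.nonsimples
  | .sup C D => C.nonsimples ++ D.nonsimples
  | .all r C => r.nonsimples ++ C.nonsimples
  | .ex r C => r.nonsimples ++ C.nonsimples
  | .self r => r.nonsimples
  | .atMost _ r C => r.nonsimples ++ C.nonsimples
  | .atLeast _ r C => r.nonsimples ++ C.nonsimples

def Axm.nonsimples : Axm σ → List σ.NonSimp
  | .inst C _ => C.nonsimples
  | .link r _ _ => r.nonsimples
  | .eq _ _ => []
  | .ne _ _ => []
  | .gci C D => C.nonsimples ++ D.nonsimples
  | .ria ρ => ρ.nonsimples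

def Sent.nonsimples : Sent σ → List σ.NonSimp
  | .ax α => α.nonsimples
  | .neg φ => φ.nonsimples
  | .and φ ψ => φ.nonsimples ++ ψ.nonsimples
  | .or φ ψ => φ.nonsimples ++ ψ.nonsimples
  | .box _ φ => φ.nonsimples
  | .dia _ φ => φ.nonsimples

end Occurrences

/-- The translation, with `n` precisifications, of a sentence in normal form. -/
def Sent.transKB {σ : Sig} (n : ℕ) (φ : Sent σ) : KB σ.trans :=
  ((List.range n).flatMap fun π => φ.nonsimples.map fun r =>
      Axm.ria (.plain [.name (.nonsimple (.named (TNonSimp.lower r π)))]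
        (.nonsimple (.named (TNonSimp.copy r π)))))
  ++ ((List.range n).flatMap fun π => (φ.posRIAs.filterMap (RIA.guarded π)).map Axm.ria)
  ++ [.gci .top (.inf
        (bigInf ((List.range n).map fun π => φ.transAt n π))
        (bigInf ((List.range n).map fun π => .all .univ (.atom (.stand .star π)))))]

/-- The translation of an arbitrary sentence. -/
noncomputable def standpointTrans {σ : Sig} (φ : Sent σ) : KB σ.ext.trans := φ.normal.transKB φ.card

/-! ## Encodings

Syntactic objects are encoded as binary trees, which serve as the data of the machine model below.
The size of an object is the number of nodes of its encoding. -/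

/-- Binary trees (LISP data). -/
inductive Val where
  | nil
  | cons (a b : Val)

def Val.size : Val → ℕ
  | .nil => 1
  | .cons a b => a.size + b.size + 1

def Val.ofList : List Val → Val
  | [] => .nil
  | a :: l => .cons a (Val.ofList l)

/-- Unary numerals. -/
def Val.unary : ℕ → Val
  | 0 => .nil
  | n + 1 => .cons .nil (Val.unary n)

/-- Binary numerals, least significant bit first. -/
def Val.binary (n : ℕ) : Val :=
  Val.ofList (n.bits.map fun b => if b then .cons .nil .nil else .nil)

/-- The `k`-th constructor applied to encoded arguments. -/
def Val.con (k : ℕ) (args : List Val) : Val := .cons (Val.unary k) (Val.ofList args)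

/-- Encodings of the names of a vocabulary. -/
structure SigEnc (σ : Sig) where
  ind : σ.Ind → Val
  con : σ.Con → Val
  simp : σ.Simp → Val
  nonsimp : σ.NonSimp → Val

section Encodings

variable {σ : Sig} (E : SigEnc σ)

def encRName : RName σ.Simp σ.NonSimp → Val
  | .simple s => .con 0 [E.simp s]
  | .nonsimple (.named r) => .con 1 [E.nonsimp r]
  | .nonsimple .univ => .con 2 []

def encRole : Role σ.Simp σ.NonSimp → Val
  | .name r => .con 0 [encRName E r]
  | .inv r => .con 1 [encRName E r]
  | .union r₁ r₂ => .con 2 [encRole r₁, encRole r₂]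
  | .inter r₁ r₂ => .con 3 [encRole r₁, encRole r₂]
  | .diff r₁ r₂ => .con 4 [encRole r₁, encRole r₂]

def encRIA : RIA σ.Simp σ.NonSimp → Val
  | .plain ws r => .con 0 [.ofList (ws.map (encRole E)), encRName E r]
  | .right ws r => .con 1 [.ofList (ws.map (encRole E)), encRName E r]
  | .left ws r => .con 2 [.ofList (ws.map (encRole E)), encRName E r]
  | .trans r => .con 3 [encRName E r]

def encConcept : Concept σ → Val
  | .atom A => .con 0 [E.con A]
  | .nominal a => .con 1 [E.ind a]
  | .top => .con 2 []
  | .bot => .con 3 []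
  | .neg C => .con 4 [encConcept C]
  | .inf C D => .con 5 [encConcept C, encConcept D]
  | .sup C D => .con 6 [encConcept C, encConcept D]
  | .all r C => .con 7 [encRole E r, encConcept C]
  | .ex r C => .con 8 [encRole E r, encConcept C]
  | .self r => .con 9 [encRole E r]
  | .atMost n r C => .con 10 [.binary n, encRole E r, encConcept C]
  | .atLeast n r C => .con 11 [.binary n, encRole E r, encConcept C]

def encAxm : Axm σ → Val
  | .inst C a => .con 0 [encConcept E C, E.ind a]
  | .link r a b => .con 1 [encRole E r, E.ind a, E.ind b]
  | .eq a b => .con 2 [E.ind a, E.ind b]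
  | .ne a b => .con 3 [E.ind a, E.ind b]
  | .gci C D => .con 4 [encConcept E C, encConcept E D]
  | .ria ρ => .con 5 [encRIA E ρ]

def encStName : StName → Val
  | .star => .con 0 []
  | .sym s => .con 1 [.binary s]

def encStExpr : StExpr → Val
  | .base s => .con 0 [encStName s]
  | .union e₁ e₂ => .con 1 [encStExpr e₁, encStExpr e₂]
  | .inter e₁ e₂ => .con 2 [encStExpr e₁, encStExpr e₂]
  | .diff e₁ e₂ => .con 3 [encStExpr e₁, encStExpr e₂]

def encSent : Sent σ → Val
  | .ax α => .con 0 [encAxm E α]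
  | .neg φ => .con 1 [encSent φ]
  | .and φ ψ => .con 2 [encSent φ, encSent ψ]
  | .or φ ψ => .con 3 [encSent φ, encSent ψ]
  | .box e φ => .con 4 [encStExpr e, encSent φ]
  | .dia e φ => .con 5 [encStExpr e, encSent φ]

def encKB (K : KB σ) : Val := .ofList (K.map (encAxm E))

/-- The names of the extended vocabulary. -/
def SigEnc.ext : SigEnc σ.ext where
  ind := E.ind
  con
    | .inl A => .con 0 [E.con A]
    | .inr ψ => .con 1 [encSent E ψ]
  simp := E.simp
  nonsimp := E.nonsimp

/-- The names of the vocabulary of the translation. -/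
def SigEnc.trans : SigEnc σ.trans where
  ind
    | .orig a => .con 0 [E.ind a]
    | .fresh ρ π => .con 1 [encRIA E ρ, .unary π]
  con
    | .copy A π => .con 0 [E.con A, .unary π]
    | .stand s π => .con 1 [encStName s, .unary π]
  simp
    | .copy s π => .con 0 [E.simp s, .unary π]
    | .guard ρ π => .con 1 [encRIA E ρ, .unary π]
  nonsimp
    | .copy r π => .con 0 [E.nonsimp r, .unary π]
    | .lower r π => .con 1 [E.nonsimp r, .unary π]

end Encodings

/-- The source vocabulary: countably many names of each kind. -/
abbrev baseSig : Sig := ⟨ℕ, ℕ, ℕ, ℕ⟩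

/-- Names of the source vocabulary are encoded in binary. -/
def baseEnc : SigEnc baseSig := ⟨.binary, .binary, .binary, .binary⟩

/-- The encodings of sentences and of their translations. -/
def inputEnc : Sent baseSig → Val := encSent baseEnc

def outputEnc : KB baseSig.ext.trans → Val := encKB baseEnc.ext.trans

/-! ## Polynomial time

The machine model is first-order LISP: finitely many mutually recursive unary functions on binary
trees, evaluated call-by-value. Values are pointers to immutable shared cells, so every evaluation
rule is one elementary step, and `t` steps allocate at most `t` cells; writing out the result as a
tree is charged with its size. -/

/-- Expressions; variables are de Bruijn indices into the environment. -/
inductive Expr where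
  | var (i : ℕ)
  | nil
  | cons (a b : Expr)
  /-- `let x := e in b`; `x` is variable `0` of `b`. -/
  | letE (e b : Expr)
  /-- Case distinction on `e`: `a` if `e` is `nil`, and `b` if `e` is `cons x y`, where `x` and `y`
  are the variables `0` and `1` of `b`. -/
  | case (e a b : Expr)
  /-- Call of the `f`-th function of the program. -/
  | call (f : ℕ) (e : Expr)

/-- A program lists the bodies of its functions; the argument is variable `0` of the body. -/
abbrev Prog := List Expr

/-- `Eval p env e v t`: in the environment `env`, the expression `e` evaluates to `v` in `t`
steps. -/
inductive Eval (p : Prog) : List Val → Expr → Val → ℕ → Prop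
  | var {env : List Val} {i : ℕ} {v : Val} (h : env[i]? = some v) : Eval p env (.var i) v 1
  | nil {env : List Val} : Eval p env .nil .nil 1
  | cons {env : List Val} {a b : Expr} {x y : Val} {s t : ℕ}
      (ha : Eval p env a x s) (hb : Eval p env b y t) :
      Eval p env (.cons a b) (.cons x y) (s + t + 1)
  | letE {env : List Val} {e b : Expr} {x v : Val} {s t : ℕ}
      (he : Eval p env e x s) (hb : Eval p (x :: env) b v t) :
      Eval p env (.letE e b) v (s + t + 1)
  | caseNil {env : List Val} {e a b : Expr} {v : Val} {s t : ℕ}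
      (he : Eval p env e .nil s) (ha : Eval p env a v t) :
      Eval p env (.case e a b) v (s + t + 1)
  | caseCons {env : List Val} {e a b : Expr} {x y v : Val} {s t : ℕ}
      (he : Eval p env e (.cons x y) s) (hb : Eval p (x :: y :: env) b v t) :
      Eval p env (.case e a b) v (s + t + 1)
  | call {env : List Val} {f : ℕ} {e body : Expr} {x v : Val} {s t : ℕ}
      (hf : p[f]? = some body) (he : Eval p env e x s) (hb : Eval p [x] body v t) :
      Eval p env (.call f e) v (s + t + 1)

/-- `f` is computable in polynomial time: some program, started with its function `0` on the
encoding of `x`, yields the encoding of `f x`, where the number of steps plus the size of the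
result is bounded by a polynomial in the size of the encoding of `x`. -/
def PolyTimeComputable {α β : Type} (encα : α → Val) (encβ : β → Val) (f : α → β) : Prop :=
  ∃ (p : Prog) (q : Polynomial ℕ), ∀ x : α, ∃ t : ℕ,
    Eval p [encα x] (.call 0 (.var 0)) (encβ (f x)) t ∧
      t + (encβ (f x)).size ≤ q.eval (encα x).size

end SROIQ

open SROIQ

namespace SROIQ

/-! ## Linking programs -/

/-! Finitely many precisifications are simulated by disjoint copies of the vocabulary over one
domain. In negation normal form only diamonds ask for witnesses, and the truth of a modal sentence
does not depend on the current precisification, so one witness per diamond suffices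
(`StandStr.satAt_comap`). Every diamond of the normal form stems from a subsentence of `φ`
(`Sent.dias_normal`), also after the structural transformation that removes nested modalities. Hence
`|φ|` precisifications are enough (`StandStr.exists_small`).

Role inclusion axioms are not concepts, so each is made conditional by a guard role that the concept
`∀u.∃s_ρ.Self` switches on. Transitivity resists this, since `s ∘ r ∘ r ⊑ r` has no admissible
shape. The remedy is to split `r` into a lower approximation `r̲ ≺ r` and to state `s ∘ r̲ ∘ r ⊑ r`.

A model of `φ` yields a model of the translation in which `r̲` and `r` coincide, a guard is the
identity or empty according to whether its axiom holds, and the fresh individuals mark the end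
points of violations (`StandStr.sat_toInterp`). Conversely, in a model of the translation `r` is
reinterpreted as `r̲`, or as the transitive closure of `r̲` if transitivity is switched on. The
result lies between `r̲` and `r` (`Interp.toStandStr_le`). Existential restrictions are translated
with `r̲` and universal ones with `r`, with the roles exchanged at antitone positions; so a
translated concept is contained in its original (`Interp.concept_toStandStr`), and the switched-on
axioms hold (`Interp.sat_ria_toStandStr`). One inclusion is enough because the sentences are in
negation normal form. Together this gives `satisfiable_standpointTrans`.

For polynomial time the translation is rewritten as a function on encodings (`translation_enc`). The
class `PT` of polynomial-time tree functions is closed under composition and under recursion with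
results of polynomial size (`PT.treeRec`); the latter is secured by step functions that grow only
additively in the recursive results (`Lin`). The size bound follows, as writing out the result is
part of the cost. -/

def Expr.shift (k : ℕ) : Expr → Expr
  | .var i => .var i
  | .nil => .nil
  | .cons a b => .cons (a.shift k) (b.shift k)
  | .letE e b => .letE (e.shift k) (b.shift k)
  | .case e a b => .case (e.shift k) (a.shift k) (b.shift k)
  | .call f e => .call (k + f) (e.shift k)

/-- Only calls consult the program, and the shifted index finds the shifted body behind `pre`;
values and step counts stay the same. -/
theorem Eval.shift {p : Prog} {env : List Val} {e : Expr} {v : Val} {t : ℕ}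
    (h : Eval p env e v t) (pre : Prog) :
    Eval (pre ++ p.map (Expr.shift pre.length)) env (e.shift pre.length) v t := by
  induction h with
  | var h => exact .var h
  | nil => exact .nil
  | cons _ _ iha ihb => exact .cons iha ihb
  | letE _ _ iha ihb => exact .letE iha ihb
  | caseNil _ _ iha ihb => exact .caseNil iha ihb
  | caseCons _ _ iha ihb => exact .caseCons iha ihb
  | call hf _ _ iha ihb =>
    refine .call ?_ iha ihb
    rw [List.getElem?_append_right (by omega)]
    simp [hf]

theorem Eval.append {p : Prog} {env : List Val} {e : Expr} {v : Val} {t : ℕ}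
    (h : Eval p env e v t) (suf : Prog) : Eval (p ++ suf) env e v t := by
  induction h with
  | var h => exact .var h
  | nil => exact .nil
  | cons _ _ iha ihb => exact .cons iha ihb
  | letE _ _ iha ihb => exact .letE iha ihb
  | caseNil _ _ iha ihb => exact .caseNil iha ihb
  | caseCons _ _ iha ihb => exact .caseCons iha ihb
  | call hf _ _ iha ihb =>
    refine .call ?_ iha ihb
    rw [List.getElem?_append_left (List.getElem?_eq_some_iff.1 hf).1]
    exact hf

theorem eval_mono (q : Polynomial ℕ) {a b : ℕ} (hab : a ≤ b) : q.eval a ≤ q.eval b := by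
  simp only [Polynomial.eval_eq_sum_range]
  exact Finset.sum_le_sum fun i _ => by gcongr

/-- The `i`-th function of `p` computes `f` in polynomial time. -/
def Comp (p : Prog) (i : ℕ) (f : Val → Val) : Prop :=
  ∃ body, p[i]? = some body ∧ ∃ q : Polynomial ℕ, ∀ x, ∃ t,
    Eval p [x] body (f x) t ∧ t + (f x).size ≤ q.eval x.size

/-- `f` is computable in polynomial time on all binary trees. -/
@[fun_prop]
def PT (f : Val → Val) : Prop := ∃ p i, Comp p i f

theorem Comp.append {p : Prog} {i : ℕ} {f : Val → Val} (h : Comp p i f) (suf : Prog) :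
    Comp (p ++ suf) i f := by
  obtain ⟨body, hb, q, hq⟩ := h
  refine ⟨body, ?_, q, fun x => ?_⟩
  · rw [List.getElem?_append_left (List.getElem?_eq_some_iff.1 hb).1]
    exact hb
  · obtain ⟨t, ht, h⟩ := hq x
    exact ⟨t, ht.append suf, h⟩

/-- Used with `Comp.append` to gather several subroutines in one program: each new one is linked
behind the program built so far, which keeps the earlier indices. -/
theorem PT.link {f : Val → Val} (h : PT f) (p : Prog) : ∃ suf i, Comp (p ++ suf) i f := by
  obtain ⟨p', i, body, hb, q, hq⟩ := h
  refine ⟨p'.map (Expr.shift p.length), p.length + i, body.shift p.length, ?_, q, fun x => ?_⟩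
  · rw [List.getElem?_append_right (by omega)]
    simp [hb]
  · obtain ⟨t, ht, h⟩ := hq x
    exact ⟨t, ht.shift p, h⟩

/-- The form in which subroutines are used: a single polynomial bounds both the result and the cost
of the call beyond evaluating its argument. -/
theorem Comp.calls {p : Prog} {i : ℕ} {f : Val → Val} (h : Comp p i f) :
    ∃ q : Polynomial ℕ, ∀ x, (f x).size ≤ q.eval x.size ∧ ∀ env e s, Eval p env e x s →
      ∃ t ≤ q.eval x.size, Eval p env (.call i e) (f x) (s + t) := by
  obtain ⟨body, hb, q, hq⟩ := h
  refine ⟨q + 1, fun x => ?_⟩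
  obtain ⟨t, ht, h⟩ := hq x
  refine ⟨by simp; omega, fun env e s he => ⟨t + 1, by simp; omega, ?_⟩⟩
  exact .call hb he ht

theorem PT.of_eval {f : Val → Val} (p : Prog) (e : Expr) (q : Polynomial ℕ)
    (h : ∀ x, ∃ t, Eval p [x] e (f x) t ∧ t + (f x).size ≤ q.eval x.size) : PT f := by
  refine ⟨p ++ [e], p.length, e, by simp, q, fun x => ?_⟩
  obtain ⟨t, ht, h⟩ := h x
  exact ⟨t, ht.append _, h⟩

theorem PT.polyTimeComputable {f : Val → Val} (h : PT f) : PolyTimeComputable id id f := by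
  obtain ⟨p, i, h⟩ := h
  obtain ⟨suf, j, hc⟩ := PT.link ⟨p, i, h⟩ [.call (1 + i) (.var 0)]
  obtain ⟨body, hb, q, hq⟩ := h
  refine ⟨[.call (1 + i) (.var 0)] ++ p.map (Expr.shift 1), q + 4, fun x => ?_⟩
  obtain ⟨t, ht, h⟩ := hq x
  refine ⟨1 + (1 + t + 1) + 1, ?_, by simp; omega⟩
  refine .call rfl (.var rfl) (.call ?_ (.var rfl) (ht.shift [_]))
  rw [List.getElem?_append_right (by simp)]
  simp [hb]

/-! ## Closure properties -/

namespace Val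

def car : Val → Val
  | nil => nil
  | cons a _ => a

def cdr : Val → Val
  | nil => nil
  | cons _ b => b

def ifnil : Val → Val → Val → Val
  | nil, a, _ => a
  | cons _ _, _, b => b

@[simp] theorem car_nil : car nil = nil := rfl
@[simp] theorem car_cons (a b : Val) : car (cons a b) = a := rfl
@[simp] theorem cdr_nil : cdr nil = nil := rfl
@[simp] theorem cdr_cons (a b : Val) : cdr (cons a b) = b := rfl
@[simp] theorem ifnil_nil (a b : Val) : ifnil nil a b = a := rfl
@[simp] theorem ifnil_cons (x y a b : Val) : ifnil (cons x y) a b = b := rfl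

theorem size_pos (x : Val) : 1 ≤ x.size := by cases x <;> simp [size]

theorem size_car_le (x : Val) : x.car.size ≤ x.size := by cases x <;> simp [size]; omega

theorem size_cdr_le (x : Val) : x.cdr.size ≤ x.size := by cases x <;> simp [size]; omega

end Val

@[fun_prop]
theorem PT.id : PT fun x => x :=
  .of_eval [] (.var 0) (1 + Polynomial.X) fun x => ⟨1, .var rfl, by simp⟩

@[fun_prop]
theorem PT.comp {f g : Val → Val} (hf : PT f) (hg : PT g) : PT fun x => f (g x) := by
  obtain ⟨p, i, hf⟩ := hf
  obtain ⟨suf, j, hg⟩ := hg.link p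
  obtain ⟨qf, hf⟩ := (hf.append suf).calls
  obtain ⟨qg, hg⟩ := hg.calls
  refine .of_eval (p ++ suf) (.call i (.call j (.var 0))) (1 + qg + qf.comp qg + qf.comp qg)
    fun x => ?_
  obtain ⟨t, ht, h⟩ := (hg x).2 [x] (.var 0) 1 (.var rfl)
  obtain ⟨s, hs, h'⟩ := (hf (g x)).2 _ _ _ h
  have := eval_mono qf (hg x).1
  have := (hf (g x)).1
  refine ⟨_, h', ?_⟩
  simp only [Polynomial.eval_add, Polynomial.eval_one, Polynomial.eval_comp] at *
  omega

theorem PT.nil : PT fun _ => .nil :=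
  .of_eval [] .nil 2 fun _ => ⟨1, .nil, by simp [Val.size]⟩

@[fun_prop]
theorem PT.cons {f g : Val → Val} (hf : PT f) (hg : PT g) : PT fun x => .cons (f x) (g x) := by
  obtain ⟨p, i, hf⟩ := hf
  obtain ⟨suf, j, hg⟩ := hg.link p
  obtain ⟨qf, hf⟩ := (hf.append suf).calls
  obtain ⟨qg, hg⟩ := hg.calls
  refine .of_eval (p ++ suf) (.cons (.call i (.var 0)) (.call j (.var 0))) (4 + 2 * qf + 2 * qg)
    fun x => ?_
  obtain ⟨t, ht, h⟩ := (hf x).2 [x] (.var 0) 1 (.var rfl)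
  obtain ⟨s, hs, h'⟩ := (hg x).2 [x] (.var 0) 1 (.var rfl)
  have := (hf x).1
  have := (hg x).1
  refine ⟨_, .cons h h', ?_⟩
  simp only [Polynomial.eval_add, Polynomial.eval_mul, Polynomial.eval_ofNat, Val.size] at *
  omega

@[fun_prop]
theorem PT.const (v : Val) : PT fun _ => v := by
  induction v with
  | nil => exact .nil
  | cons a b iha ihb => exact .cons iha ihb

theorem PT.car' : PT Val.car := by
  refine .of_eval [] (.case (.var 0) .nil (.var 0)) (4 + Polynomial.X) fun x => ?_
  cases x with
  | nil => exact ⟨_, .caseNil (.var rfl) .nil, by simp [Val.size]⟩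
  | cons a b => exact ⟨_, .caseCons (.var rfl) (.var rfl), by simp [Val.size]; omega⟩

theorem PT.cdr' : PT Val.cdr := by
  refine .of_eval [] (.case (.var 0) .nil (.var 1)) (4 + Polynomial.X) fun x => ?_
  cases x with
  | nil => exact ⟨_, .caseNil (.var rfl) .nil, by simp [Val.size]⟩
  | cons a b => exact ⟨_, .caseCons (.var rfl) (.var rfl), by simp [Val.size]; omega⟩

@[fun_prop]
theorem PT.car {f : Val → Val} (hf : PT f) : PT fun x => (f x).car := PT.car'.comp hf

@[fun_prop]
theorem PT.cdr {f : Val → Val} (hf : PT f) : PT fun x => (f x).cdr := PT.cdr'.comp hf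

theorem PT.ifnil' : PT fun z => z.car.ifnil z.cdr.car z.cdr.cdr := by
  obtain ⟨p, i, hf⟩ := (by fun_prop : PT fun z => z.cdr.car)
  obtain ⟨suf, j, hg⟩ := (by fun_prop : PT fun z => z.cdr.cdr).link p
  have hf := hf.append suf
  obtain ⟨suf', k, hk⟩ := PT.car'.link (p ++ suf)
  obtain ⟨qf, hf⟩ := (hf.append suf').calls
  obtain ⟨qg, hg⟩ := (hg.append suf').calls
  obtain ⟨qk, hk⟩ := hk.calls
  -- The `cons` branch binds two variables, so there the argument has index `2`.
  refine .of_eval (p ++ suf ++ suf')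
    (.case (.call k (.var 0)) (.call i (.var 0)) (.call j (.var 2)))
    (4 + 2 * qf + 2 * qg + qk) fun x => ?_
  obtain ⟨s, hs, h⟩ := (hk x).2 [x] (.var 0) 1 (.var rfl)
  have h1 := (hf x).1
  have h2 := (hg x).1
  cases hx : x.car with
  | nil =>
    rw [hx] at h
    obtain ⟨t, ht, h'⟩ := (hf x).2 [x] (.var 0) 1 (.var rfl)
    refine ⟨_, .caseNil h h', ?_⟩
    simp only [Polynomial.eval_add, Polynomial.eval_mul, Polynomial.eval_ofNat, Val.ifnil_nil] at *
    omega
  | cons a b =>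
    rw [hx] at h
    obtain ⟨t, ht, h'⟩ := (hg x).2 [a, b, x] (.var 2) 1 (.var rfl)
    refine ⟨_, .caseCons h h', ?_⟩
    simp only [Polynomial.eval_add, Polynomial.eval_mul, Polynomial.eval_ofNat, Val.ifnil_cons] at *
    omega

@[fun_prop]
theorem PT.ifnil {f g h : Val → Val} (hf : PT f) (hg : PT g) (hh : PT h) :
    PT fun x => (f x).ifnil (g x) (h x) :=
  PT.ifnil'.comp (hf.cons (hg.cons hh))

/-- Polynomial growth. -/
theorem PT.size_le {f : Val → Val} (hf : PT f) :
    ∃ q : Polynomial ℕ, ∀ x, (f x).size ≤ q.eval x.size := by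
  obtain ⟨p, i, body, _, q, hq⟩ := hf
  refine ⟨q, fun x => ?_⟩
  obtain ⟨t, _, h⟩ := hq x
  omega

/-- Recursion on binary trees, with a parameter that may change along the recursion but stays
small, and with results of polynomial size. -/
theorem PT.treeRec {F : Val → Val → Val} {g : Val → Val} {h : Val → Val → Val → Val → Val → Val}
    {σ₁ σ₂ : Val → Val → Val → Val} (c : ℕ)
    (hnil : ∀ q, F q .nil = g q)
    (hcons : ∀ q a b, F q (.cons a b) = h q a b (F (σ₁ q a b) a) (F (σ₂ q a b) b))
    (hg : PT g)
    (hh : PT fun z => h z.car z.cdr.car z.cdr.cdr.car z.cdr.cdr.cdr.car z.cdr.cdr.cdr.cdr)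
    (h1 : PT fun z => σ₁ z.car z.cdr.car z.cdr.cdr)
    (h2 : PT fun z => σ₂ z.car z.cdr.car z.cdr.cdr)
    (b1 : ∀ q a b, (σ₁ q a b).size ≤ max q.size c)
    (b2 : ∀ q a b, (σ₂ q a b).size ≤ max q.size c)
    (hB : ∃ B : Polynomial ℕ, ∀ q x, (F q x).size ≤ B.eval (q.size + x.size)) :
    PT fun z => F z.car z.cdr := by
  obtain ⟨B, hB⟩ := hB
  obtain ⟨p, ig, hg⟩ := hg
  obtain ⟨s, ih, hh⟩ := hh.link p
  have hg := hg.append s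
  obtain ⟨s', i1, h1⟩ := h1.link (p ++ s)
  have hg := hg.append s'
  have hh := hh.append s'
  obtain ⟨s'', i2, h2⟩ := h2.link (p ++ s ++ s')
  have hg := hg.append s''
  have hh := hh.append s''
  have h1 := h1.append s''
  generalize p ++ s ++ s' ++ s'' = p at *
  let tup : Expr := .cons (.var 2) (.cons (.var 0) (.var 1))
  -- The body will be appended to `p`, so calls of `p.length` are the recursive calls. The outer
  -- `nil` branch serves the argument `nil`, which is no pair but has `car` and `cdr` equal to
  -- `nil`. In the innermost branch the variables `0`, `1`, `2` are `a`, `b`, `q`.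
  let body : Expr := .case (.var 0) (.call ig .nil) (.case (.var 1) (.call ig (.var 0))
    (.call ih (.cons (.var 2) (.cons (.var 0) (.cons (.var 1) (.cons
      (.call p.length (.cons (.call i1 tup) (.var 0)))
      (.call p.length (.cons (.call i2 tup) (.var 1)))))))))
  obtain ⟨qg, hg⟩ := (hg.append [body]).calls
  obtain ⟨qh, hh⟩ := (hh.append [body]).calls
  obtain ⟨q1, h1⟩ := (h1.append [body]).calls
  obtain ⟨q2, h2⟩ := (h2.append [body]).calls
  have hself : (p ++ [body])[p.length]? = some body := by simp
  generalize p ++ [body] = P at *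
  -- time per node, for parameters of size `≤ m` and trees of size `≤ n`
  let K : ℕ → ℕ → ℕ := fun m n => 40 + qg.eval m + q1.eval (m + n + 2) + q2.eval (m + n + 2) +
    qh.eval (m + n + 2 * B.eval (m + n) + 4)
  -- With `m` and `n` fixed for the whole recursion the cost `K m n` per node is constant, so the
  -- times add up along the tree. The hypotheses `b1`, `b2` keep the parameters below `m` because `c
  -- ≤ m`.
  have key : ∀ m n, c ≤ m → ∀ x q : Val, q.size ≤ m → x.size ≤ n →
      ∃ t ≤ x.size * K m n, Eval P [.cons q x] body (F q x) t := by
    intro m n hc x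
    induction x with
    | nil =>
      intro q hq hn
      obtain ⟨t, ht, h⟩ := (hg q).2 [q, .nil, .cons q .nil] (.var 0) 1 (.var rfl)
      rw [hnil]
      refine ⟨_, ?_, .caseCons (.var rfl) (.caseNil (.var rfl) h)⟩
      have := eval_mono qg hq
      simp only [Val.size, K] at *
      omega
    | cons a b iha ihb =>
      intro q hq hn
      simp only [Val.size] at hn
      have hs1 := b1 q a b
      have hs2 := b2 q a b
      obtain ⟨ta, hta, ha⟩ := iha (σ₁ q a b) (by omega) (by omega)
      obtain ⟨tb, htb, hb⟩ := ihb (σ₂ q a b) (by omega) (by omega)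
      have htup : Eval P [a, b, q, .cons a b, .cons q (.cons a b)] tup (.cons q (.cons a b)) 5 :=
        .cons (.var (i := 2) rfl) (.cons (.var (i := 0) rfl) (.var (i := 1) rfl))
      obtain ⟨t1, ht1, e1⟩ := (h1 _).2 _ _ _ htup
      obtain ⟨t2, ht2, e2⟩ := (h2 _).2 _ _ _ htup
      have ca : Eval P [a, b, q, .cons a b, .cons q (.cons a b)]
          (.call p.length (.cons (.call i1 tup) (.var 0)))
          (F (σ₁ q a b) a) (5 + t1 + 1 + 1 + ta + 1) := .call hself (.cons e1 (.var rfl)) ha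
      have cb : Eval P [a, b, q, .cons a b, .cons q (.cons a b)]
          (.call p.length (.cons (.call i2 tup) (.var 1)))
          (F (σ₂ q a b) b) (5 + t2 + 1 + 1 + tb + 1) := .call hself (.cons e2 (.var rfl)) hb
      obtain ⟨t, ht, e⟩ := (hh _).2 [a, b, q, .cons a b, .cons q (.cons a b)] _ _
        (.cons (.var (i := 2) rfl) (.cons (.var (i := 0) rfl) (.cons (.var (i := 1) rfl)
          (.cons ca cb))))
      simp only [Val.car_cons, Val.cdr_cons] at e
      rw [hcons]
      refine ⟨_, ?_, .caseCons (.var rfl) (.caseCons (.var rfl) e)⟩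
      have m1 := eval_mono q1 (a := (Val.cons q (.cons a b)).size) (b := m + n + 2)
        (by simp only [Val.size]; omega)
      have m2 := eval_mono q2 (a := (Val.cons q (.cons a b)).size) (b := m + n + 2)
        (by simp only [Val.size]; omega)
      have B1 := (hB (σ₁ q a b) a).trans (eval_mono B (b := m + n) (by omega))
      have B2 := (hB (σ₂ q a b) b).trans (eval_mono B (b := m + n) (by omega))
      have m3 := eval_mono qh (a := (Val.cons q (.cons a (.cons b (.cons (F (σ₁ q a b) a)
        (F (σ₂ q a b) b))))).size) (b := m + n + 2 * B.eval (m + n) + 4)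
        (by simp only [Val.size]; omega)
      have hK : (Val.cons a b).size * K m n = a.size * K m n + b.size * K m n + K m n := by
        simp only [Val.size]; ring
      have hK' : K m n = 40 + qg.eval m + q1.eval (m + n + 2) + q2.eval (m + n + 2) +
        qh.eval (m + n + 2 * B.eval (m + n) + 4) := rfl
      omega
  -- `key` is applied with `m = n = z.size + c`, the value of `Y`, which meets the condition `c ≤
  -- m`.
  let Y : Polynomial ℕ := Polynomial.X + Polynomial.C c
  refine ⟨P, p.length, body, hself, qg + 40 + B.comp (2 * Y) +
    Y * (40 + qg.comp Y + q1.comp (2 * Y + 2) + q2.comp (2 * Y + 2) +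
      qh.comp (2 * Y + 2 * B.comp (2 * Y) + 4)), fun z => ?_⟩
  have hY : ∀ n, Y.eval n = n + c := by intro n; simp [Y]
  have hsz : (F z.car z.cdr).size ≤ B.eval (2 * (z.size + c)) :=
    (hB _ _).trans (eval_mono B (by have := z.size_car_le; have := z.size_cdr_le; omega))
  have main : ∃ t ≤ 40 + qg.eval z.size + (z.size + c) * K (z.size + c) (z.size + c),
      Eval P [z] body (F z.car z.cdr) t := by
    cases z with
    | nil =>
      obtain ⟨t, ht, h⟩ := (hg .nil).2 [.nil] .nil 1 .nil
      rw [Val.car_nil, Val.cdr_nil, hnil]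
      exact ⟨_, by omega, .caseNil (.var rfl) h⟩
    | cons q x =>
      obtain ⟨t, ht, h⟩ := key ((Val.cons q x).size + c) ((Val.cons q x).size + c) (by omega) x q
        (by simp only [Val.size]; omega) (by simp only [Val.size]; omega)
      refine ⟨t, ht.trans (le_add_left (Nat.mul_le_mul_right _ ?_)), h⟩
      simp only [Val.size]; omega
  obtain ⟨t, ht, h⟩ := main
  refine ⟨t, h, ?_⟩
  simp only [Polynomial.eval_add, Polynomial.eval_mul, Polynomial.eval_comp, Polynomial.eval_ofNat,
    hY, K, two_mul, ← add_assoc] at *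
  omega

end SROIQ

namespace SROIQ

/-! ## Recursion on lists and on encoded syntax trees -/

namespace Val

def isNil : Val → Bool
  | nil => true
  | cons _ _ => false

@[simp] theorem isNil_nil : isNil nil = true := rfl
@[simp] theorem isNil_cons (a b : Val) : isNil (cons a b) = false := rfl

/-- Recursion on a list with parameter `q`; the step sees the whole remaining list. -/
def lrec (g : Val → Val) (h : Val → Val → Val → Val) (q : Val) : Val → Val
  | nil => g q
  | cons a b => h q (cons a b) (lrec g h q b)

theorem lrec_ofList (g : Val → Val) (k : Val → Val → Val → Val) (q : Val) (l : List Val) :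
    lrec g (fun q x v => k q x.car v) q (ofList l) = l.foldr (k q) (g q) := by
  induction l with
  | nil => rfl
  | cons a l ih => simp [ofList, lrec, ih]

/-- Recursion on encoded syntax trees with parameter `q` and a polarity, which for the children of
a node depends on the tag of the node by `s`. The result at a node is `H b q x l`, where `b` is the
polarity, `x` the node, and `l` the list of the results for its children. The mode `true` stands
for nodes, `false` for lists of nodes. -/
def nrec (H : Bool → Val → Val → Val → Val) (s : Bool → Val → Val) (q : Val) :
    Val → Bool → Bool → Val
  | nil, true, b => H b q nil nil
  | nil, false, _ => nil
  | cons x y, true, b => H b q (cons x y) (nrec H s q y false (isNil (s b x)))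
  | cons x y, false, b => cons (nrec H s q x true b) (nrec H s q y false b)

theorem nrec_ofList (H : Bool → Val → Val → Val → Val) (s : Bool → Val → Val) (q : Val)
    (l : List Val) (b : Bool) :
    nrec H s q (ofList l) false b = ofList (l.map fun x => nrec H s q x true b) := by
  induction l with
  | nil => rfl
  | cons a l ih => simp [ofList, nrec, ih]

/-- The recursion enters all arguments, also names, numerals and roles inside concepts. The results
there are meaningless but of controlled size, and the step functions ignore them. -/
theorem nrec_con (H : Bool → Val → Val → Val → Val) (s : Bool → Val → Val) (q : Val)
    (k : ℕ) (l : List Val) (b : Bool) :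
    nrec H s q (con k l) true b = H b q (con k l)
      (ofList (l.map fun x => nrec H s q x true (isNil (s b (unary k))))) := by
  rw [con, nrec, nrec_ofList]

/-- A pair of a Boolean and a tree, in such a way that the size does not depend on the Boolean. -/
def code : Bool → Val → Val
  | true, q => cons nil (cons q nil)
  | false, q => cons (cons q nil) nil

def decode (q : Val) : Val := ifnil q.car q.cdr.car q.car.car

@[simp] theorem decode_code (b : Bool) (q : Val) : decode (code b q) = q := by cases b <;> rfl
@[simp] theorem isNil_code (b : Bool) (q : Val) : isNil (code b q).car = b := by cases b <;> rfl

theorem size_code (b : Bool) (q : Val) : (code b q).size = q.size + 4 := by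
  cases b <;> simp [code, size]; omega

/-- The slack `4` is the cost of coding again: decoding and recoding with other Booleans does not
increase a parameter beyond a constant, as `PT.treeRec` demands. -/
theorem size_decode (q : Val) : (decode q).size + 4 ≤ max q.size 5 := by
  rcases q with _ | ⟨_ | ⟨a, b⟩, r⟩
  · simp [decode, size]
  · rcases r with _ | ⟨c, d⟩
    · simp [decode, size]
    · have := d.size_pos
      simp [decode, size]
      omega
  · have := b.size_pos
    have := r.size_pos
    simp [decode, size]
    omega

end Val

/-- Growth that allows for recursion: additive in the results `l` of recursive calls. -/
def Lin (H : Val → Val → Val → Val) : Prop :=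
  ∃ Q : Polynomial ℕ, ∀ q x l, (H q x l).size ≤ l.size + Q.eval (q.size + x.size)

theorem Lin.result : Lin fun _ _ l => l := ⟨0, fun _ _ _ => by simp⟩

theorem Lin.of_PT {G : Val → Val → Val} (h : PT fun z => G z.car z.cdr) :
    Lin fun q x _ => G q x := by
  obtain ⟨Q, hQ⟩ := h.size_le
  refine ⟨Q.comp (Polynomial.X + 1), fun q x l => ?_⟩
  have := hQ (.cons q x)
  simp [Val.size] at this ⊢
  omega

theorem Lin.car {H : Val → Val → Val → Val} (h : Lin H) : Lin fun q x l => (H q x l).car := by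
  obtain ⟨Q, hQ⟩ := h
  exact ⟨Q, fun q x l => (Val.size_car_le _).trans (hQ q x l)⟩

theorem Lin.cdr {H : Val → Val → Val → Val} (h : Lin H) : Lin fun q x l => (H q x l).cdr := by
  obtain ⟨Q, hQ⟩ := h
  exact ⟨Q, fun q x l => (Val.size_cdr_le _).trans (hQ q x l)⟩

/-- The test only selects a branch, so nothing is required of it, and each branch may use up the
recursive results once. -/
theorem Lin.ifnil {T A B : Val → Val → Val → Val} (hA : Lin A) (hB : Lin B) :
    Lin fun q x l => (T q x l).ifnil (A q x l) (B q x l) := by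
  obtain ⟨P, hP⟩ := hA
  obtain ⟨Q, hQ⟩ := hB
  refine ⟨P + Q, fun q x l => ?_⟩
  have := hP q x l
  have := hQ q x l
  rw [Polynomial.eval_add]
  beta_reduce
  cases T q x l <;> simp only [Val.ifnil_nil, Val.ifnil_cons] <;> omega

theorem Lin.cons {G : Val → Val → Val} {H : Val → Val → Val → Val}
    (hG : PT fun z => G z.car z.cdr) (h : Lin H) : Lin fun q x l => .cons (G q x) (H q x l) := by
  obtain ⟨P, hP⟩ := h
  obtain ⟨Q, hQ⟩ := Lin.of_PT hG
  refine ⟨P + Q + 2, fun q x l => ?_⟩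
  have := hP q x l
  have := hQ q x .nil
  simp [Val.size] at *
  omega

theorem Lin.cons' {G : Val → Val → Val} {H : Val → Val → Val → Val}
    (h : Lin H) (hG : PT fun z => G z.car z.cdr) : Lin fun q x l => .cons (H q x l) (G q x) := by
  obtain ⟨P, hP⟩ := h
  obtain ⟨Q, hQ⟩ := Lin.of_PT hG
  refine ⟨P + Q + 2, fun q x l => ?_⟩
  have := hP q x l
  have := hQ q x .nil
  simp [Val.size] at *
  omega

theorem PT.lrec' {g : Val → Val} {h : Val → Val → Val → Val} (hg : PT g)
    (hh : PT fun z => h z.car z.cdr.car z.cdr.cdr) (hl : Lin h) :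
    PT fun z => Val.lrec g h z.car z.cdr := by
  refine PT.treeRec (F := Val.lrec g h) (g := g) (h := fun q a b _ v => h q (.cons a b) v)
    (σ₁ := fun q _ _ => q) (σ₂ := fun q _ _ => q) 0 (fun q => rfl) (fun q a b => rfl) hg ?_
    (by fun_prop) (by fun_prop) (fun _ _ _ => by simp) (fun _ _ _ => by simp) ?_
  · exact hh.comp (f := fun z => h z.car z.cdr.car z.cdr.cdr)
      (g := fun z => .cons z.car (.cons (.cons z.cdr.car z.cdr.cdr.car) z.cdr.cdr.cdr.cdr))
      (by fun_prop)
  · obtain ⟨Q, hQ⟩ := hl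
    obtain ⟨P, hP⟩ := hg.size_le
    -- `P` bounds the start value, and each of the at most `x.size` steps adds at most a value of
    -- `Q`.
    refine ⟨P + Polynomial.X * Q, fun q x => ?_⟩
    have key : ∀ n x : _, Val.size x ≤ n →
        (Val.lrec g h q x).size ≤ P.eval q.size + x.size * Q.eval (q.size + n) := by
      intro n x
      induction x with
      | nil => intro _; exact (hP q).trans (Nat.le_add_right _ _)
      | cons a b _ ih =>
        intro hn
        have h1 := hQ q (.cons a b) (Val.lrec g h q b)
        have h2 := ih (by simp only [Val.size] at hn; omega)
        have h3 := eval_mono Q (a := q.size + (Val.cons a b).size) (b := q.size + n) (by omega)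
        have h4 : (Val.cons a b).size * Q.eval (q.size + n) = a.size * Q.eval (q.size + n) +
          b.size * Q.eval (q.size + n) + Q.eval (q.size + n) := by simp only [Val.size]; ring
        simp only [Val.lrec]
        omega
    refine (key _ x le_rfl).trans ?_
    have := eval_mono P (a := q.size) (b := q.size + x.size) (by omega)
    simp only [Polynomial.eval_add, Polynomial.eval_mul, Polynomial.eval_X]
    gcongr
    omega

theorem PT.lrec {g : Val → Val} {h : Val → Val → Val → Val} {q x : Val → Val} (hg : PT g)
    (hh : PT fun z => h z.car z.cdr.car z.cdr.cdr) (hl : Lin h) (hq : PT q) (hx : PT x) :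
    PT fun z => Val.lrec g h (q z) (x z) :=
  (PT.lrec' hg hh hl).comp (hq.cons hx)

@[fun_prop]
theorem PT.code (b : Bool) {f : Val → Val} (hf : PT f) : PT fun x => (f x).code b := by
  cases b <;> (unfold Val.code; fun_prop)

@[fun_prop]
theorem PT.decode {f : Val → Val} (hf : PT f) : PT fun x => (f x).decode := by
  unfold Val.decode; fun_prop

/-- Mode and polarity are packed into the parameter by two layers of `code`, which turns `nrec` into
an instance of `PT.treeRec`. -/
theorem PT.nrec' {H : Bool → Val → Val → Val → Val} {s : Bool → Val → Val}
    (hH : ∀ b, PT fun z => H b z.car z.cdr.car z.cdr.cdr) (hs : ∀ b, PT (s b))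
    (hl : ∀ b, Lin (H b)) :
    PT fun z => Val.nrec H s z.car.decode.decode z.cdr z.car.car.isNil z.car.decode.car.isNil := by
  have hH' : ∀ b {x y z : Val → Val}, PT x → PT y → PT z → PT fun v => H b (x v) (y v) (z v) :=
    fun b x y z hx hy hz => (hH b).comp (f := fun z => H b z.car z.cdr.car z.cdr.cdr)
      (hx.cons (hy.cons hz))
  have hs1 := hs true
  have hs2 := hs false
  refine PT.treeRec
    (F := fun q x => Val.nrec H s q.decode.decode x q.car.isNil q.decode.car.isNil)
    (g := fun q => q.car.ifnil (q.decode.car.ifnil (H true q.decode.decode .nil .nil)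
      (H false q.decode.decode .nil .nil)) .nil)
    (h := fun q a b u v => q.car.ifnil (q.decode.car.ifnil (H true q.decode.decode (.cons a b) v)
      (H false q.decode.decode (.cons a b) v)) (.cons u v))
    (σ₁ := fun q _ _ => q.decode.code true)
    (σ₂ := fun q a _ => q.car.ifnil
      (((q.decode.car.ifnil (s true a) (s false a)).ifnil (q.decode.decode.code true)
        (q.decode.decode.code false)).code false) (q.decode.code false))
        -- `9` is the size of `nil` under two layers of `code`, reached when the parameter is not a
        -- proper code.
        9 ?_ ?_ ?_ ?_ ?_ ?_ ?_ ?_ ?_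
  · intro q
    cases q.car <;> cases q.decode.car <;> rfl
  · intro q a b
    cases q.car <;> simp [Val.nrec]
    cases q.decode.car with
    | nil => cases h : s true a <;> simp [h]
    | cons => cases h : s false a <;> simp [h]
  · refine PT.ifnil (by fun_prop) (PT.ifnil (by fun_prop) (hH' _ ?_ ?_ ?_) (hH' _ ?_ ?_ ?_)) ?_ <;>
      fun_prop
  · refine PT.ifnil (by fun_prop) (PT.ifnil (by fun_prop) (hH' _ ?_ ?_ ?_) (hH' _ ?_ ?_ ?_)) ?_ <;>
      fun_prop
  · fun_prop
  · fun_prop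
  · intro q _ _
    have := q.size_decode
    simp only [Val.size_code]
    omega
  · intro q a _
    have := q.size_decode
    have := q.decode.size_decode
    cases q.car <;> cases q.decode.car <;> cases s true a <;> cases s false a <;>
      simp only [Val.size_code, Val.ifnil_nil, Val.ifnil_cons] <;> omega
  · obtain ⟨P, hP⟩ := hl true
    obtain ⟨Q, hQ⟩ := hl false
    have hPQ : ∀ b q x l, (H b q x l).size ≤ l.size + (P + Q).eval (q.size + x.size) := by
      intro b q x l
      rw [Polynomial.eval_add]
      cases b
      · exact (hQ q x l).trans (by omega)
      · exact (hP q x l).trans (by omega)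
    generalize P + Q = Q at hPQ
    -- The summand `1` per node pays for the cells of the lists of results.
    have key : ∀ q n x m b, Val.size x ≤ n →
        (Val.nrec H s q x m b).size ≤ x.size * (Q.eval (q.size + n) + 1) := by
      intro q n x
      induction x with
      | nil =>
        intro m b hn
        cases m
        · simp [Val.nrec, Val.size]
        · have h1 := hPQ b q .nil .nil
          have h2 := eval_mono Q (a := q.size + Val.nil.size) (b := q.size + n) (by omega)
          simp only [Val.nrec, Val.size] at *
          omega
      | cons x y ihx ihy =>
        intro m b hn
        have hn' := hn
        simp only [Val.size] at hn
        have h4 : (Val.cons x y).size * (Q.eval (q.size + n) + 1) =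
          x.size * (Q.eval (q.size + n) + 1) + y.size * (Q.eval (q.size + n) + 1) +
          Q.eval (q.size + n) + 1 := by simp only [Val.size]; ring
        have h2 := eval_mono Q (a := q.size + (Val.cons x y).size) (b := q.size + n) (by omega)
        rw [h4]
        cases m
        · have := ihx true b (by omega)
          have := ihy false b (by omega)
          simp only [Val.nrec, Val.size] at *
          omega
        · have h3 := ihy false (s b x).isNil (by omega)
          have h1 := hPQ b q (.cons x y) (Val.nrec H s q y false (s b x).isNil)
          simp only [Val.nrec] at *
          omega
    refine ⟨(Polynomial.X + 5) * (Q.comp (Polynomial.X + 5) + 1), fun q x => ?_⟩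
    refine (key _ _ x _ _ le_rfl).trans ?_
    have h1 := q.size_decode
    have h2 := q.decode.size_decode
    have h3 := eval_mono Q (a := q.decode.decode.size + x.size) (b := q.size + x.size + 5)
      (by omega)
    simp only [Polynomial.eval_add, Polynomial.eval_mul, Polynomial.eval_X, Polynomial.eval_comp,
      Polynomial.eval_ofNat, Polynomial.eval_one]
    gcongr
    omega

theorem PT.nrec {H : Bool → Val → Val → Val → Val} {s : Bool → Val → Val} (b : Bool)
    {q x : Val → Val} (hH : ∀ b, PT fun z => H b z.car z.cdr.car z.cdr.cdr)
    (hs : ∀ b, PT (s b)) (hl : ∀ b, Lin (H b)) (hq : PT q) (hx : PT x) :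
    PT fun z => Val.nrec H s (q z) (x z) true b := by
  have := (PT.nrec' hH hs hl).comp (g := fun z => .cons (((q z).code b).code true) (x z))
    (by fun_prop)
  simpa using this

/-! ## Case distinction on tags, and basic list functions -/

namespace Val

/-- Tags are unary numerals, so each case strips one `cdr`; the last branch takes all remaining
tags. -/
def sel2 (t a b : Val) : Val := t.ifnil a b
def sel3 (t a b c : Val) : Val := t.ifnil a (t.cdr.sel2 b c)
def sel4 (t a b c d : Val) : Val := t.ifnil a (t.cdr.sel3 b c d)
def sel5 (t a b c d e : Val) : Val := t.ifnil a (t.cdr.sel4 b c d e)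
def sel6 (t a b c d e f : Val) : Val := t.ifnil a (t.cdr.sel5 b c d e f)
def sel12 (t a b c d e f g h i j k l : Val) : Val :=
  t.sel6 a b c d e (t.cdr.cdr.cdr.cdr.cdr.ifnil f (t.cdr.cdr.cdr.cdr.cdr.cdr.sel6 g h i j k l))

/-- The argument with index `k` of an encoded constructor application. -/
def arg (x : Val) : ℕ → Val
  | 0 => x.cdr.car
  | k + 1 => (cons .nil x.cdr.cdr).arg k

@[simp] theorem arg_zero_con (k : ℕ) (a : Val) (l : List Val) : (con k (a :: l)).arg 0 = a := rfl
@[simp] theorem arg_one_con (k : ℕ) (a b : Val) (l : List Val) :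
    (con k (a :: b :: l)).arg 1 = b := rfl
@[simp] theorem arg_two_con (k : ℕ) (a b c : Val) (l : List Val) :
    (con k (a :: b :: c :: l)).arg 2 = c := rfl
@[simp] theorem car_con (k : ℕ) (l : List Val) : (con k l).car = unary k := rfl
@[simp] theorem cdr_con (k : ℕ) (l : List Val) : (con k l).cdr = ofList l := rfl
@[simp] theorem car_ofList (a : Val) (l : List Val) : (ofList (a :: l)).car = a := rfl
@[simp] theorem cdr_ofList (a : Val) (l : List Val) : (ofList (a :: l)).cdr = ofList l := rfl

def append (x y : Val) : Val := lrec (fun y => y) (fun _ a v => cons a.car v) y x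

@[simp]
theorem append_ofList (l m : List Val) : append (ofList l) (ofList m) = ofList (l ++ m) := by
  induction l with
  | nil => rfl
  | cons a l ih => rw [append] at ih; simp [append, ofList, lrec, ih]

theorem size_append (x y : Val) : (append x y).size ≤ x.size + y.size := by
  induction x with
  | nil => simp [append, lrec, size]
  | cons a b _ ih => simp [append, lrec, size] at *; omega

end Val

section

variable {t a b c d e f g h i j k l : Val → Val}

@[fun_prop]
theorem PT.sel2 (ht : PT t) (ha : PT a) (hb : PT b) : PT fun x => (t x).sel2 (a x) (b x) := by
  unfold Val.sel2; fun_prop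

@[fun_prop]
theorem PT.sel3 (ht : PT t) (ha : PT a) (hb : PT b) (hc : PT c) :
    PT fun x => (t x).sel3 (a x) (b x) (c x) := by
  unfold Val.sel3; fun_prop

@[fun_prop]
theorem PT.sel4 (ht : PT t) (ha : PT a) (hb : PT b) (hc : PT c) (hd : PT d) :
    PT fun x => (t x).sel4 (a x) (b x) (c x) (d x) := by
  unfold Val.sel4; fun_prop

@[fun_prop]
theorem PT.sel5 (ht : PT t) (ha : PT a) (hb : PT b) (hc : PT c) (hd : PT d) (he : PT e) :
    PT fun x => (t x).sel5 (a x) (b x) (c x) (d x) (e x) := by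
  unfold Val.sel5; fun_prop

@[fun_prop]
theorem PT.sel6 (ht : PT t) (ha : PT a) (hb : PT b) (hc : PT c) (hd : PT d) (he : PT e)
    (hf : PT f) : PT fun x => (t x).sel6 (a x) (b x) (c x) (d x) (e x) (f x) := by
  unfold Val.sel6; fun_prop

@[fun_prop]
theorem PT.sel12 (ht : PT t) (ha : PT a) (hb : PT b) (hc : PT c) (hd : PT d) (he : PT e)
    (hf : PT f) (hg : PT g) (hh : PT h) (hi : PT i) (hj : PT j) (hk : PT k) (hl : PT l) :
    PT fun x => (t x).sel12 (a x) (b x) (c x) (d x) (e x) (f x) (g x) (h x) (i x) (j x) (k x)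
      (l x) := by
  unfold Val.sel12; fun_prop

@[fun_prop]
theorem PT.arg (ht : PT t) (k : ℕ) : PT fun x => (t x).arg k := by
  induction k generalizing t with
  | zero => unfold Val.arg; fun_prop
  | succ k ih => exact ih (t := fun x => .cons .nil (t x).cdr.cdr) (by fun_prop)

@[fun_prop]
theorem PT.append (ha : PT a) (hb : PT b) : PT fun x => (a x).append (b x) := by
  refine PT.lrec ?_ ?_ ?_ hb ha
  · fun_prop
  · fun_prop
  · exact Lin.cons (by fun_prop) Lin.result

@[fun_prop]
theorem PT.con1 (k : ℕ) (ha : PT a) : PT fun x => .con k [a x] := by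
  unfold Val.con Val.ofList Val.ofList; fun_prop

@[fun_prop]
theorem PT.con2 (k : ℕ) (ha : PT a) (hb : PT b) : PT fun x => .con k [a x, b x] := by
  unfold Val.con Val.ofList Val.ofList Val.ofList; fun_prop

@[fun_prop]
theorem PT.con3 (k : ℕ) (ha : PT a) (hb : PT b) (hc : PT c) :
    PT fun x => .con k [a x, b x, c x] := by
  unfold Val.con Val.ofList Val.ofList Val.ofList Val.ofList; fun_prop

end

section

variable {t a b c d e f g h i j k l : Val → Val → Val → Val}

theorem Lin.sel2 (ha : Lin a) (hb : Lin b) : Lin fun q x r => (t q x r).sel2 (a q x r) (b q x r) :=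
  ha.ifnil hb

theorem Lin.sel3 (ha : Lin a) (hb : Lin b) (hc : Lin c) :
    Lin fun q x r => (t q x r).sel3 (a q x r) (b q x r) (c q x r) :=
  ha.ifnil (hb.sel2 hc)

theorem Lin.sel4 (ha : Lin a) (hb : Lin b) (hc : Lin c) (hd : Lin d) :
    Lin fun q x r => (t q x r).sel4 (a q x r) (b q x r) (c q x r) (d q x r) :=
  ha.ifnil (hb.sel3 hc hd)

theorem Lin.sel5 (ha : Lin a) (hb : Lin b) (hc : Lin c) (hd : Lin d) (he : Lin e) :
    Lin fun q x r => (t q x r).sel5 (a q x r) (b q x r) (c q x r) (d q x r) (e q x r) :=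
  ha.ifnil (hb.sel4 hc hd he)

theorem Lin.sel6 (ha : Lin a) (hb : Lin b) (hc : Lin c) (hd : Lin d) (he : Lin e) (hf : Lin f) :
    Lin fun q x r => (t q x r).sel6 (a q x r) (b q x r) (c q x r) (d q x r) (e q x r) (f q x r) :=
  ha.ifnil (hb.sel5 hc hd he hf)

theorem Lin.sel12 (ha : Lin a) (hb : Lin b) (hc : Lin c) (hd : Lin d) (he : Lin e) (hf : Lin f)
    (hg : Lin g) (hh : Lin h) (hi : Lin i) (hj : Lin j) (hk : Lin k) (hl : Lin l) :
    Lin fun q x r => (t q x r).sel12 (a q x r) (b q x r) (c q x r) (d q x r) (e q x r) (f q x r)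
      (g q x r) (h q x r) (i q x r) (j q x r) (k q x r) (l q x r) :=
  ha.sel6 hb hc hd he (hf.ifnil (hg.sel6 hh hi hj hk hl))

theorem Lin.con2 (n : ℕ) {G : Val → Val → Val} (hG : PT fun z => G z.car z.cdr) (ha : Lin a) :
    Lin fun q x r => .con n [G q x, a q x r] :=
  Lin.cons (.const _) (.cons hG (ha.cons' (.const _)))

theorem Lin.con3 (n : ℕ) {G G' : Val → Val → Val} (hG : PT fun z => G z.car z.cdr)
    (hG' : PT fun z => G' z.car z.cdr) (ha : Lin a) :
    Lin fun q x r => .con n [G q x, G' q x, a q x r] :=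
  Lin.cons (.const _) (.cons hG (.cons hG' (ha.cons' (.const _))))

/-- Concatenation of the results of both children. -/
theorem Lin.append : Lin fun _ _ r => r.car.append r.cdr.car := by
  refine ⟨1, fun q x r => ?_⟩
  have := Val.size_append r.car r.cdr.car
  rw [Polynomial.eval_one]
  -- The two results are disjoint subtrees of `r`; the constant `1` is needed only for `r = nil`,
  -- where both default to `nil`.
  rcases r with _ | ⟨a, _ | ⟨b, c⟩⟩ <;> simp [Val.size] at * <;> omega

/-- Prepending a list to the result. -/
theorem Lin.append_left {G : Val → Val → Val} (hG : PT fun z => G z.car z.cdr) (ha : Lin a) :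
    Lin fun q x r => (G q x).append (a q x r) := by
  obtain ⟨P, hP⟩ := ha
  obtain ⟨Q, hQ⟩ := Lin.of_PT hG
  refine ⟨P + Q + 1, fun q x r => ?_⟩
  have := hP q x r
  have := hQ q x .nil
  have := Val.size_append (G q x) (a q x r)
  simp [Val.size] at *
  omega

end

end SROIQ

/-! ### Syntactic operations as tree functions on encodings -/

namespace SROIQ

open Val

theorem con_congr₁ {k : ℕ} {a a' : Val} (h : a = a') : con k [a] = con k [a'] := by rw [h]

theorem con_congr₂ {k : ℕ} {a a' b b' : Val} (h : a = a') (h' : b = b') :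
    con k [a, b] = con k [a', b'] := by rw [h, h']

theorem con_congr₃ {k : ℕ} {a a' b b' c c' : Val} (h : a = a') (h' : b = b') (h'' : c = c') :
    con k [a, b, c] = con k [a', b', c'] := by rw [h, h', h'']

/-! ## Binary numerals -/

namespace Val

def one : Val := cons nil nil

def inc (x : Val) : Val :=
  lrec (fun _ => ofList [one]) (fun _ x v => x.car.ifnil (cons one x.cdr) (cons nil v)) nil x

/-- A leading digit `1` is dropped instead of becoming `0`. This keeps numerals canonical, so that
the result equals the encoding of the predecessor. -/
def dec (x : Val) : Val :=
  lrec (fun _ => nil) (fun _ x v => x.car.ifnil (cons one v) (x.cdr.ifnil nil (cons nil x.cdr)))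
    nil x

/-- The hypothesis excludes a leading zero: the number `Nat.bit false 0` has no digits at all. -/
theorem binary_bit (b : Bool) (n : ℕ) (h : n = 0 → b = true) :
    binary (Nat.bit b n) = cons (if b then one else nil) (binary n) := by
  rw [binary, Nat.bits_append_bit n b h]
  rfl

theorem binary_zero : binary 0 = nil := by simp [binary, ofList]

theorem inc_binary (n : ℕ) : inc (binary n) = binary (n + 1) := by
  induction n using Nat.binaryRec' with
  | zero =>
    rw [show 0 + 1 = Nat.bit true 0 from rfl, binary_bit _ _ (fun _ => rfl), binary_zero]
    rfl
  | bit b n h ih =>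
    rw [binary_bit _ _ h]
    cases b
    · rw [show Nat.bit false n + 1 = Nat.bit true n from rfl, binary_bit _ _ (fun _ => rfl)]
      rfl
    · rw [show Nat.bit true n + 1 = Nat.bit false (n + 1) by simp [Nat.bit]; omega,
        binary_bit _ _ (by omega), ← ih]
      rfl

theorem dec_binary (n : ℕ) : dec (binary (n + 1)) = binary n := by
  generalize hm : n + 1 = m
  induction m using Nat.binaryRec' generalizing n with
  | zero => omega
  | bit b m h ih =>
    rw [binary_bit _ _ h]
    cases b
    · obtain _ | m := m
      · simp at h
      · rw [show n = Nat.bit true m by simp [Nat.bit] at hm ⊢; omega,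
          binary_bit _ _ (fun _ => rfl), ← ih m rfl]
        rfl
    · rw [show n = Nat.bit false m by simp [Nat.bit] at hm ⊢; omega]
      obtain rfl | hm := eq_or_ne m 0
      · simp [binary_zero, dec, lrec, one]
      · rw [binary_bit _ _ (fun h => absurd h hm)]
        have : binary m ≠ nil := by
          obtain ⟨b, k, rfl, hk⟩ : ∃ b k, m = Nat.bit b k ∧ (k = 0 → b = true) := by
            clear ih h
            induction m using Nat.binaryRec' with
            | zero => exact absurd rfl hm
            | bit b k h _ => exact ⟨b, k, rfl, h⟩
          rw [binary_bit _ _ hk]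
          exact Val.noConfusion
        cases hb : binary m with
        | nil => exact absurd hb this
        | cons => rfl

/-- If it were `nil`, then `binary n = dec nil = nil`, and `binary (n + 1) = inc nil` would be a
`cons`. -/
theorem binary_succ_ne (n : ℕ) : binary (n + 1) ≠ nil := by
  intro h
  have h1 := inc_binary (n + 1)
  have h2 := dec_binary n
  have h3 := dec_binary (n + 1)
  rw [h] at h1 h2
  rw [← h1, show dec (inc nil) = nil from rfl, h] at h3
  rw [← inc_binary, ← h2] at h
  exact Val.noConfusion h

theorem ifnil_of_ne {x : Val} (h : x ≠ nil) (a b : Val) : x.ifnil a b = b := by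
  cases x with
  | nil => exact absurd rfl h
  | cons => rfl

end Val

section

variable {f g : Val → Val}

@[fun_prop]
theorem PT.inc (hf : PT f) : PT fun x => (f x).inc := by
  refine PT.lrec ?_ ?_ ?_ (.const _) hf
  · fun_prop
  · fun_prop
  · exact Lin.ifnil (Lin.of_PT (by fun_prop)) (Lin.cons (by fun_prop) Lin.result)

@[fun_prop]
theorem PT.dec (hf : PT f) : PT fun x => (f x).dec := by
  refine PT.lrec ?_ ?_ ?_ (.const _) hf
  · fun_prop
  · fun_prop
  · exact Lin.ifnil (Lin.cons (by fun_prop) Lin.result) (Lin.of_PT (by fun_prop))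

end

/-! ## Roles -/

namespace Val

/-- Copies of role names. -/
def nameAt (q r : Val) : Val :=
  r.car.sel3 (con 0 [con 0 [r.arg 0, q]]) (con 1 [con 0 [r.arg 0, q]]) r

def roleAtStep (_ : Bool) (q x l : Val) : Val :=
  x.car.sel5 (con 0 [nameAt q (x.arg 0)]) (con 1 [nameAt q (x.arg 0)]) (cons x.car l)
    (cons x.car l) (cons x.car l)

def roleAt (q r : Val) : Val := nrec roleAtStep (fun _ _ => nil) q r true true

def roleLowerAt (q r : Val) : Val :=
  r.car.ifnil ((r.arg 0).car.sel3 (roleAt q r) (con 0 [con 1 [con 1 [(r.arg 0).arg 0, q]]])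
    (roleAt q r)) (roleAt q r)

def nameNonsimples (r : Val) : Val := r.car.sel3 nil (cons (r.arg 0) nil) nil

def roleNonsimplesStep (_ : Bool) (_ x l : Val) : Val :=
  x.car.sel5 (nameNonsimples (x.arg 0)) (nameNonsimples (x.arg 0)) (append l.car l.cdr.car)
    (append l.car l.cdr.car) (append l.car l.cdr.car)

def roleNonsimples (r : Val) : Val := nrec roleNonsimplesStep (fun _ _ => nil) nil r true true

end Val

section

variable {f g : Val → Val}

@[fun_prop]
theorem PT.nameAt (hf : PT f) (hg : PT g) : PT fun x => (f x).nameAt (g x) := by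
  unfold Val.nameAt; fun_prop

@[fun_prop]
theorem PT.roleAt (hf : PT f) (hg : PT g) : PT fun x => (f x).roleAt (g x) := by
  refine PT.nrec true (fun _ => ?_) (fun _ => .const _) (fun _ => ?_) hf hg
  · unfold Val.roleAtStep; fun_prop
  · have := Lin.cons (G := fun _ x => x.car) (by fun_prop) Lin.result
    exact Lin.sel5 (Lin.of_PT (by fun_prop)) (Lin.of_PT (by fun_prop)) this this this

@[fun_prop]
theorem PT.roleLowerAt (hf : PT f) (hg : PT g) : PT fun x => (f x).roleLowerAt (g x) := by
  unfold Val.roleLowerAt; fun_prop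

@[fun_prop]
theorem PT.nameNonsimples (hf : PT f) : PT fun x => (f x).nameNonsimples := by
  unfold Val.nameNonsimples; fun_prop

@[fun_prop]
theorem PT.roleNonsimples (hf : PT f) : PT fun x => (f x).roleNonsimples := by
  refine PT.nrec true (fun _ => ?_) (fun _ => .const _) (fun _ => ?_) (.const _) hf
  · unfold Val.roleNonsimplesStep; fun_prop
  · exact Lin.sel5 (Lin.of_PT (by fun_prop)) (Lin.of_PT (by fun_prop)) Lin.append Lin.append
      Lin.append

variable {σ : Sig} (E : SigEnc σ)

theorem nameAt_enc (π : ℕ) (r : RName σ.Simp σ.NonSimp) :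
    nameAt (unary π) (encRName E r) = encRName E.trans (RName.at π r) := by
  rcases r with s | _ | _ <;> rfl

theorem roleAt_enc (π : ℕ) (r : Role σ.Simp σ.NonSimp) :
    roleAt (unary π) (encRole E r) = encRole E.trans (Role.at π r) := by
  induction r with
  | name r => exact con_congr₁ (nameAt_enc E π r)
  | inv r => exact con_congr₁ (nameAt_enc E π r)
  | union r s ihr ihs =>
    rw [encRole, roleAt, nrec_con]; exact con_congr₂ ihr ihs
  | inter r s ihr ihs =>
    rw [encRole, roleAt, nrec_con]; exact con_congr₂ ihr ihs
  | diff r s ihr ihs =>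
    rw [encRole, roleAt, nrec_con]; exact con_congr₂ ihr ihs

theorem roleLowerAt_enc (π : ℕ) (r : Role σ.Simp σ.NonSimp) :
    roleLowerAt (unary π) (encRole E r) = encRole E.trans (Role.lowerAt π r) := by
  rcases r with (_ | _ | _) | _ | _ | _ | _
  case name.nonsimple.named => rfl
  all_goals exact roleAt_enc E π _

theorem nameNonsimples_enc (r : RName σ.Simp σ.NonSimp) :
    nameNonsimples (encRName E r) = ofList (r.nonsimples.map E.nonsimp) := by
  rcases r with s | _ | _ <;> rfl

theorem roleNonsimples_enc (r : Role σ.Simp σ.NonSimp) :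
    roleNonsimples (encRole E r) = ofList (r.nonsimples.map E.nonsimp) := by
  induction r with
  | name r => exact nameNonsimples_enc E r
  | inv r => exact nameNonsimples_enc E r
  | union r s ihr ihs | inter r s ihr ihs | diff r s ihr ihs =>
    rw [encRole, roleNonsimples, nrec_con, Role.nonsimples, List.map_append, ← append_ofList,
      ← ihr, ← ihs]
    rfl

theorem encRName_ext (r : RName σ.Simp σ.NonSimp) :
    encRName E.ext (r : RName σ.ext.Simp σ.ext.NonSimp) = encRName E r := by
  rcases r with s | _ | _ <;> rfl

theorem encRole_ext (r : Role σ.Simp σ.NonSimp) :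
    encRole E.ext (r : Role σ.ext.Simp σ.ext.NonSimp) = encRole E r := by
  induction r with
  | name r => exact con_congr₁ (encRName_ext E r)
  | inv r => exact con_congr₁ (encRName_ext E r)
  | union r s ihr ihs => exact con_congr₂ ihr ihs
  | inter r s ihr ihs => exact con_congr₂ ihr ihs
  | diff r s ihr ihs => exact con_congr₂ ihr ihs

theorem encRIA_ext (ρ : RIA σ.Simp σ.NonSimp) :
    encRIA E.ext (ρ : RIA σ.ext.Simp σ.ext.NonSimp) = encRIA E ρ := by
  have h : encRole E.ext = encRole E := funext (encRole_ext E)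
  have h' : encRName E.ext = encRName E := funext (encRName_ext E)
  cases ρ <;> simp only [encRIA] <;> rw [h'] <;> rw [h]

end

/-! ## Concepts -/

namespace Val

def nnfStep : Bool → Val → Val → Val → Val
  | true, _, x, l => x.car.sel12 x x x x l.car (cons x.car l) (cons x.car l)
      (con 7 [x.arg 0, l.cdr.car]) (con 8 [x.arg 0, l.cdr.car]) x
      (con 10 [x.arg 0, x.arg 1, l.cdr.cdr.car]) (con 11 [x.arg 0, x.arg 1, l.cdr.cdr.car])
  | false, _, x, l => x.car.sel12 (con 4 [x]) (con 4 [x]) (con 3 []) (con 2 []) l.car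
      (cons (unary 6) l) (cons (unary 5) l)
      (con 8 [x.arg 0, l.cdr.car]) (con 7 [x.arg 0, l.cdr.car]) (con 4 [x])
      (con 11 [(x.arg 0).inc, x.arg 1, l.cdr.cdr.car])
      ((x.arg 0).ifnil (con 3 []) (con 10 [(x.arg 0).dec, x.arg 1, l.cdr.cdr.car]))

/-- Polarities of the children, with `nil` for the positive one. A negated number restriction keeps
its filler unnegated, whence the two final `nil` of the negative case. -/
def nnfPol : Bool → Val → Val
  | true, t => t.sel12 nil nil nil nil one nil nil nil nil nil nil nil
  | false, t => t.sel12 one one one one nil one one one one one nil nil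

/-- Negation normal form of concepts. -/
def nnf (b : Bool) (x : Val) : Val := nrec nnfStep nnfPol nil x true b

def liftStep (_ : Bool) (_ x l : Val) : Val :=
  x.car.sel12 (con 0 [con 0 [x.arg 0]]) x x x (cons x.car l) (cons x.car l) (cons x.car l)
      (con 7 [x.arg 0, l.cdr.car]) (con 8 [x.arg 0, l.cdr.car]) x
      (con 10 [x.arg 0, x.arg 1, l.cdr.cdr.car]) (con 11 [x.arg 0, x.arg 1, l.cdr.cdr.car])

/-- Translation of concepts into the extended vocabulary. -/
def lift (x : Val) : Val := nrec liftStep (fun _ _ => nil) nil x true true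

def replaceStep (b : Bool) (q x l : Val) : Val :=
  x.car.sel12 (con 0 [con 0 [x.arg 0, q]]) (con 1 [con 0 [x.arg 0]]) x x
    (cons x.car l) (cons x.car l) (cons x.car l)
    (con 7 [bif b then roleAt q (x.arg 0) else roleLowerAt q (x.arg 0), l.cdr.car])
    (con 8 [bif b then roleLowerAt q (x.arg 0) else roleAt q (x.arg 0), l.cdr.car])
    (con 9 [roleAt q (x.arg 0)])
    (con 10 [x.arg 0, roleAt q (x.arg 1), l.cdr.cdr.car])
    (con 11 [x.arg 0, roleAt q (x.arg 1), l.cdr.cdr.car])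

/-- The polarity changes exactly below negation (tag `4`) and `≤ n` (tag `10`). -/
def replacePol : Bool → Val → Val
  | true, t => t.sel12 nil nil nil nil one nil nil nil nil nil one nil
  | false, t => t.sel12 one one one one nil one one one one one nil one

/-- Replacement of names by copies in concepts. -/
def replace (b : Bool) (q x : Val) : Val := nrec replaceStep replacePol q x true b

def conceptAt (q x : Val) : Val := replace true q (nnf true x)

def nonsimplesStep (_ : Bool) (_ x l : Val) : Val :=
  x.car.sel12 nil nil nil nil l.car (append l.car l.cdr.car) (append l.car l.cdr.car)
    (append (roleNonsimples (x.arg 0)) l.cdr.car) (append (roleNonsimples (x.arg 0)) l.cdr.car)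
    (roleNonsimples (x.arg 0))
    (append (roleNonsimples (x.arg 1)) l.cdr.cdr.car)
    (append (roleNonsimples (x.arg 1)) l.cdr.cdr.car)

/-- The non-simple role names in concepts. -/
def nonsimples (x : Val) : Val := nrec nonsimplesStep (fun _ _ => nil) nil x true true

end Val

section

variable {f g : Val → Val}

@[fun_prop]
theorem PT.nnf (b : Bool) (hf : PT f) : PT fun x => (f x).nnf b := by
  refine PT.nrec b (fun b => ?_) (fun b => ?_) (fun b => ?_) (.const _) hf
  · cases b <;> (unfold Val.nnfStep; fun_prop)
  · cases b <;> (unfold Val.nnfPol; fun_prop)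
  · cases b <;> unfold Val.nnfStep <;> apply Lin.sel12 <;> first
        | exact Lin.of_PT (by fun_prop)
        | exact Lin.cons (by fun_prop) Lin.result
        | exact Lin.result.car
        | exact Lin.con2 _ (by fun_prop) Lin.result.cdr.car
        | exact Lin.con3 _ (by fun_prop) (by fun_prop) Lin.result.cdr.cdr.car
        | exact Lin.ifnil (Lin.of_PT (by fun_prop))
            (Lin.con3 _ (by fun_prop) (by fun_prop) Lin.result.cdr.cdr.car)

@[fun_prop]
theorem PT.lift (hf : PT f) : PT fun x => (f x).lift := by
  refine PT.nrec true (fun b => ?_) (fun _ => .const _) (fun b => ?_) (.const _) hf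
  · unfold Val.liftStep; fun_prop
  · unfold Val.liftStep
    apply Lin.sel12 <;> first
        | exact Lin.of_PT (by fun_prop)
        | exact Lin.cons (by fun_prop) Lin.result
        | exact Lin.con2 _ (by fun_prop) Lin.result.cdr.car
        | exact Lin.con3 _ (by fun_prop) (by fun_prop) Lin.result.cdr.cdr.car

@[fun_prop]
theorem PT.replace (b : Bool) (hf : PT f) (hg : PT g) : PT fun x => replace b (f x) (g x) := by
  refine PT.nrec b (fun b => ?_) (fun b => ?_) (fun b => ?_) hf hg
  · cases b <;> (unfold Val.replaceStep; simp only [cond_true, cond_false]; fun_prop)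
  · cases b <;> (unfold Val.replacePol; fun_prop)
  · cases b <;> unfold Val.replaceStep <;> simp only [cond_true, cond_false] <;>
      apply Lin.sel12 <;> first
        | exact Lin.of_PT (by fun_prop)
        | exact Lin.cons (by fun_prop) Lin.result
        | exact Lin.con2 _ (by fun_prop) Lin.result.cdr.car
        | exact Lin.con3 _ (by fun_prop) (by fun_prop) Lin.result.cdr.cdr.car

@[fun_prop]
theorem PT.conceptAt (hf : PT f) (hg : PT g) : PT fun x => conceptAt (f x) (g x) := by
  unfold Val.conceptAt; fun_prop

@[fun_prop]
theorem PT.nonsimples (hf : PT f) : PT fun x => (f x).nonsimples := by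
  refine PT.nrec true (fun b => ?_) (fun _ => .const _) (fun b => ?_) (.const _) hf
  · unfold Val.nonsimplesStep; fun_prop
  · unfold Val.nonsimplesStep
    apply_rules [Lin.sel12, Lin.append, Lin.append_left, Lin.result.car, Lin.result.cdr.car,
      Lin.result.cdr.cdr.car] <;>
      first
        | exact Lin.of_PT (by fun_prop)
        | fun_prop

variable {σ : Sig} (E : SigEnc σ)

theorem nnf_enc (C : Concept σ) (b : Bool) :
    nnf b (encConcept E C) = encConcept E (C.nnf b) := by
  induction C generalizing b with
  | atom A | nominal a | top | bot | self r => cases b <;> rfl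
  | neg C ih => cases b <;> (rw [encConcept, nnf, nrec_con]; exact ih _)
  | inf C D ihC ihD =>
    cases b <;> (rw [encConcept, nnf, nrec_con]; exact con_congr₂ (ihC _) (ihD _))
  | sup C D ihC ihD =>
    cases b <;> (rw [encConcept, nnf, nrec_con]; exact con_congr₂ (ihC _) (ihD _))
  | all r C ih | ex r C ih =>
    cases b <;> (rw [encConcept, nnf, nrec_con]
                 exact con_congr₂ (a := encRole E r) (a' := encRole E r) rfl (ih _))
  | atMost n r C ih =>
    cases b
    · rw [encConcept, nnf, nrec_con]
      exact con_congr₃ (inc_binary n) rfl (ih true)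
    · rw [encConcept, nnf, nrec_con]
      exact con_congr₃ rfl rfl (ih true)
  | atLeast n r C ih =>
    cases b
    · rw [encConcept, nnf, nrec_con]
      obtain _ | n := n
      · rfl
      · refine (ifnil_of_ne (binary_succ_ne n) _ _).trans ?_
        exact con_congr₃ (dec_binary n) rfl (ih true)
    · rw [encConcept, nnf, nrec_con]
      have : (Concept.atLeast n r C).nnf true = .atLeast n r (C.nnf true) := by cases n <;> rfl
      rw [this]
      exact con_congr₃ rfl rfl (ih true)

theorem lift_enc (C : Concept σ) : lift (encConcept E C) = encConcept E.ext C.lift := by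
  induction C with
  | atom A | nominal a | top | bot => rfl
  | self r => exact (con_congr₁ (encRole_ext E r)).symm
  | neg C ih => rw [encConcept, lift, nrec_con]; exact con_congr₁ ih
  | inf C D ihC ihD =>
    rw [encConcept, lift, nrec_con]; exact con_congr₂ ihC ihD
  | sup C D ihC ihD =>
    rw [encConcept, lift, nrec_con]; exact con_congr₂ ihC ihD
  | all r C ih | ex r C ih =>
    rw [encConcept, lift, nrec_con]
    exact con_congr₂ (encRole_ext E r).symm ih
  | atMost n r C ih | atLeast n r C ih =>
    rw [encConcept, lift, nrec_con]
    exact con_congr₃ rfl (encRole_ext E r).symm ih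

theorem replace_enc (π : ℕ) (C : Concept σ) (b : Bool) :
    replace b (unary π) (encConcept E C) = encConcept E.trans (C.replace π b) := by
  induction C generalizing b with
  | atom A | nominal a | top | bot => cases b <;> rfl
  | self r => cases b <;> exact con_congr₁ (roleAt_enc E π r)
  | neg C ih =>
    cases b <;> (rw [encConcept, replace, nrec_con]; exact con_congr₁ (ih _))
  | inf C D ihC ihD | sup C D ihC ihD =>
    cases b <;> (rw [encConcept, replace, nrec_con]; exact con_congr₂ (ihC _) (ihD _))
  | all r C ih =>
    cases b <;> rw [encConcept, replace, nrec_con]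
    · exact con_congr₂ (roleLowerAt_enc E π r) (ih false)
    · exact con_congr₂ (roleAt_enc E π r) (ih true)
  | ex r C ih =>
    cases b <;> rw [encConcept, replace, nrec_con]
    · exact con_congr₂ (roleAt_enc E π r) (ih false)
    · exact con_congr₂ (roleLowerAt_enc E π r) (ih true)
  | atMost n r C ih | atLeast n r C ih =>
    cases b <;> (rw [encConcept, replace, nrec_con]
                 exact con_congr₃ rfl (roleAt_enc E π r) (ih _))

theorem conceptAt_enc (π : ℕ) (C : Concept σ) :
    conceptAt (unary π) (encConcept E C) = encConcept E.trans (C.at π) := by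
  rw [conceptAt, nnf_enc, replace_enc, Concept.at]

theorem nonsimples_enc (C : Concept σ) :
    nonsimples (encConcept E C) = ofList (C.nonsimples.map E.nonsimp) := by
  induction C with
  | atom A | nominal a | top | bot => rfl
  | self r => exact roleNonsimples_enc E r
  | neg C ih => rw [encConcept, nonsimples, nrec_con]; exact ih
  | inf C D ihC ihD | sup C D ihC ihD =>
    rw [encConcept, nonsimples, nrec_con, Concept.nonsimples, List.map_append, ← append_ofList,
      ← ihC, ← ihD]
    rfl
  | all r C ih | ex r C ih | atMost n r C ih | atLeast n r C ih =>
    rw [encConcept, nonsimples, nrec_con, Concept.nonsimples, List.map_append, ← append_ofList,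
      ← ih, ← roleNonsimples_enc]
    rfl

end

end SROIQ

namespace SROIQ

open Val

/-! ## Normal forms of sentences -/

namespace Val

def axmLift (x : Val) : Val :=
  x.car.sel6 (con 0 [lift (x.arg 0), x.arg 1]) x x x (con 4 [lift (x.arg 0), lift (x.arg 1)]) x

def sentLiftStep (_ : Bool) (_ x l : Val) : Val :=
  x.car.sel6 (con 0 [axmLift (x.arg 0)]) (cons x.car l) (cons x.car l) (cons x.car l)
    (con 4 [x.arg 0, l.cdr.car]) (con 5 [x.arg 0, l.cdr.car])

def sentLift (x : Val) : Val := nrec sentLiftStep (fun _ _ => nil) nil x true true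

def sentNnfStep : Bool → Val → Val → Val → Val
  | true, _, x, l => x.car.sel6 x l.car (cons x.car l) (cons x.car l)
      (con 4 [x.arg 0, l.cdr.car]) (con 5 [x.arg 0, l.cdr.car])
  | false, _, x, l => x.car.sel6 (con 1 [x]) l.car (cons (unary 3) l) (cons (unary 2) l)
      (con 5 [x.arg 0, l.cdr.car]) (con 4 [x.arg 0, l.cdr.car])

def sentNnfPol : Bool → Val → Val
  | true, t => t.sel6 nil one nil nil nil nil
  | false, t => t.sel6 one nil one one one one

def sentNnf (b : Bool) (x : Val) : Val := nrec sentNnfStep sentNnfPol nil x true b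

def modalStep (_ : Bool) (_ x l : Val) : Val :=
  x.car.sel6 nil l.car (l.car.ifnil l.cdr.car l.car) (l.car.ifnil l.cdr.car l.car) one one

/-- Whether there are modalities (`nil` if not). -/
def modal (x : Val) : Val := nrec modalStep (fun _ _ => nil) nil x true true

def nestedStep (_ : Bool) (_ x l : Val) : Val :=
  x.car.sel6 nil l.car (l.car.ifnil l.cdr.car l.car) (l.car.ifnil l.cdr.car l.car)
    (modal (x.arg 1)) (modal (x.arg 1))

/-- Whether there are nested modalities (`nil` if not). -/
def nested (x : Val) : Val := nrec nestedStep (fun _ _ => nil) nil x true true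

def freshLit (x : Val) : Val := con 0 [con 4 [con 2 [], con 0 [con 1 [x]]]]

def lit (x : Val) : Val :=
  x.car.sel6 (con 0 [axmLift (x.arg 0)])
    ((x.arg 0).car.ifnil (con 1 [con 0 [axmLift ((x.arg 0).arg 0)]]) (freshLit x))
    (freshLit x) (freshLit x) (freshLit x) (freshLit x)

def defsStep (_ : Bool) (_ x l : Val) : Val :=
  x.car.sel6 nil nil
    (cons (con 3 [con 1 [lit x], con 2 [lit (x.arg 0), lit (x.arg 1)]]) (append l.car l.cdr.car))
    (cons (con 3 [con 1 [lit x], con 3 [lit (x.arg 0), lit (x.arg 1)]]) (append l.car l.cdr.car))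
    (cons (con 3 [con 1 [lit x], con 4 [x.arg 0, lit (x.arg 1)]]) l.cdr.car)
    (cons (con 3 [con 1 [lit x], con 5 [x.arg 0, lit (x.arg 1)]]) l.cdr.car)

def defs (x : Val) : Val := nrec defsStep (fun _ _ => nil) nil x true true

def reverse (x : Val) : Val :=
  lrec (fun _ => nil) (fun _ x v => append v (cons x.car nil)) nil x

/-- `lrec` folds from the right, so the left fold of the conjuncts runs over the reversed list. -/
def structural (x : Val) : Val :=
  lrec (fun q => q) (fun _ y v => con 2 [v, y.car]) (lit x) (reverse (defs x))

def normal (x : Val) : Val :=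
  (nested x).ifnil (sentLift (sentNnf true x)) (structural (sentNnf true x))

end Val

theorem Lin.or : Lin fun _ _ l => l.car.ifnil l.cdr.car l.car :=
  Lin.ifnil Lin.result.cdr.car Lin.result.car

section

variable {f g : Val → Val}

@[fun_prop]
theorem PT.axmLift (hf : PT f) : PT fun x => (f x).axmLift := by
  unfold Val.axmLift; fun_prop

@[fun_prop]
theorem PT.sentLift (hf : PT f) : PT fun x => (f x).sentLift := by
  refine PT.nrec true (fun b => ?_) (fun _ => .const _) (fun b => ?_) (.const _) hf
  · unfold Val.sentLiftStep; fun_prop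
  · unfold Val.sentLiftStep
    apply Lin.sel6 <;> first
      | exact Lin.of_PT (by fun_prop)
      | exact Lin.cons (by fun_prop) Lin.result
      | exact Lin.con2 _ (by fun_prop) Lin.result.cdr.car

@[fun_prop]
theorem PT.sentNnf (b : Bool) (hf : PT f) : PT fun x => (f x).sentNnf b := by
  refine PT.nrec b (fun b => ?_) (fun b => ?_) (fun b => ?_) (.const _) hf
  · cases b <;> (unfold Val.sentNnfStep; fun_prop)
  · cases b <;> (unfold Val.sentNnfPol; fun_prop)
  · cases b <;> unfold Val.sentNnfStep <;> apply Lin.sel6 <;> first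
      | exact Lin.of_PT (by fun_prop)
      | exact Lin.cons (by fun_prop) Lin.result
      | exact Lin.result.car
      | exact Lin.con2 _ (by fun_prop) Lin.result.cdr.car

@[fun_prop]
theorem PT.modal (hf : PT f) : PT fun x => (f x).modal := by
  refine PT.nrec true (fun b => ?_) (fun _ => .const _) (fun b => ?_) (.const _) hf
  · unfold Val.modalStep; fun_prop
  · exact Lin.sel6 (Lin.of_PT (by fun_prop)) Lin.result.car Lin.or Lin.or
      (Lin.of_PT (by fun_prop)) (Lin.of_PT (by fun_prop))

@[fun_prop]
theorem PT.nested (hf : PT f) : PT fun x => (f x).nested := by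
  refine PT.nrec true (fun b => ?_) (fun _ => .const _) (fun b => ?_) (.const _) hf
  · unfold Val.nestedStep; fun_prop
  · exact Lin.sel6 (Lin.of_PT (by fun_prop)) Lin.result.car Lin.or Lin.or
      (Lin.of_PT (by fun_prop)) (Lin.of_PT (by fun_prop))

@[fun_prop]
theorem PT.lit (hf : PT f) : PT fun x => (f x).lit := by
  unfold Val.lit Val.freshLit; fun_prop

@[fun_prop]
theorem PT.defs (hf : PT f) : PT fun x => (f x).defs := by
  refine PT.nrec true (fun b => ?_) (fun _ => .const _) (fun b => ?_) (.const _) hf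
  · unfold Val.defsStep; fun_prop
  · exact Lin.sel6 (Lin.of_PT (by fun_prop)) (Lin.of_PT (by fun_prop))
      (Lin.cons (by fun_prop) Lin.append) (Lin.cons (by fun_prop) Lin.append)
      (Lin.cons (by fun_prop) Lin.result.cdr.car) (Lin.cons (by fun_prop) Lin.result.cdr.car)

@[fun_prop]
theorem PT.reverse (hf : PT f) : PT fun x => (f x).reverse := by
  refine PT.lrec ?_ ?_ ?_ (.const _) hf
  · fun_prop
  · fun_prop
  · refine ⟨Polynomial.X + 2, fun q x l => (Val.size_append _ _).trans ?_⟩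
    have := x.size_car_le
    simp [Val.size]
    omega

@[fun_prop]
theorem PT.structural (hf : PT f) : PT fun x => (f x).structural := by
  refine PT.lrec ?_ ?_ ?_ (by fun_prop) (by fun_prop)
  · fun_prop
  · fun_prop
  · exact Lin.cons (.const _) (Lin.cons' Lin.result (PT.cons (by fun_prop) (.const _)))

@[fun_prop]
theorem PT.normal (hf : PT f) : PT fun x => (f x).normal := by
  unfold Val.normal; fun_prop

variable {σ : Sig} (E : SigEnc σ)

theorem axmLift_enc (α : Axm σ) : axmLift (encAxm E α) = encAxm E.ext α.lift := by
  cases α with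
  | inst C a => exact con_congr₂ (lift_enc E C) rfl
  | link r a b => exact con_congr₃ (encRole_ext E r).symm rfl rfl
  | eq a b | ne a b => rfl
  | gci C D => exact con_congr₂ (lift_enc E C) (lift_enc E D)
  | ria ρ => exact con_congr₁ (encRIA_ext E ρ).symm

theorem sentLift_enc (φ : Sent σ) : sentLift (encSent E φ) = encSent E.ext φ.lift := by
  induction φ with
  | ax α => exact con_congr₁ (axmLift_enc E α)
  | neg φ ih => rw [encSent, sentLift, nrec_con]; exact con_congr₁ ih
  | and φ ψ ih ih' | or φ ψ ih ih' => rw [encSent, sentLift, nrec_con]; exact con_congr₂ ih ih'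
  | box e φ ih | dia e φ ih => rw [encSent, sentLift, nrec_con]; exact con_congr₂ rfl ih

theorem sentNnf_enc (φ : Sent σ) (b : Bool) :
    sentNnf b (encSent E φ) = encSent E (φ.nnf b) := by
  induction φ generalizing b with
  | ax α => cases b <;> rfl
  | neg φ ih => cases b <;> (rw [encSent, sentNnf, nrec_con]; exact ih _)
  | and φ ψ ih ih' | or φ ψ ih ih' =>
    cases b <;> (rw [encSent, sentNnf, nrec_con]; exact con_congr₂ (ih _) (ih' _))
  | box e φ ih | dia e φ ih =>
    cases b <;> (rw [encSent, sentNnf, nrec_con]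
                 exact con_congr₂ (a := encStExpr e) (a' := encStExpr e) rfl (ih _))

theorem modal_enc (φ : Sent σ) : modal (encSent E φ) = nil ↔ φ.degree = 0 := by
  induction φ with
  | ax α => exact iff_of_true rfl rfl
  | neg φ ih => rw [encSent, modal, nrec_con]; exact ih
  | and φ ψ ih ih' | or φ ψ ih ih' =>
    rw [encSent, modal, nrec_con, Sent.degree, Nat.max_eq_zero_iff, ← ih, ← ih']
    show (modal (encSent E φ)).ifnil (modal (encSent E ψ)) (modal (encSent E φ)) = nil ↔ _
    cases modal (encSent E φ) <;> simp
  | box e φ ih | dia e φ ih => exact iff_of_false Val.noConfusion (Nat.succ_ne_zero _)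

theorem nested_enc (φ : Sent σ) : nested (encSent E φ) = nil ↔ φ.degree ≤ 1 := by
  induction φ with
  | ax α => exact iff_of_true rfl (Nat.zero_le _)
  | neg φ ih => rw [encSent, nested, nrec_con]; exact ih
  | and φ ψ ih ih' | or φ ψ ih ih' =>
    rw [encSent, nested, nrec_con, Sent.degree, max_le_iff, ← ih, ← ih']
    show (nested (encSent E φ)).ifnil (nested (encSent E ψ)) (nested (encSent E φ)) = nil ↔ _
    cases nested (encSent E φ) <;> simp
  | box e φ ih | dia e φ ih =>
    rw [encSent, nested, nrec_con, Sent.degree, Nat.succ_le_succ_iff, Nat.le_zero, ← modal_enc E]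
    rfl

theorem lit_enc (φ : Sent σ) : lit (encSent E φ) = encSent E.ext φ.lit := by
  cases φ with
  | ax α => exact con_congr₁ (axmLift_enc E α)
  | neg φ =>
    cases φ with
    | ax α => exact con_congr₁ (con_congr₁ (axmLift_enc E α))
    | _ => rfl
  | _ => rfl

theorem defs_enc (φ : Sent σ) : defs (encSent E φ) = ofList (φ.defs.map (encSent E.ext)) := by
  induction φ with
  | ax α => rfl
  | neg φ ih => rw [encSent, defs, nrec_con]; rfl
  | and φ ψ ih ih' | or φ ψ ih ih' =>
    rw [Sent.defs, List.map_cons, List.map_append, ofList, ← append_ofList, ← ih, ← ih']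
    simp only [encSent, ← lit_enc E]
    rw [defs, nrec_con]
    rfl
  | box e φ ih | dia e φ ih =>
    rw [Sent.defs, List.map_cons, ofList, ← ih]
    simp only [encSent, ← lit_enc E]
    rw [defs, nrec_con]
    rfl

theorem reverse_ofList (l : List Val) : reverse (ofList l) = ofList l.reverse := by
  induction l with
  | nil => rfl
  | cons a l ih =>
    rw [List.reverse_cons, ← append_ofList, ← ih]
    rfl

theorem structural_enc (φ : Sent σ) :
    structural (encSent E φ) = encSent E.ext φ.structural := by
  rw [Sent.structural, structural, lit_enc, defs_enc, reverse_ofList,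
    lrec_ofList (k := fun _ a v => con 2 [v, a]), List.foldr_reverse]
  generalize φ.lit = ψ
  induction φ.defs generalizing ψ with
  | nil => rfl
  | cons χ l ih => exact ih (.and ψ χ)

theorem normal_enc (φ : Sent σ) : normal (encSent E φ) = encSent E.ext φ.normal := by
  rw [Sent.normal, normal]
  split_ifs with h
  · rw [(nested_enc E φ).2 h, ifnil_nil, sentNnf_enc, sentLift_enc]
  · rw [ifnil_of_ne (mt (nested_enc E φ).1 h), sentNnf_enc, structural_enc]

end

/-! ## Counting subsentences -/

namespace Val

/-- Equality of trees (`nil` if equal). -/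
def eqv : Val → Val → Val
  | q, nil => q.ifnil nil one
  | q, cons a b => q.ifnil one ((eqv q.car a).ifnil (eqv q.cdr b) one)

theorem eqv_eq_nil (x y : Val) : eqv x y = nil ↔ x = y := by
  induction y generalizing x with
  | nil => cases x <;> simp [eqv, one]
  | cons a b iha ihb =>
    cases x with
    | nil => simp [eqv, one]
    | cons c d =>
      simp only [eqv, ifnil_cons, car_cons, cdr_cons, cons.injEq, ← iha, ← ihb]
      cases eqv c a <;> simp [one]

/-- Supplies the bound on results that `PT.treeRec` asks for. -/
theorem size_eqv (x y : Val) : (eqv x y).size ≤ 3 := by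
  induction y generalizing x with
  | nil => cases x <;> simp [eqv, one, size]
  | cons a b iha ihb =>
    cases x with
    | nil => simp [eqv, one, size]
    | cons c d =>
      have := ihb d
      simp only [eqv, ifnil_cons, car_cons, cdr_cons]
      cases eqv c a <;> simp [one, size]
      exact this

/-- Membership in a list (`nil` if it holds). -/
def mem (q x : Val) : Val := lrec (fun _ => one) (fun q x v => (eqv q x.car).ifnil nil v) q x

theorem mem_ofList (q : Val) (l : List Val) : mem q (ofList l) = nil ↔ q ∈ l := by
  induction l with
  | nil => simp [mem, ofList, lrec, one]
  | cons a l ih =>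
    rw [List.mem_cons, ← ih, ← eqv_eq_nil q a]
    show (eqv q a).ifnil nil (mem q (ofList l)) = nil ↔ _
    cases eqv q a <;> simp

/-- The number of distinct elements of a list, in unary. -/
def count (x : Val) : Val :=
  lrec (fun _ => nil) (fun _ x v => (mem x.car x.cdr).ifnil v (cons nil v)) nil x

/-- An entry is counted if it does not recur later in the list, which is also the entry that `dedup`
keeps. Counting codes amounts to counting objects only for an injective encoding; this is what the
injectivity results are for. -/
theorem count_ofList {α : Type} [DecidableEq α] (f : α → Val) (hf : Function.Injective f)
    (l : List α) : count (ofList (l.map f)) = unary l.dedup.length := by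
  induction l with
  | nil => rfl
  | cons a l ih =>
    show (mem (f a) (ofList (l.map f))).ifnil (count (ofList (l.map f)))
      (cons nil (count (ofList (l.map f)))) = _
    rw [ih]
    by_cases h : a ∈ l
    · rw [(mem_ofList _ _).2 (List.mem_map_of_mem h), List.dedup_cons_of_mem h]
      rfl
    · rw [ifnil_of_ne, List.dedup_cons_of_notMem h]
      · rfl
      · rw [Ne, mem_ofList, List.mem_map]
        rintro ⟨b, hb, h'⟩
        exact h (hf h' ▸ hb)

/-- The numerals below a unary numeral. -/
def range (x : Val) : Val :=
  reverse (lrec (fun _ => nil) (fun _ x v => cons x.cdr v) nil x)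

theorem range_unary (n : ℕ) : range (unary n) = ofList ((List.range n).map unary) := by
  rw [← List.reverse_reverse (List.map unary (List.range n)), ← reverse_ofList, range]
  congr 1
  induction n with
  | zero => rfl
  | succ n ih =>
    rw [List.range_succ, List.map_append, List.reverse_append]
    exact congrArg (cons (unary n)) ih

def subsStep (_ : Bool) (_ x l : Val) : Val :=
  cons x (x.car.sel6 nil l.car (append l.car l.cdr.car) (append l.car l.cdr.car)
    l.cdr.car l.cdr.car)

/-- The list of subsentences. -/
def subs (x : Val) : Val := nrec subsStep (fun _ _ => nil) nil x true true

end Val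

section

variable {f g : Val → Val}

-- The recursion descends in both trees at once: the second is the recursion argument and the first
-- is the parameter, replaced by its `car` or `cdr`.
@[fun_prop]
theorem PT.eqv (hf : PT f) (hg : PT g) : PT fun x => eqv (f x) (g x) := by
  refine (PT.treeRec (F := Val.eqv) (g := fun q => q.ifnil .nil Val.one)
    (h := fun q _ _ u v => q.ifnil Val.one (u.ifnil v Val.one)) (σ₁ := fun q _ _ => q.car)
    (σ₂ := fun q _ _ => q.cdr) 0 (fun q => by rw [Val.eqv]) (fun q a b => by rw [Val.eqv])
    ?_ ?_ ?_ ?_ ?_ ?_ ?_).comp (hf.cons hg)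
  · fun_prop
  · fun_prop
  · fun_prop
  · fun_prop
  · exact fun q _ _ => q.size_car_le.trans (le_max_left _ _)
  · exact fun q _ _ => q.size_cdr_le.trans (le_max_left _ _)
  · exact ⟨3, fun q x => by simpa using size_eqv q x⟩

@[fun_prop]
theorem PT.mem (hf : PT f) (hg : PT g) : PT fun x => mem (f x) (g x) := by
  refine PT.lrec ?_ ?_ ?_ hf hg
  · fun_prop
  · fun_prop
  · exact Lin.ifnil (Lin.of_PT (by fun_prop)) Lin.result

@[fun_prop]
theorem PT.count (hf : PT f) : PT fun x => count (f x) := by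
  refine PT.lrec ?_ ?_ ?_ (.const _) hf
  · fun_prop
  · fun_prop
  · exact Lin.ifnil Lin.result (Lin.cons (by fun_prop) Lin.result)

@[fun_prop]
theorem PT.range (hf : PT f) : PT fun x => range (f x) := by
  refine PT.reverse (PT.lrec ?_ ?_ ?_ (.const _) hf)
  · fun_prop
  · fun_prop
  · exact Lin.cons (by fun_prop) Lin.result

@[fun_prop]
theorem PT.subs (hf : PT f) : PT fun x => (f x).subs := by
  refine PT.nrec true (fun b => ?_) (fun _ => .const _) (fun b => ?_) (.const _) hf
  · unfold Val.subsStep; fun_prop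
  · exact Lin.cons (by fun_prop) (Lin.sel6 (Lin.of_PT (by fun_prop)) Lin.result.car Lin.append
      Lin.append Lin.result.cdr.car Lin.result.cdr.car)

variable {σ : Sig} (E : SigEnc σ)

/-- The list of subsentences, with repetitions. -/
def Sent.subList : Sent σ → List (Sent σ)
  | .ax α => [.ax α]
  | .neg φ => .neg φ :: φ.subList
  | .and φ ψ => .and φ ψ :: (φ.subList ++ ψ.subList)
  | .or φ ψ => .or φ ψ :: (φ.subList ++ ψ.subList)
  | .box e φ => .box e φ :: φ.subList
  | .dia e φ => .dia e φ :: φ.subList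

theorem Sent.mem_subList (φ ψ : Sent σ) : ψ ∈ φ.subList ↔ ψ ∈ φ.sub := by
  induction φ <;> simp_all [Sent.subList, Sent.sub]

theorem Sent.card_eq [DecidableEq (Sent σ)] (φ : Sent σ) : φ.card = φ.subList.dedup.length := by
  have : φ.sub = (φ.subList.toFinset : Set (Sent σ)) := by
    ext ψ
    simp [Sent.mem_subList]
  rw [Sent.card, this, Set.ncard_coe_finset, List.card_toFinset]

theorem subs_enc (φ : Sent σ) : subs (encSent E φ) = ofList (φ.subList.map (encSent E)) := by
  induction φ with
  | ax α => rfl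
  | neg φ ih =>
    rw [Sent.subList, List.map_cons, ofList, ← ih, encSent, subs, nrec_con]
    rfl
  | and φ ψ ih ih' | or φ ψ ih ih' =>
    rw [Sent.subList, List.map_cons, List.map_append, ofList, ← append_ofList, ← ih, ← ih',
      encSent, subs, nrec_con]
    rfl
  | box e φ ih | dia e φ ih =>
    rw [Sent.subList, List.map_cons, ofList, ← ih, encSent, subs, nrec_con]
    rfl

end

end SROIQ

namespace SROIQ

open Val

/-! ## Injectivity of the encodings -/

namespace Val

theorem unary_injective : Function.Injective unary := by
  intro m
  induction m with
  | zero => intro n h; cases n with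
    | zero => rfl
    | succ n => exact Val.noConfusion h
  | succ m ih => intro n h; cases n with
    | zero => exact Val.noConfusion h
    | succ n => exact congrArg Nat.succ (ih (by injection h))

theorem ofList_injective : Function.Injective ofList := by
  intro l
  induction l with
  | nil => intro m h; cases m with
    | nil => rfl
    | cons b m => exact Val.noConfusion h
  | cons a l ih => intro m h; cases m with
    | nil => exact Val.noConfusion h
    | cons b m =>
      injection h with h h'
      rw [h, ih h']

theorem con_inj (k k' : ℕ) (l l' : List Val) : con k l = con k' l' ↔ k = k' ∧ l = l' := by
  rw [con, con, cons.injEq, unary_injective.eq_iff, ofList_injective.eq_iff]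

/-- `dec` strips one successor on both sides, and `binary_succ_ne` separates zero from successors.
-/
theorem binary_injective : Function.Injective binary := by
  intro m
  induction m with
  | zero => intro n h; cases n with
    | zero => rfl
    | succ n => exact absurd (h.symm.trans binary_zero) (binary_succ_ne n)
  | succ m ih => intro n h; cases n with
    | zero => exact absurd (h.trans binary_zero) (binary_succ_ne m)
    | succ n =>
      rw [ih (a₂ := n)]
      rw [← dec_binary m, h, dec_binary]

end Val

/-- All names have different encodings. -/
structure SigEnc.Injective {σ : Sig} (E : SigEnc σ) : Prop where
  ind : Function.Injective E.ind
  con : Function.Injective E.con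
  simp : Function.Injective E.simp
  nonsimp : Function.Injective E.nonsimp

section

variable {σ : Sig} {E : SigEnc σ}

theorem encRName_injective (hE : E.Injective) : Function.Injective (encRName E) := by
  rintro (s | _ | _) (s | _ | _) <;>
    simp [encRName, con_inj, hE.simp.eq_iff, hE.nonsimp.eq_iff]

theorem encRole_injective (hE : E.Injective) : Function.Injective (encRole E) := by
  intro r
  induction r with
  | name r | inv r =>
    rintro (_ | _) <;> simp [encRole, con_inj, (encRName_injective hE).eq_iff]
  | union r s ihr ihs | inter r s ihr ihs | diff r s ihr ihs =>
    rintro (_ | _) <;> simp [encRole, con_inj]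
    exact fun h h' => ⟨ihr h, ihs h'⟩

theorem encRIA_injective (hE : E.Injective) : Function.Injective (encRIA E) := by
  rintro (_ | _) (_ | _) <;>
    simp [encRIA, con_inj, (encRName_injective hE).eq_iff, ofList_injective.eq_iff,
      (List.map_injective_iff.2 (encRole_injective hE)).eq_iff]

theorem encConcept_injective (hE : E.Injective) : Function.Injective (encConcept E) := by
  intro C
  induction C with
  | atom A | nominal a | top | bot | self r =>
    rintro (_ | _) <;>
      simp [encConcept, con_inj, hE.con.eq_iff, hE.ind.eq_iff, (encRole_injective hE).eq_iff]
  | neg C ih =>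
    rintro (_ | _) <;> simp [encConcept, con_inj]
    exact fun h => ih h
  | inf C D ihC ihD | sup C D ihC ihD =>
    rintro (_ | _) <;> simp [encConcept, con_inj]
    exact fun h h' => ⟨ihC h, ihD h'⟩
  | all r C ih | ex r C ih =>
    rintro (_ | _) <;> simp [encConcept, con_inj, (encRole_injective hE).eq_iff]
    exact fun h h' => ⟨h, ih h'⟩
  | atMost n r C ih | atLeast n r C ih =>
    rintro (_ | _) <;>
      simp [encConcept, con_inj, (encRole_injective hE).eq_iff, binary_injective.eq_iff]
    exact fun h h' h'' => ⟨h, h', ih h''⟩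

theorem encAxm_injective (hE : E.Injective) : Function.Injective (encAxm E) := by
  rintro (_ | _) (_ | _) <;>
    simp [encAxm, con_inj, (encConcept_injective hE).eq_iff, hE.ind.eq_iff,
      (encRole_injective hE).eq_iff, (encRIA_injective hE).eq_iff]

theorem encStName_injective : Function.Injective encStName := by
  rintro (_ | _) (_ | _) <;> simp [encStName, con_inj, binary_injective.eq_iff]

theorem encStExpr_injective : Function.Injective encStExpr := by
  intro e
  induction e with
  | base s =>
    rintro (_ | _) <;> simp [encStExpr, con_inj, encStName_injective.eq_iff]
  | union r s ihr ihs | inter r s ihr ihs | diff r s ihr ihs =>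
    rintro (_ | _) <;> simp [encStExpr, con_inj]
    exact fun h h' => ⟨ihr h, ihs h'⟩

theorem encSent_injective (hE : E.Injective) : Function.Injective (encSent E) := by
  intro φ
  induction φ with
  | ax α => rintro (_ | _) <;> simp [encSent, con_inj, (encAxm_injective hE).eq_iff]
  | neg φ ih =>
    rintro (_ | _) <;> simp [encSent, con_inj]
    exact fun h => ih h
  | and φ ψ ih ih' | or φ ψ ih ih' =>
    rintro (_ | _) <;> simp [encSent, con_inj]
    exact fun h h' => ⟨ih h, ih' h'⟩
  | box e φ ih | dia e φ ih =>
    rintro (_ | _) <;> simp [encSent, con_inj, encStExpr_injective.eq_iff]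
    exact fun h h' => ⟨h, ih h'⟩

end

theorem baseEnc_injective : baseEnc.Injective :=
  ⟨binary_injective, binary_injective, binary_injective, binary_injective⟩

/-! ## The translation -/

namespace Val

def univRole : Val := con 0 [con 2 []]

def stTransStep (_ : Bool) (q x l : Val) : Val :=
  x.car.sel4 (con 7 [univRole, con 0 [con 1 [x.arg 0, q]]]) (cons (unary 6) l) (cons (unary 5) l)
    (con 5 [l.car, con 4 [l.cdr.car]])

def stTrans (q x : Val) : Val := nrec stTransStep (fun _ _ => nil) q x true true

def riaBody (x : Val) : Val :=
  x.car.sel4 (x.arg 0) (append (x.arg 0) (cons (con 0 [x.arg 1]) nil))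
    (cons (con 0 [x.arg 1]) (x.arg 0))
    (cons (con 0 [x.arg 0]) (cons (con 0 [x.arg 0]) nil))

def riaHead (x : Val) : Val := x.car.sel4 (x.arg 1) (x.arg 1) (x.arg 1) (x.arg 0)

def riaNonsimples (x : Val) : Val :=
  append (lrec (fun _ => nil) (fun _ y v => append (roleNonsimples y.car) v) nil (riaBody x))
    (nameNonsimples (riaHead x))

/-- Chains of existential restrictions, for the parameter `(π, C)`. -/
def exLowerChain (q rs : Val) : Val :=
  lrec (fun q => q.cdr) (fun q y v => con 8 [roleLowerAt q.car y.car, v]) q rs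

def nom (x : Val) : Val := con 1 [con 0 [x]]

def transPos (q x : Val) : Val :=
  x.car.sel6 (con 8 [univRole, con 5 [nom (x.arg 1), conceptAt q (x.arg 0)]])
    (con 8 [univRole, con 5 [nom (x.arg 1), con 8 [roleLowerAt q (x.arg 0), nom (x.arg 2)]]])
    (con 8 [univRole, con 5 [nom (x.arg 0), nom (x.arg 1)]])
    (con 8 [univRole, con 5 [nom (x.arg 0), con 4 [nom (x.arg 1)]]])
    (con 7 [univRole, conceptAt q (con 6 [con 4 [x.arg 0], x.arg 1])])
    (con 7 [univRole, con 9 [con 0 [con 0 [con 1 [x.arg 0, q]]]]])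

def transNegRIA (q x : Val) : Val :=
  con 8 [univRole, con 5 [con 7 [con 0 [nameAt q (riaHead x)], con 4 [con 1 [con 1 [x, q]]]],
    exLowerChain (cons q (con 1 [con 1 [x, q]])) (riaBody x)]]

def transNeg (q x : Val) : Val :=
  x.car.sel6 (con 8 [univRole, con 5 [nom (x.arg 1), conceptAt q (con 4 [x.arg 0])]])
    (con 8 [univRole, con 5 [nom (x.arg 1), con 7 [roleAt q (x.arg 0), con 4 [nom (x.arg 2)]]]])
    (con 8 [univRole, con 5 [nom (x.arg 0), con 4 [nom (x.arg 1)]]])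
    (con 8 [univRole, con 5 [nom (x.arg 0), nom (x.arg 1)]])
    (con 8 [univRole, conceptAt q (con 5 [x.arg 0, con 4 [x.arg 1]])])
    (transNegRIA q (x.arg 0))

/-- Below a modality the translation is repeated for every precisification. As normal forms have
modal depth at most one, this happens on a single level: `transStep` treats the outer level, and its
modalities call the present function on bodies of degree zero, which never reach the branches for
modalities. -/
def transFlatStep (_ : Bool) (q x l : Val) : Val :=
  x.car.sel6 (transPos q (x.arg 0))
    ((x.arg 0).car.ifnil (transNeg q ((x.arg 0).arg 0)) (con 3 []))
    (cons (unary 5) l) (cons (unary 6) l) nil nil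

/-- The translation of sentences without modalities. -/
def transFlat (q x : Val) : Val := nrec transFlatStep (fun _ _ => nil) q x true true

/-- The translation of a box over the precisifications in `ps`, for the parameter `(e, φ)`. -/
def transBox (q ps : Val) : Val :=
  lrec (fun _ => con 2 [])
    (fun q y v => con 5 [con 6 [con 4 [stTrans y.car q.car], transFlat y.car q.cdr], v]) q ps

def transDia (q ps : Val) : Val :=
  lrec (fun _ => con 3 [])
    (fun q y v => con 6 [con 5 [stTrans y.car q.car, transFlat y.car q.cdr], v]) q ps

/-- The translation of sentences without nested modalities; the parameter consists of the list of
precisifications and the current one. -/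
def transStep (_ : Bool) (q x l : Val) : Val :=
  x.car.sel6 (transPos q.cdr (x.arg 0))
    ((x.arg 0).car.ifnil (transNeg q.cdr ((x.arg 0).arg 0)) (con 3 []))
    (cons (unary 5) l) (cons (unary 6) l) (transBox (cons (x.arg 0) (x.arg 1)) q.car)
    (transDia (cons (x.arg 0) (x.arg 1)) q.car)

def transAt (q x : Val) : Val := nrec transStep (fun _ _ => nil) q x true true

def rolesAt (q x : Val) : Val := lrec (fun _ => nil) (fun q y v => cons (roleAt q y.car) v) q x

def guardRole (q x : Val) : Val := con 0 [con 0 [con 1 [x, q]]]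

def ifNamed (r x : Val) : Val := r.car.sel3 nil (cons (con 5 [x]) nil) nil

def lowerName (q r : Val) : Val := con 1 [con 1 [r.arg 0, q]]

/-- The list of the guarded version of a role inclusion axiom, as an axiom, if there is one. -/
def guarded (q x : Val) : Val :=
  x.car.sel4
    (ifNamed (x.arg 1) (con 0 [cons (guardRole q x) (rolesAt q (x.arg 0)),
      lowerName q (x.arg 1)]))
    (ifNamed (x.arg 1) (con 1 [cons (guardRole q x) (rolesAt q (x.arg 0)),
      lowerName q (x.arg 1)]))
    (ifNamed (x.arg 1) (con 2 [append (rolesAt q (x.arg 0)) (cons (guardRole q x) nil),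
      lowerName q (x.arg 1)]))
    (ifNamed (x.arg 0) (con 1 [cons (guardRole q x) (cons (con 0 [lowerName q (x.arg 0)]) nil),
      con 1 [con 0 [(x.arg 0).arg 0, q]]]))

def posRIAsStep (_ : Bool) (_ x l : Val) : Val :=
  x.car.sel6 ((x.arg 0).car.sel6 nil nil nil nil nil (cons ((x.arg 0).arg 0) nil)) nil
    (append l.car l.cdr.car) (append l.car l.cdr.car) l.cdr.car l.cdr.car

def posRIAs (x : Val) : Val := nrec posRIAsStep (fun _ _ => nil) nil x true true

def axmNonsimples (x : Val) : Val :=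
  x.car.sel6 (nonsimples (x.arg 0)) (roleNonsimples (x.arg 0)) nil nil
    (append (nonsimples (x.arg 0)) (nonsimples (x.arg 1))) (riaNonsimples (x.arg 0))

def sentNonsimplesStep (_ : Bool) (_ x l : Val) : Val :=
  x.car.sel6 (axmNonsimples (x.arg 0)) l.car
    (append l.car l.cdr.car) (append l.car l.cdr.car) l.cdr.car l.cdr.car

def sentNonsimples (x : Val) : Val := nrec sentNonsimplesStep (fun _ _ => nil) nil x true true

def lowerAxms (q rs : Val) : Val :=
  lrec (fun _ => nil) (fun q y v => cons (con 5 [con 0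
    [cons (con 0 [con 1 [con 1 [y.car, q]]]) nil, con 1 [con 0 [y.car, q]]]]) v) q rs

def guardedAxms (q rs : Val) : Val :=
  lrec (fun _ => nil) (fun q y v => append (guarded q y.car) v) q rs

def transConj (q ps : Val) : Val :=
  lrec (fun _ => con 2 []) (fun q y v => con 5 [transAt (cons q.car y.car) q.cdr, v]) q ps

def starConj (ps : Val) : Val :=
  lrec (fun _ => con 2 []) (fun _ y v =>
    con 5 [con 7 [univRole, con 0 [con 1 [con 0 [], y.car]]], v]) nil ps

/-- The translation of a sentence `x` in normal form over the list `ps` of precisifications. -/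
def transKB (ps x : Val) : Val :=
  append (append
    (lrec (fun _ => nil) (fun q y v => append (lowerAxms y.car q) v) (sentNonsimples x) ps)
    (lrec (fun _ => nil) (fun q y v => append (guardedAxms y.car q) v) (posRIAs x) ps))
    (cons (con 4 [con 2 [], con 5 [transConj (cons ps x) ps, starConj ps]]) nil)

def translation (x : Val) : Val := transKB (range (count (subs x))) (normal x)

end Val

/-! ### Polynomial time of the tree functions for the translation -/

section

variable {f g : Val → Val}

@[fun_prop]
theorem PT.stTrans (hf : PT f) (hg : PT g) : PT fun x => stTrans (f x) (g x) := by
  refine PT.nrec true (fun b => ?_) (fun _ => .const _) (fun b => ?_) hf hg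
  · unfold Val.stTransStep; fun_prop
  -- The case of set difference uses each of the two results once and adds a bounded number of
  -- cells; `40` is a generous bound.
  · refine Lin.sel4 (Lin.of_PT (by fun_prop)) (Lin.cons (by fun_prop) Lin.result)
      (Lin.cons (by fun_prop) Lin.result) ⟨40, fun q x l => ?_⟩
    rw [Polynomial.eval_ofNat]
    beta_reduce
    rcases l with _ | ⟨a, _ | ⟨b, c⟩⟩ <;> simp [Val.con, Val.ofList, Val.size, unary] <;> omega

@[fun_prop]
theorem PT.riaBody (hf : PT f) : PT fun x => riaBody (f x) := by
  unfold Val.riaBody; fun_prop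

@[fun_prop]
theorem PT.riaHead (hf : PT f) : PT fun x => riaHead (f x) := by
  unfold Val.riaHead; fun_prop

@[fun_prop]
theorem PT.riaNonsimples (hf : PT f) : PT fun x => riaNonsimples (f x) := by
  refine PT.append (PT.lrec ?_ ?_ ?_ (.const _) (by fun_prop)) (by fun_prop)
  · fun_prop
  · fun_prop
  · exact Lin.append_left (by fun_prop) Lin.result

@[fun_prop]
theorem PT.exLowerChain (hf : PT f) (hg : PT g) : PT fun x => exLowerChain (f x) (g x) := by
  refine PT.lrec ?_ ?_ ?_ hf hg
  · fun_prop
  · fun_prop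
  · exact Lin.con2 _ (by fun_prop) Lin.result

@[fun_prop]
theorem PT.nom (hf : PT f) : PT fun x => nom (f x) := by unfold Val.nom; fun_prop

@[fun_prop]
theorem PT.transPos (hf : PT f) (hg : PT g) : PT fun x => transPos (f x) (g x) := by
  unfold Val.transPos; fun_prop

@[fun_prop]
theorem PT.transNegRIA (hf : PT f) (hg : PT g) : PT fun x => transNegRIA (f x) (g x) := by
  unfold Val.transNegRIA; fun_prop

@[fun_prop]
theorem PT.transNeg (hf : PT f) (hg : PT g) : PT fun x => transNeg (f x) (g x) := by
  unfold Val.transNeg; fun_prop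

@[fun_prop]
theorem PT.transFlat (hf : PT f) (hg : PT g) : PT fun x => transFlat (f x) (g x) := by
  refine PT.nrec true (fun b => ?_) (fun _ => .const _) (fun b => ?_) hf hg
  · unfold Val.transFlatStep; fun_prop
  · exact Lin.sel6 (Lin.of_PT (by fun_prop)) (Lin.of_PT (by fun_prop))
      (Lin.cons (by fun_prop) Lin.result) (Lin.cons (by fun_prop) Lin.result)
      (Lin.of_PT (by fun_prop)) (Lin.of_PT (by fun_prop))

@[fun_prop]
theorem PT.transBox (hf : PT f) (hg : PT g) : PT fun x => transBox (f x) (g x) := by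
  refine PT.lrec ?_ ?_ ?_ hf hg
  · fun_prop
  · fun_prop
  · exact Lin.con2 _ (by fun_prop) Lin.result

@[fun_prop]
theorem PT.transDia (hf : PT f) (hg : PT g) : PT fun x => transDia (f x) (g x) := by
  refine PT.lrec ?_ ?_ ?_ hf hg
  · fun_prop
  · fun_prop
  · exact Lin.con2 _ (by fun_prop) Lin.result

@[fun_prop]
theorem PT.transAt (hf : PT f) (hg : PT g) : PT fun x => transAt (f x) (g x) := by
  refine PT.nrec true (fun b => ?_) (fun _ => .const _) (fun b => ?_) hf hg
  · unfold Val.transStep; fun_prop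
  · exact Lin.sel6 (Lin.of_PT (by fun_prop)) (Lin.of_PT (by fun_prop))
      (Lin.cons (by fun_prop) Lin.result) (Lin.cons (by fun_prop) Lin.result)
      (Lin.of_PT (by fun_prop)) (Lin.of_PT (by fun_prop))

@[fun_prop]
theorem PT.rolesAt (hf : PT f) (hg : PT g) : PT fun x => rolesAt (f x) (g x) := by
  refine PT.lrec ?_ ?_ ?_ hf hg
  · fun_prop
  · fun_prop
  · exact Lin.cons (by fun_prop) Lin.result

@[fun_prop]
theorem PT.guarded (hf : PT f) (hg : PT g) : PT fun x => guarded (f x) (g x) := by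
  unfold Val.guarded Val.ifNamed Val.guardRole Val.lowerName; fun_prop

@[fun_prop]
theorem PT.posRIAs (hf : PT f) : PT fun x => posRIAs (f x) := by
  refine PT.nrec true (fun b => ?_) (fun _ => .const _) (fun b => ?_) (.const _) hf
  · unfold Val.posRIAsStep; fun_prop
  · exact Lin.sel6 (Lin.of_PT (by fun_prop)) (Lin.of_PT (by fun_prop)) Lin.append Lin.append
      Lin.result.cdr.car Lin.result.cdr.car

@[fun_prop]
theorem PT.axmNonsimples (hf : PT f) : PT fun x => axmNonsimples (f x) := by
  unfold Val.axmNonsimples; fun_prop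

@[fun_prop]
theorem PT.sentNonsimples (hf : PT f) : PT fun x => sentNonsimples (f x) := by
  refine PT.nrec true (fun b => ?_) (fun _ => .const _) (fun b => ?_) (.const _) hf
  · unfold Val.sentNonsimplesStep; fun_prop
  · exact Lin.sel6 (Lin.of_PT (by fun_prop)) Lin.result.car Lin.append Lin.append
      Lin.result.cdr.car Lin.result.cdr.car

@[fun_prop]
theorem PT.lowerAxms (hf : PT f) (hg : PT g) : PT fun x => lowerAxms (f x) (g x) := by
  refine PT.lrec ?_ ?_ ?_ hf hg
  · fun_prop
  · fun_prop
  · exact Lin.cons (by fun_prop) Lin.result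

@[fun_prop]
theorem PT.guardedAxms (hf : PT f) (hg : PT g) : PT fun x => guardedAxms (f x) (g x) := by
  refine PT.lrec ?_ ?_ ?_ hf hg
  · fun_prop
  · fun_prop
  · exact Lin.append_left (by fun_prop) Lin.result

@[fun_prop]
theorem PT.transConj (hf : PT f) (hg : PT g) : PT fun x => transConj (f x) (g x) := by
  refine PT.lrec ?_ ?_ ?_ hf hg
  · fun_prop
  · fun_prop
  · exact Lin.con2 _ (by fun_prop) Lin.result

@[fun_prop]
theorem PT.starConj (hf : PT f) : PT fun x => starConj (f x) := by
  refine PT.lrec ?_ ?_ ?_ (.const _) hf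
  · fun_prop
  · fun_prop
  · exact Lin.con2 _ (by fun_prop) Lin.result

@[fun_prop]
theorem PT.transKB (hf : PT f) (hg : PT g) : PT fun x => transKB (f x) (g x) := by
  refine PT.append (PT.append (PT.lrec ?_ ?_ ?_ (by fun_prop) hf)
    (PT.lrec ?_ ?_ ?_ (by fun_prop) hf)) (by fun_prop)
  · fun_prop
  · fun_prop
  · exact Lin.append_left (by fun_prop) Lin.result
  · fun_prop
  · fun_prop
  · exact Lin.append_left (by fun_prop) Lin.result

theorem PT.translation : PT Val.translation := by
  unfold Val.translation; fun_prop

end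

/-! ### Agreement of the tree functions with the translation -/

section

variable {σ : Sig} (E : SigEnc σ)

theorem stTrans_enc (π : ℕ) (e : StExpr) :
    stTrans (unary π) (encStExpr e) = encConcept E.trans (e.trans σ π) := by
  induction e with
  | base s => rfl
  | union e f ihe ihf | inter e f ihe ihf =>
    rw [encStExpr, stTrans, nrec_con]; exact con_congr₂ ihe ihf
  | diff e f ihe ihf =>
    rw [encStExpr, stTrans, nrec_con]; exact con_congr₂ ihe (con_congr₁ ihf)

theorem riaBody_enc (ρ : RIA σ.Simp σ.NonSimp) :
    riaBody (encRIA E ρ) = ofList (ρ.body.map (encRole E)) := by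
  cases ρ with
  | right ws r => rw [RIA.body, List.map_append, ← append_ofList]; rfl
  | _ => rfl

theorem riaHead_enc (ρ : RIA σ.Simp σ.NonSimp) : riaHead (encRIA E ρ) = encRName E ρ.head := by
  cases ρ <;> rfl

theorem riaNonsimples_enc (ρ : RIA σ.Simp σ.NonSimp) :
    riaNonsimples (encRIA E ρ) = ofList (ρ.nonsimples.map E.nonsimp) := by
  rw [riaNonsimples, riaBody_enc, riaHead_enc, nameNonsimples_enc, RIA.nonsimples, List.map_append,
    ← append_ofList, lrec_ofList (k := fun _ a v => append (roleNonsimples a) v)]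
  congr 1
  induction ρ.body with
  | nil => rfl
  | cons r rs ih =>
    rw [List.flatMap_cons, List.map_append, ← append_ofList, ← ih, ← roleNonsimples_enc]
    rfl

theorem exLowerChain_enc (π : ℕ) (C : Concept σ.trans) (rs : List (Role σ.Simp σ.NonSimp)) :
    exLowerChain (cons (unary π) (encConcept E.trans C)) (ofList (rs.map (encRole E))) =
      encConcept E.trans (exChain (rs.map (Role.lowerAt π)) C) := by
  rw [exLowerChain, lrec_ofList (k := fun q a v => con 8 [roleLowerAt q.car a, v])]
  induction rs with
  | nil => rfl
  | cons r rs ih => exact con_congr₂ (roleLowerAt_enc E π r) ih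

theorem transPos_enc (π : ℕ) (α : Axm σ) :
    transPos (unary π) (encAxm E α) = encConcept E.trans (α.transPos π) := by
  cases α with
  | inst C a => exact con_congr₂ rfl (con_congr₂ rfl (conceptAt_enc E π C))
  | link r a b => exact con_congr₂ rfl (con_congr₂ rfl (con_congr₂ (roleLowerAt_enc E π r) rfl))
  | eq a b | ne a b => rfl
  | gci C D => exact con_congr₂ rfl (conceptAt_enc E π (.sup (.neg C) D))
  | ria ρ => rfl

theorem transNeg_enc (π : ℕ) (α : Axm σ) :
    transNeg (unary π) (encAxm E α) = encConcept E.trans (α.transNeg π) := by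
  cases α with
  | inst C a => exact con_congr₂ rfl (con_congr₂ rfl (conceptAt_enc E π (.neg C)))
  | link r a b => exact con_congr₂ rfl (con_congr₂ rfl (con_congr₂ (roleAt_enc E π r) rfl))
  | eq a b | ne a b => rfl
  | gci C D => exact con_congr₂ rfl (conceptAt_enc E π (.inf C (.neg D)))
  | ria ρ =>
    have h := exLowerChain_enc E π (.nominal (.fresh ρ π)) ρ.body
    rw [← riaBody_enc] at h
    have h' := nameAt_enc E π ρ.head
    rw [← riaHead_enc] at h'
    exact con_congr₂ rfl (con_congr₂ (con_congr₂ (con_congr₁ h') rfl) h)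

theorem transFlat_enc (n π : ℕ) (φ : Sent σ) (h : φ.degree = 0) :
    transFlat (unary π) (encSent E φ) = encConcept E.trans (φ.transAt n π) := by
  induction φ with
  | ax α => exact transPos_enc E π α
  | neg φ ih =>
    cases φ with
    | ax α => exact transNeg_enc E π α
    | _ => rfl
  | and φ ψ ih ih' | or φ ψ ih ih' =>
    rw [Sent.degree, Nat.max_eq_zero_iff] at h
    rw [encSent, transFlat, nrec_con]
    exact con_congr₂ (ih h.1) (ih' h.2)
  | box e φ ih | dia e φ ih => exact absurd h (Nat.succ_ne_zero _)

theorem transBox_enc (n π : ℕ) (e : StExpr) (φ : Sent σ) (h : φ.degree = 0) :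
    transBox (cons (encStExpr e) (encSent E φ)) (ofList ((List.range n).map unary)) =
      encConcept E.trans ((Sent.box e φ).transAt n π) := by
  rw [transBox, lrec_ofList (k := fun q a v =>
    con 5 [con 6 [con 4 [stTrans a q.car], transFlat a q.cdr], v]), Sent.transAt, bigInf]
  induction List.range n with
  | nil => rfl
  | cons π l ih =>
    exact con_congr₂ (con_congr₂ (con_congr₁ (stTrans_enc E π e)) (transFlat_enc E n π φ h)) ih

theorem transDia_enc (n π : ℕ) (e : StExpr) (φ : Sent σ) (h : φ.degree = 0) :
    transDia (cons (encStExpr e) (encSent E φ)) (ofList ((List.range n).map unary)) =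
      encConcept E.trans ((Sent.dia e φ).transAt n π) := by
  rw [transDia, lrec_ofList (k := fun q a v =>
    con 6 [con 5 [stTrans a q.car, transFlat a q.cdr], v]), Sent.transAt, bigSup]
  induction List.range n with
  | nil => rfl
  | cons π l ih =>
    exact con_congr₂ (con_congr₂ (stTrans_enc E π e) (transFlat_enc E n π φ h)) ih

theorem transAt_enc (n π : ℕ) (φ : Sent σ) (h : φ.degree ≤ 1) :
    transAt (cons (ofList ((List.range n).map unary)) (unary π)) (encSent E φ) =
      encConcept E.trans (φ.transAt n π) := by
  induction φ with
  | ax α => exact transPos_enc E π α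
  | neg φ ih =>
    cases φ with
    | ax α => exact transNeg_enc E π α
    | _ => rfl
  | and φ ψ ih ih' | or φ ψ ih ih' =>
    rw [Sent.degree, max_le_iff] at h
    rw [encSent, transAt, nrec_con]
    exact con_congr₂ (ih h.1) (ih' h.2)
  | box e φ ih => exact transBox_enc E n π e φ (by rw [Sent.degree] at h; omega)
  | dia e φ ih => exact transDia_enc E n π e φ (by rw [Sent.degree] at h; omega)

theorem rolesAt_enc (π : ℕ) (rs : List (Role σ.Simp σ.NonSimp)) :
    rolesAt (unary π) (ofList (rs.map (encRole E))) =
      ofList ((rs.map (Role.at π)).map (encRole E.trans)) := by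
  rw [rolesAt, lrec_ofList (k := fun q a v => cons (roleAt q a) v)]
  induction rs with
  | nil => rfl
  | cons r rs ih => exact congrArg₂ cons (roleAt_enc E π r) ih

theorem guarded_enc (π : ℕ) (ρ : RIA σ.Simp σ.NonSimp) :
    guarded (unary π) (encRIA E ρ) =
      ofList (((ρ.guarded π).toList.map Axm.ria).map (encAxm E.trans)) := by
  cases ρ with
  | plain ws r =>
    rcases r with s | r | _
    · rfl
    · have h := rolesAt_enc E π ws
      exact congrArg₂ cons (con_congr₁ (con_congr₂ (congrArg₂ cons rfl h) rfl)) rfl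
    · rfl
  | right ws r =>
    rcases r with s | r | _
    · rfl
    · have h := rolesAt_enc E π ws
      exact congrArg₂ cons (con_congr₁ (con_congr₂ (congrArg₂ cons rfl h) rfl)) rfl
    · rfl
  | left ws r =>
    rcases r with s | r | _
    · rfl
    · refine congrArg₂ cons (con_congr₁ (con_congr₂ ?_ rfl)) rfl
      rw [List.map_append, ← append_ofList, ← rolesAt_enc]
      rfl
    · rfl
  | trans r => rcases r with s | r | _ <;> rfl

theorem posRIAs_enc (φ : Sent σ) :
    posRIAs (encSent E φ) = ofList (φ.posRIAs.map (encRIA E)) := by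
  induction φ with
  | ax α => cases α <;> rfl
  | neg φ ih => rw [encSent, posRIAs, nrec_con]; rfl
  | and φ ψ ih ih' | or φ ψ ih ih' =>
    rw [Sent.posRIAs, List.map_append, ← append_ofList, ← ih, ← ih', encSent, posRIAs, nrec_con]
    rfl
  | box e φ ih | dia e φ ih =>
    rw [Sent.posRIAs, ← ih, encSent, posRIAs, nrec_con]
    rfl

theorem axmNonsimples_enc (α : Axm σ) :
    axmNonsimples (encAxm E α) = ofList (α.nonsimples.map E.nonsimp) := by
  cases α with
  | inst C a => exact nonsimples_enc E C
  | link r a b => exact roleNonsimples_enc E r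
  | eq a b | ne a b => rfl
  | gci C D =>
    rw [Axm.nonsimples, List.map_append, ← append_ofList, ← nonsimples_enc, ← nonsimples_enc]
    rfl
  | ria ρ => exact riaNonsimples_enc E ρ

theorem sentNonsimples_enc (φ : Sent σ) :
    sentNonsimples (encSent E φ) = ofList (φ.nonsimples.map E.nonsimp) := by
  induction φ with
  | ax α => exact axmNonsimples_enc E α
  | neg φ ih => rw [encSent, sentNonsimples, nrec_con]; exact ih
  | and φ ψ ih ih' | or φ ψ ih ih' =>
    rw [Sent.nonsimples, List.map_append, ← append_ofList, ← ih, ← ih', encSent, sentNonsimples,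
      nrec_con]
    rfl
  | box e φ ih | dia e φ ih =>
    rw [Sent.nonsimples, ← ih, encSent, sentNonsimples, nrec_con]
    rfl

theorem lowerAxms_enc (π : ℕ) (rs : List σ.NonSimp) :
    lowerAxms (unary π) (ofList (rs.map E.nonsimp)) = encKB E.trans (rs.map fun r =>
      Axm.ria (.plain [.name (.nonsimple (.named (TNonSimp.lower r π)))]
        (.nonsimple (.named (TNonSimp.copy r π))))) := by
  rw [lowerAxms, lrec_ofList (k := fun q a v => cons (con 5 [con 0
    [cons (con 0 [con 1 [con 1 [a, q]]]) nil, con 1 [con 0 [a, q]]]]) v), encKB]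
  induction rs with
  | nil => rfl
  | cons r rs ih => exact congrArg₂ cons rfl ih

theorem guardedAxms_enc (π : ℕ) (l : List (RIA σ.Simp σ.NonSimp)) :
    guardedAxms (unary π) (ofList (l.map (encRIA E))) =
      encKB E.trans ((l.filterMap (RIA.guarded π)).map Axm.ria) := by
  rw [guardedAxms, lrec_ofList (k := fun q a v => append (guarded q a) v), encKB]
  induction l with
  | nil => rfl
  | cons ρ l ih =>
    rw [List.map_cons, List.foldr_cons, ih, guarded_enc, append_ofList, List.filterMap_cons]
    cases RIA.guarded π ρ <;> rfl

theorem lrec_append_enc (F : Val → Val → Val) (G : ℕ → KB σ) (q : Val)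
    (h : ∀ π, F (unary π) q = encKB E (G π)) (l : List ℕ) :
    lrec (fun _ => nil) (fun q y v => append (F y.car q) v) q (ofList (l.map unary)) =
      encKB E (l.flatMap G) := by
  rw [lrec_ofList (k := fun q a v => append (F a q) v), encKB]
  induction l with
  | nil => rfl
  | cons π l ih =>
    rw [List.map_cons, List.foldr_cons, ih, h, encKB, append_ofList, List.flatMap_cons,
      List.map_append]

theorem transConj_enc (n : ℕ) (φ : Sent σ) (h : φ.degree ≤ 1) (l : List ℕ) :
    transConj (cons (ofList ((List.range n).map unary)) (encSent E φ)) (ofList (l.map unary)) =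
      encConcept E.trans (bigInf (l.map fun π => φ.transAt n π)) := by
  rw [transConj, lrec_ofList (k := fun q a v => con 5 [transAt (cons q.car a) q.cdr, v])]
  induction l with
  | nil => rfl
  | cons π l ih => exact con_congr₂ (transAt_enc E n π φ h) ih

theorem starConj_enc (l : List ℕ) :
    starConj (ofList (l.map unary)) =
      encConcept E.trans (bigInf (l.map fun π => .all .univ (.atom (.stand .star π)))) := by
  rw [starConj, lrec_ofList (k := fun _ a v =>
    con 5 [con 7 [univRole, con 0 [con 1 [con 0 [], a]]], v])]
  induction l with
  | nil => rfl
  | cons π l ih => exact con_congr₂ rfl ih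

theorem transKB_enc (n : ℕ) (φ : Sent σ) (h : φ.degree ≤ 1) :
    transKB (ofList ((List.range n).map unary)) (encSent E φ) = encKB E.trans (φ.transKB n) := by
  rw [transKB, sentNonsimples_enc, posRIAs_enc,
    lrec_append_enc E.trans lowerAxms _ _ fun π => lowerAxms_enc E π _,
    lrec_append_enc E.trans guardedAxms _ _ fun π => guardedAxms_enc E π _,
    transConj_enc E n φ h, starConj_enc E, Sent.transKB]
  simp only [encKB, List.map_append, ← append_ofList]
  rfl

theorem Sent.degree_nnf (φ : Sent σ) (b : Bool) : (φ.nnf b).degree = φ.degree := by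
  induction φ generalizing b with
  | ax α => cases b <;> rfl
  | neg φ ih => cases b <;> exact ih _
  | and φ ψ ih ih' | or φ ψ ih ih' => cases b <;> simp [Sent.nnf, Sent.degree, ih, ih']
  | box e φ ih | dia e φ ih => cases b <;> simp [Sent.nnf, Sent.degree, ih]

theorem Sent.degree_lift (φ : Sent σ) : φ.lift.degree = φ.degree := by
  induction φ with
  | ax α => rfl
  | _ => simp_all [Sent.lift, Sent.degree]

theorem Sent.degree_lit (φ : Sent σ) : φ.lit.degree = 0 := by
  rcases φ with _ | (_ | _) | _ | _ | _ | _ <;> rfl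

theorem Sent.degree_defs (φ : Sent σ) : ∀ ψ ∈ φ.defs, ψ.degree ≤ 1 := by
  induction φ with
  | ax α => simp [Sent.defs]
  | neg φ ih => simp [Sent.defs]
  | and φ ψ ih ih' | or φ ψ ih ih' =>
    simp only [Sent.defs, List.mem_cons, List.mem_append]
    rintro χ (rfl | h | h)
    · simp [Sent.degree, Sent.degree_lit]
    · exact ih _ h
    · exact ih' _ h
  | box e φ ih | dia e φ ih =>
    simp only [Sent.defs, List.mem_cons]
    rintro χ (rfl | h)
    · simp [Sent.degree, Sent.degree_lit]
    · exact ih _ h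

/-- A defining conjunct puts at most one modality in front of a literal. The bound licenses the
two-level tree function for the translation. -/
theorem Sent.degree_normal (φ : Sent σ) : φ.normal.degree ≤ 1 := by
  rw [Sent.normal]
  split_ifs with h
  · rwa [Sent.degree_lift, Sent.degree_nnf]
  · rw [Sent.structural]
    have key : ∀ (l : List (Sent σ.ext)) (ψ : Sent σ.ext), ψ.degree ≤ 1 →
        (∀ χ ∈ l, χ.degree ≤ 1) → (l.foldl Sent.and ψ).degree ≤ 1 := by
      intro l
      induction l with
      | nil => exact fun ψ h _ => h
      | cons χ l ih =>
        exact fun ψ h h' => ih _ (max_le h (h' χ (by simp))) fun χ hχ => h' χ (by simp [hχ])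
    exact key _ _ (by rw [Sent.degree_lit]; exact Nat.zero_le _) (φ.nnf true).degree_defs

end

/-- The number of precisifications is counted on `φ` itself, not on its normal form. -/
theorem translation_enc (φ : Sent baseSig) :
    translation (inputEnc φ) = outputEnc (standpointTrans φ) := by
  classical
  rw [translation, inputEnc, subs_enc, count_ofList _ (encSent_injective baseEnc_injective),
    range_unary, normal_enc, ← Sent.card_eq, transKB_enc _ _ _ φ.degree_normal]
  rfl

theorem polyTimeComputable_standpointTrans :
    PolyTimeComputable inputEnc outputEnc (standpointTrans (σ := baseSig)) := by
  obtain ⟨p, q, h⟩ := PT.translation.polyTimeComputable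
  refine ⟨p, q, fun φ => ?_⟩
  have := h (inputEnc φ)
  rwa [translation_enc] at this

end SROIQ

namespace SROIQ

/-! ## Well-formedness of the translation -/

section

variable {σ : Sig} {prec : NName σ.NonSimp → NName σ.NonSimp → Prop}

/-- An added pair joins two names with the same original, so composed with an inherited pair it
gives an inherited pair. Two added pairs never compose, since each leads from a lower approximation
to a copy. -/
theorem isStrictOrder_transPrec (h : IsStrictOrder (NName σ.NonSimp) prec) :
    IsStrictOrder (NName (TNonSimp σ)) (transPrec prec) where
  irrefl x := by
    rintro (h' | ⟨r, π, rfl, h'⟩)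
    · exact h.irrefl _ h'
    · simp at h'
  trans x y z := by
    rintro (h1 | ⟨r, π, rfl, rfl⟩) (h2 | ⟨s, π', h2, rfl⟩)
    · exact .inl (h.trans _ _ _ h1 h2)
    · subst h2
      exact .inl h1
    · exact .inl h2
    · simp at h2

theorem Role.simple_at (π : ℕ) (r : Role σ.Simp σ.NonSimp) (h : r.Simple) :
    (Role.at π r).Simple := by
  induction r with
  | name r | inv r => rcases r with _ | _ | _ <;> exact h
  | union r s ihr ihs | inter r s ihr ihs | diff r s ihr ihs => exact ⟨ihr h.1, ihs h.2⟩

theorem Role.lowerAt_of_simple (π : ℕ) (r : Role σ.Simp σ.NonSimp) (h : r.Simple) :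
    Role.lowerAt π r = Role.at π r := by
  rcases r with (_ | _ | _) | _ | _ | _ | _ <;> first | rfl | exact h.elim

theorem Role.valid_at (π : ℕ) (r : Role σ.Simp σ.NonSimp) (h : r.Valid) :
    (Role.at π r).Valid := by
  rcases h with h | ⟨_ | _, rfl⟩
  · exact .inl (r.simple_at π h)
  · exact .inr ⟨_, rfl⟩
  · exact .inr ⟨_, rfl⟩

theorem Role.valid_lowerAt (π : ℕ) (r : Role σ.Simp σ.NonSimp) (h : r.Valid) :
    (Role.lowerAt π r).Valid := by
  rcases h with h | ⟨_ | _, rfl⟩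
  · rw [r.lowerAt_of_simple π h]
    exact .inl (r.simple_at π h)
  · exact .inr ⟨_, rfl⟩
  · exact .inr ⟨_, rfl⟩

theorem Role.Below.valid {S N : Type} {prec : NName N → NName N → Prop} {r : Role S N}
    {h : NName N} (hr : r.Below prec h) : r.Valid := by
  rcases hr with hr | ⟨k, rfl, _⟩
  · exact .inl hr
  · exact .inr ⟨k, rfl⟩

/-- Copies and lower approximations occupy the same place in the inherited order, so this serves
right-hand sides of either kind. -/
theorem Role.below_at (π : ℕ) (r : Role σ.Simp σ.NonSimp) (k : NName (TNonSimp σ))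
    (h : r.Below prec (origName k)) : (Role.at π r).Below (transPrec prec) k := by
  rcases h with h | ⟨_ | _, rfl, h⟩
  · exact .inl (r.simple_at π h)
  · exact .inr ⟨_, rfl, .inl h⟩
  · exact .inr ⟨_, rfl, .inl h⟩

theorem Concept.valid_nnf (C : Concept σ) (b : Bool) (h : C.Valid) : (C.nnf b).Valid := by
  induction C generalizing b with
  | atom A | nominal a | top | bot => cases b <;> trivial
  | self r => cases b <;> exact h
  | neg C ih => cases b <;> exact ih _ h
  | inf C D ihC ihD | sup C D ihC ihD => cases b <;> exact ⟨ihC _ h.1, ihD _ h.2⟩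
  | all r C ih | ex r C ih => cases b <;> exact ⟨h.1, ih _ h.2⟩
  | atMost n r C ih => cases b <;> exact ⟨h.1, ih _ h.2⟩
  | atLeast n r C ih =>
    cases b
    · cases n
      · trivial
      · exact ⟨h.1, ih _ h.2⟩
    · cases n <;> exact ⟨h.1, ih _ h.2⟩

theorem Concept.valid_replace (π : ℕ) (C : Concept σ) (b : Bool) (h : C.Valid) :
    (C.replace π b).Valid := by
  induction C generalizing b with
  | atom A | nominal a | top | bot => cases b <;> trivial
  | self r => cases b <;> exact r.simple_at π h
  | neg C ih => cases b <;> exact ih _ h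
  | inf C D ihC ihD | sup C D ihC ihD => cases b <;> exact ⟨ihC _ h.1, ihD _ h.2⟩
  | all r C ih =>
    cases b
    · exact ⟨r.valid_lowerAt π h.1, ih _ h.2⟩
    · exact ⟨r.valid_at π h.1, ih _ h.2⟩
  | ex r C ih =>
    cases b
    · exact ⟨r.valid_at π h.1, ih _ h.2⟩
    · exact ⟨r.valid_lowerAt π h.1, ih _ h.2⟩
  | atMost n r C ih | atLeast n r C ih => cases b <;> exact ⟨r.simple_at π h.1, ih _ h.2⟩

theorem Concept.valid_at (π : ℕ) (C : Concept σ) (h : C.Valid) : (C.at π).Valid :=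
  (C.nnf true).valid_replace π true (C.valid_nnf true h)

theorem Concept.valid_lift (C : Concept σ) (h : C.Valid) : C.lift.Valid := by
  induction C with
  | atom A | nominal a | top | bot => trivial
  | self r => exact h
  | neg C ih => exact ih h
  | inf C D ihC ihD | sup C D ihC ihD => exact ⟨ihC h.1, ihD h.2⟩
  | all r C ih | ex r C ih | atMost n r C ih | atLeast n r C ih => exact ⟨h.1, ih h.2⟩

theorem Axm.valid_lift (α : Axm σ) (h : α.Valid prec) : Axm.Valid (σ := σ.ext) prec α.lift := by
  cases α with
  | inst C a => exact C.valid_lift h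
  | link r a b => exact h
  | eq a b | ne a b => trivial
  | gci C D => exact ⟨C.valid_lift h.1, D.valid_lift h.2⟩
  | ria ρ => exact h

theorem Sent.valid_nnf (φ : Sent σ) (b : Bool) (h : φ.Valid prec) : (φ.nnf b).Valid prec := by
  induction φ generalizing b with
  | ax α => cases b <;> exact h
  | neg φ ih => cases b <;> exact ih _ h
  | and φ ψ ih ih' | or φ ψ ih ih' => cases b <;> exact ⟨ih _ h.1, ih' _ h.2⟩
  | box e φ ih | dia e φ ih => cases b <;> exact ih _ h

theorem Sent.valid_lift (φ : Sent σ) (h : φ.Valid prec) :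
    Sent.Valid (σ := σ.ext) prec φ.lift := by
  induction φ with
  | ax α => exact α.valid_lift h
  | neg φ ih => exact ih h
  | and φ ψ ih ih' | or φ ψ ih ih' => exact ⟨ih h.1, ih' h.2⟩
  | box e φ ih | dia e φ ih => exact ih h

theorem Sent.valid_lit (φ : Sent σ) (h : φ.Valid prec) : Sent.Valid (σ := σ.ext) prec φ.lit := by
  rcases φ with α | (α | _) | _ | _ | _ | _
  · exact α.valid_lift h
  · exact α.valid_lift h
  all_goals exact ⟨trivial, trivial⟩

theorem Sent.valid_defs (φ : Sent σ) (h : φ.Valid prec) :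
    ∀ ψ ∈ φ.defs, Sent.Valid (σ := σ.ext) prec ψ := by
  induction φ with
  | ax α => simp [Sent.defs]
  | neg φ ih => simp [Sent.defs]
  | and φ ψ ih ih' | or φ ψ ih ih' =>
    simp only [Sent.defs, List.mem_cons, List.mem_append]
    rintro χ (rfl | h' | h')
    · exact ⟨Sent.valid_lit _ h, φ.valid_lit h.1, ψ.valid_lit h.2⟩
    · exact ih h.1 _ h'
    · exact ih' h.2 _ h'
  | box e φ ih | dia e φ ih =>
    simp only [Sent.defs, List.mem_cons]
    rintro χ (rfl | h')
    · exact ⟨Sent.valid_lit (.box e φ) h, φ.valid_lit h⟩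
    · exact ih h _ h'

theorem Sent.valid_foldl_and (l : List (Sent σ)) (φ : Sent σ) (h : φ.Valid prec)
    (hl : ∀ ψ ∈ l, ψ.Valid prec) : (l.foldl Sent.and φ).Valid prec := by
  induction l generalizing φ with
  | nil => exact h
  | cons ψ l ih => exact ih _ ⟨h, hl ψ (by simp)⟩ fun χ hχ => hl χ (by simp [hχ])

theorem Sent.valid_normal (φ : Sent σ) (h : φ.Valid prec) :
    Sent.Valid (σ := σ.ext) prec φ.normal := by
  have h := φ.valid_nnf true h
  rw [Sent.normal]
  split_ifs
  · exact Sent.valid_lift _ h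
  · exact Sent.valid_foldl_and (σ := σ.ext) _ _ (Sent.valid_lit _ h) (Sent.valid_defs _ h)

theorem RIA.Valid.exists_head {S N : Type} {prec : NName N → NName N → Prop} {ρ : RIA S N}
    (h : ρ.Valid prec) : ∃ k, ρ.head = .nonsimple k := by
  cases ρ with
  | trans r => exact h
  | _ ws r =>
    obtain ⟨_, k, h, _⟩ := h
    exact ⟨k, h⟩

theorem RIA.Valid.body {S N : Type} {prec : NName N → NName N → Prop} {ρ : RIA S N}
    (h : ρ.Valid prec) : ∀ w ∈ ρ.body, w.Valid := by
  cases ρ with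
  | plain ws r =>
    obtain ⟨_, k, _, h⟩ := h
    exact fun w hw => (h w hw).valid
  | right ws r =>
    obtain ⟨_, k, rfl, h⟩ := h
    simp only [RIA.body, List.mem_append, List.mem_singleton]
    rintro w (hw | rfl)
    · exact (h w hw).valid
    · exact .inr ⟨k, rfl⟩
  | left ws r =>
    obtain ⟨_, k, rfl, h⟩ := h
    simp only [RIA.body, List.mem_cons]
    rintro w (rfl | hw)
    · exact .inr ⟨k, rfl⟩
    · exact (h w hw).valid
  | trans r =>
    obtain ⟨k, rfl⟩ := h
    simp only [RIA.body, List.mem_cons, List.not_mem_nil, or_false, or_self]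
    rintro w rfl
    exact .inr ⟨k, rfl⟩

theorem RIA.valid_guarded (π : ℕ) (ρ : RIA σ.Simp σ.NonSimp) (h : ρ.Valid prec)
    (ρ' : RIA (TSimp σ) (TNonSimp σ)) (h' : ρ.guarded π = some ρ') :
    ρ'.Valid (transPrec prec) := by
  have key : ∀ (ws : List (Role σ.Simp σ.NonSimp)) r, (∀ w ∈ ws, w.Below prec (.named r)) →
      ∀ w ∈ ws.map (Role.at π), w.Below (transPrec prec) (.named (.lower r π)) := by
    intro ws r hw
    simp only [List.mem_map]
    rintro _ ⟨w, hw', rfl⟩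
    exact Role.below_at π w _ (hw w hw')
  rcases ρ with ⟨ws, _ | r | _⟩ | ⟨ws, _ | r | _⟩ | ⟨ws, _ | r | _⟩ | ⟨_ | r | _⟩ <;>
    simp only [RIA.guarded, Option.some.injEq, reduceCtorEq] at h' <;> subst h'
  · obtain ⟨_, k, hk, h⟩ := h
    cases hk
    refine ⟨by simp, _, rfl, ?_⟩
    rintro w (_ | ⟨_, hw⟩)
    · exact .inl trivial
    · exact key ws r h w hw
  · obtain ⟨_, k, hk, h⟩ := h
    cases hk
    refine ⟨by simp, _, rfl, ?_⟩
    rintro w (_ | ⟨_, hw⟩)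
    · exact .inl trivial
    · exact key ws r h w hw
  · obtain ⟨_, k, hk, h⟩ := h
    cases hk
    refine ⟨by simp, _, rfl, fun w hw => ?_⟩
    rcases List.mem_append.1 hw with hw | hw
    · exact key ws r h w hw
    · rw [List.mem_singleton.1 hw]
      exact .inl trivial
  -- Transitivity: its guarded version has the second shape with head `r^π`, and the extra pair of
  -- the order puts the lower approximation below that head.
  · refine ⟨by simp, _, rfl, ?_⟩
    simp only [List.mem_cons, List.not_mem_nil, or_false]
    rintro w (rfl | rfl)
    · exact .inl trivial
    · exact .inr ⟨_, rfl, .inr ⟨r, π, rfl, rfl⟩⟩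

theorem valid_bigInf (l : List (Concept σ)) (h : ∀ C ∈ l, C.Valid) : (bigInf l).Valid := by
  induction l with
  | nil => trivial
  | cons C l ih => exact ⟨h C (by simp), ih fun D hD => h D (by simp [hD])⟩

theorem valid_bigSup (l : List (Concept σ)) (h : ∀ C ∈ l, C.Valid) : (bigSup l).Valid := by
  induction l with
  | nil => trivial
  | cons C l ih => exact ⟨h C (by simp), ih fun D hD => h D (by simp [hD])⟩

theorem valid_exChain (rs : List (Role σ.Simp σ.NonSimp)) (C : Concept σ) (hC : C.Valid)
    (h : ∀ r ∈ rs, r.Valid) : (exChain rs C).Valid := by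
  induction rs with
  | nil => exact hC
  | cons r l ih => exact ⟨h r (by simp), ih fun s hs => h s (by simp [hs])⟩

theorem Role.valid_univ {S N : Type} : (Role.univ : Role S N).Valid := .inr ⟨_, rfl⟩

theorem StExpr.valid_trans (π : ℕ) (e : StExpr) : (e.trans σ π).Valid := by
  induction e with
  | base s => exact ⟨Role.valid_univ, trivial⟩
  | _ e f he hf => exact ⟨he, hf⟩

theorem Axm.valid_transPos (π : ℕ) (α : Axm σ) (h : α.Valid prec) : (α.transPos π).Valid := by
  cases α with
  | inst C a => exact ⟨Role.valid_univ, trivial, C.valid_at π h⟩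
  | link r a b => exact ⟨Role.valid_univ, trivial, r.valid_lowerAt π h, trivial⟩
  | eq a b | ne a b => exact ⟨Role.valid_univ, trivial, trivial⟩
  | gci C D => exact ⟨Role.valid_univ, Concept.valid_at π (.sup (.neg C) D) h⟩
  | ria ρ => exact ⟨Role.valid_univ, trivial⟩

theorem Axm.valid_transNeg (π : ℕ) (α : Axm σ) (h : α.Valid prec) : (α.transNeg π).Valid := by
  cases α with
  | inst C a => exact ⟨Role.valid_univ, trivial, Concept.valid_at π (.neg C) h⟩
  | link r a b => exact ⟨Role.valid_univ, trivial, r.valid_at π h, trivial⟩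
  | eq a b | ne a b => exact ⟨Role.valid_univ, trivial, trivial⟩
  | gci C D => exact ⟨Role.valid_univ, Concept.valid_at π (.inf C (.neg D)) h⟩
  | ria ρ =>
    refine ⟨Role.valid_univ, ⟨?_, trivial⟩, valid_exChain _ _ trivial ?_⟩
    · obtain ⟨k, hk⟩ := RIA.Valid.exists_head h
      rw [hk]
      exact Role.valid_at π (.name (.nonsimple k)) (.inr ⟨k, rfl⟩)
    · simp only [List.mem_map]
      rintro _ ⟨w, hw, rfl⟩
      exact w.valid_lowerAt π (RIA.Valid.body h w hw)

theorem Sent.valid_transAt (n π : ℕ) (φ : Sent σ) (h : φ.Valid prec) :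
    (φ.transAt n π).Valid := by
  induction φ generalizing π with
  | ax α => exact α.valid_transPos π h
  | neg φ ih =>
    cases φ with
    | ax α => exact α.valid_transNeg π h
    | _ => trivial
  | and φ ψ ih ih' | or φ ψ ih ih' => exact ⟨ih π h.1, ih' π h.2⟩
  | box e φ ih =>
    refine valid_bigInf _ fun C hC => ?_
    obtain ⟨π, _, rfl⟩ := List.mem_map.1 hC
    exact ⟨e.valid_trans π, ih π h⟩
  | dia e φ ih =>
    refine valid_bigSup _ fun C hC => ?_
    obtain ⟨π, _, rfl⟩ := List.mem_map.1 hC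
    exact ⟨e.valid_trans π, ih π h⟩

theorem Sent.valid_posRIAs (φ : Sent σ) (h : φ.Valid prec) : ∀ ρ ∈ φ.posRIAs, ρ.Valid prec := by
  induction φ with
  | ax α => cases α <;> simp [Sent.posRIAs]; exact h
  | neg φ ih => simp [Sent.posRIAs]
  | and φ ψ ih ih' | or φ ψ ih ih' =>
    simp only [Sent.posRIAs, List.mem_append]
    rintro ρ (h' | h')
    · exact ih h.1 ρ h'
    · exact ih' h.2 ρ h'
  | box e φ ih | dia e φ ih => exact ih h

theorem Sent.valid_transKB (n : ℕ) (φ : Sent σ) (h : φ.Valid prec) :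
    ∀ α ∈ φ.transKB n, α.Valid (transPrec prec) := by
  intro α hα
  simp only [Sent.transKB, List.mem_append, List.mem_flatMap, List.mem_map, List.mem_singleton,
    List.mem_filterMap] at hα
  rcases hα with (⟨π, _, r, _, rfl⟩ | ⟨π, _, ρ', ⟨ρ, hρ, h'⟩, rfl⟩) | rfl
  · refine ⟨by simp, _, rfl, ?_⟩
    simp only [List.mem_singleton]
    rintro w rfl
    exact .inr ⟨_, rfl, .inr ⟨r, π, rfl, rfl⟩⟩
  · exact RIA.valid_guarded π ρ (φ.valid_posRIAs h ρ hρ) ρ' h'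
  · refine ⟨trivial, valid_bigInf _ fun C hC => ?_, valid_bigInf _ fun C hC => ?_⟩
    · obtain ⟨π, _, rfl⟩ := List.mem_map.1 hC
      exact φ.valid_transAt n π h
    · obtain ⟨π, _, rfl⟩ := List.mem_map.1 hC
      exact ⟨Role.valid_univ, trivial⟩

theorem valid_standpointTrans (hprec : IsStrictOrder (NName σ.NonSimp) prec) (φ : Sent σ)
    (h : φ.Valid prec) : KB.Valid (σ := σ.ext.trans) (transPrec (σ := σ.ext) prec)
      (standpointTrans φ) :=
  ⟨isStrictOrder_transPrec (σ := σ.ext) hprec,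
    Sent.valid_transKB (σ := σ.ext) _ _ (φ.valid_normal h)⟩

end

end SROIQ

namespace SROIQ

/-! ## Semantics of normal forms -/

section

variable {σ : Sig} {Δ : Type u} {P : Type v}

theorem Interp.concept_nnf (I : Interp σ Δ) (C : Concept σ) (b : Bool) (x : Δ) :
    x ∈ I.concept (C.nnf b) ↔ if b then x ∈ I.concept C else x ∉ I.concept C := by
  induction C generalizing b x with
  | atom A | nominal a | top | bot | self r => cases b <;> simp [Concept.nnf, Interp.concept]
  | neg C ih => cases b <;> simp [Concept.nnf, Interp.concept, ih]
  | inf C D ihC ihD => 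
    cases b <;> simp [Concept.nnf, Interp.concept, ihC, ihD, imp_iff_not_or]
  | sup C D ihC ihD => cases b <;> simp [Concept.nnf, Interp.concept, ihC, ihD]
  | all r C ih | ex r C ih => cases b <;> simp [Concept.nnf, Interp.concept, ih]
  | atMost n r C ih =>
    cases b <;> simp [Concept.nnf, Interp.concept, ih, ENat.add_one_le_iff]
  | atLeast n r C ih =>
    cases b <;> cases n <;> simp [Concept.nnf, Interp.concept, ih, ENat.lt_add_one_iff]

theorem StandStr.satAt_nnf (M : StandStr σ Δ P) (φ : Sent σ) (b : Bool) (p : P) :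
    M.SatAt p (φ.nnf b) ↔ if b then M.SatAt p φ else ¬ M.SatAt p φ := by
  induction φ generalizing b p with
  | ax α => cases b <;> simp [Sent.nnf, StandStr.SatAt]
  | neg φ ih => cases b <;> simp [Sent.nnf, StandStr.SatAt, ih]
  | and φ ψ ih ih' => cases b <;> simp [Sent.nnf, StandStr.SatAt, ih, ih', imp_iff_not_or]
  | or φ ψ ih ih' => cases b <;> simp [Sent.nnf, StandStr.SatAt, ih, ih']
  | box e φ ih | dia e φ ih => cases b <;> simp [Sent.nnf, StandStr.SatAt, ih]

/-- Negation only in front of axioms. -/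
def Sent.IsNNF : Sent σ → Prop
  | .ax _ => True
  | .neg (.ax _) => True
  | .neg _ => False
  | .and φ ψ => φ.IsNNF ∧ ψ.IsNNF
  | .or φ ψ => φ.IsNNF ∧ ψ.IsNNF
  | .box _ φ => φ.IsNNF
  | .dia _ φ => φ.IsNNF

theorem Sent.isNNF_nnf (φ : Sent σ) (b : Bool) : (φ.nnf b).IsNNF := by
  induction φ generalizing b with
  | ax α => cases b <;> trivial
  | neg φ ih => cases b <;> exact ih _
  | and φ ψ ih ih' | or φ ψ ih ih' => cases b <;> exact ⟨ih _, ih' _⟩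
  | box e φ ih | dia e φ ih => cases b <;> exact ih _

theorem Sent.isNNF_lift (φ : Sent σ) (h : φ.IsNNF) : φ.lift.IsNNF := by
  induction φ with
  | ax α => trivial
  | neg φ ih =>
    cases φ with
    | ax α => trivial
    | _ => exact h.elim
  | and φ ψ ih ih' | or φ ψ ih ih' => exact ⟨ih h.1, ih' h.2⟩
  | box e φ ih | dia e φ ih => exact ih h

theorem Sent.isNNF_lit (φ : Sent σ) : φ.lit.IsNNF := by
  rcases φ with _ | (_ | _) | _ | _ | _ | _ <;> trivial

theorem Sent.isNNF_defs (φ : Sent σ) : ∀ ψ ∈ φ.defs, ψ.IsNNF := by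
  induction φ with
  | ax α => simp [Sent.defs]
  | neg φ ih => simp [Sent.defs]
  | and φ ψ ih ih' | or φ ψ ih ih' =>
    simp only [Sent.defs, List.mem_cons, List.mem_append]
    rintro χ (rfl | h | h)
    · exact ⟨trivial, φ.isNNF_lit, ψ.isNNF_lit⟩
    · exact ih _ h
    · exact ih' _ h
  | box e φ ih | dia e φ ih =>
    simp only [Sent.defs, List.mem_cons]
    rintro χ (rfl | h)
    · exact ⟨trivial, φ.isNNF_lit⟩
    · exact ih _ h

theorem Sent.isNNF_foldl_and (l : List (Sent σ)) (φ : Sent σ) (h : φ.IsNNF)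
    (hl : ∀ ψ ∈ l, ψ.IsNNF) : (l.foldl Sent.and φ).IsNNF := by
  induction l generalizing φ with
  | nil => exact h
  | cons ψ l ih => exact ih _ ⟨h, hl ψ (by simp)⟩ fun χ hχ => hl χ (by simp [hχ])

theorem Sent.isNNF_normal (φ : Sent σ) : φ.normal.IsNNF := by
  rw [Sent.normal]
  split_ifs
  · exact Sent.isNNF_lift _ (φ.isNNF_nnf true)
  · exact Sent.isNNF_foldl_and _ _ (Sent.isNNF_lit _) (Sent.isNNF_defs _)

/-- Forgetting the fresh concept names. -/
def Interp.reduct (I : Interp σ.ext Δ) : Interp σ Δ where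
  ind := I.ind
  con A := I.con (.inl A)
  simp := I.simp
  nonsimp := I.nonsimp

def StandStr.reduct (M : StandStr σ.ext Δ P) : StandStr σ Δ P where
  stand := M.stand
  interp p := (M.interp p).reduct
  rigid := M.rigid

/-- Interpreting the fresh concept names: `P_ψ` is the whole domain where `ψ` holds. -/
def StandStr.ext (M : StandStr σ Δ P) : StandStr σ.ext Δ P where
  stand := M.stand
  interp p :=
    { ind := (M.interp p).ind
      con := Sum.elim (M.interp p).con fun ψ => {_x | M.SatAt p ψ}
      simp := (M.interp p).simp
      nonsimp := (M.interp p).nonsimp }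
  rigid := M.rigid

theorem StandStr.reduct_ext (M : StandStr σ Δ P) : M.ext.reduct = M := rfl

theorem Interp.rname_reduct (I : Interp σ.ext Δ) (r : RName σ.Simp σ.NonSimp) :
    I.reduct.rname r = I.rname r := by
  rcases r with _ | _ | _ <;> rfl

theorem Interp.role_reduct (I : Interp σ.ext Δ) (r : Role σ.Simp σ.NonSimp) :
    I.reduct.role r = I.role r := by
  induction r with
  | name r => exact I.rname_reduct r
  | inv r => ext x y; exact iff_of_eq (congrFun (congrFun (I.rname_reduct r) y) x)
  | _ r s ihr ihs => ext x y; simp only [Interp.role, ihr, ihs]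

theorem Interp.chain_reduct (I : Interp σ.ext Δ) (rs : List (Role σ.Simp σ.NonSimp)) :
    I.reduct.chain rs = I.chain rs := by
  induction rs with
  | nil => rfl
  | cons r rs ih => ext x y; simp only [Interp.chain, ih, Interp.role_reduct]

theorem Interp.concept_lift (I : Interp σ.ext Δ) (C : Concept σ) :
    I.concept C.lift = I.reduct.concept C := by
  induction C with
  | atom A | nominal a | top | bot => rfl
  | self r => ext x; simp [Interp.concept, Concept.lift, Interp.role_reduct]
  | neg C ih => simp [Interp.concept, Concept.lift, ih]
  | inf C D ihC ihD | sup C D ihC ihD => simp [Interp.concept, Concept.lift, ihC, ihD]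
  | all r C ih | ex r C ih | atMost n r C ih | atLeast n r C ih =>
    ext x; simp [Interp.concept, Concept.lift, ih, Interp.role_reduct]

theorem Interp.sat_lift (I : Interp σ.ext Δ) (α : Axm σ) : I.Sat α.lift ↔ I.reduct.Sat α := by
  cases α with
  | inst C a => simp only [Axm.lift, Interp.Sat, I.concept_lift]; rfl
  | link r a b => simp only [Axm.lift, Interp.Sat, I.role_reduct]; rfl
  | eq a b | ne a b => rfl
  | gci C D => simp only [Axm.lift, Interp.Sat, I.concept_lift]
  | ria ρ => simp only [Axm.lift, Interp.Sat, I.chain_reduct, I.rname_reduct]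

theorem StandStr.expr_reduct (M : StandStr σ.ext Δ P) (e : StExpr) :
    M.reduct.expr e = M.expr e := by
  induction e with
  | base s => cases s <;> rfl
  | _ e f he hf => simp only [StandStr.expr, he, hf]

theorem StandStr.satAt_lift (M : StandStr σ.ext Δ P) (φ : Sent σ) (p : P) :
    M.SatAt p φ.lift ↔ M.reduct.SatAt p φ := by
  induction φ generalizing p with
  | ax α => exact (M.interp p).sat_lift α
  | neg φ ih => simp only [Sent.lift, StandStr.SatAt, ih]
  | and φ ψ ih ih' | or φ ψ ih ih' => simp only [Sent.lift, StandStr.SatAt, ih, ih']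
  | box e φ ih | dia e φ ih => simp only [Sent.lift, StandStr.SatAt, ih, M.expr_reduct]

theorem StandStr.satAt_foldl_and (M : StandStr σ Δ P) (l : List (Sent σ)) (φ : Sent σ) (p : P) :
    M.SatAt p (l.foldl Sent.and φ) ↔ M.SatAt p φ ∧ ∀ ψ ∈ l, M.SatAt p ψ := by
  induction l generalizing φ with
  | nil => simp
  | cons ψ l ih => simp [ih, StandStr.SatAt, and_assoc]

/-- The fresh name denotes the whole domain or the empty set; the inclusion `⊤ ⊑ P_φ` tells these
apart because the domain is non-empty. -/
theorem StandStr.satAt_freshLit [Nonempty Δ] (M : StandStr σ Δ P) (φ : Sent σ) (p : P) :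
    M.ext.SatAt p (.ax (.gci .top (.atom (.inr φ)))) ↔ M.SatAt p φ := by
  obtain ⟨x⟩ := ‹Nonempty Δ›
  exact ⟨fun h => h (Set.mem_univ x), fun h _ _ => h⟩

theorem StandStr.satAt_lit_ext [Nonempty Δ] (M : StandStr σ Δ P) (φ : Sent σ) (p : P) :
    M.ext.SatAt p φ.lit ↔ M.SatAt p φ := by
  rcases φ with α | (α | _) | _ | _ | _ | _
  · exact M.ext.satAt_lift (.ax α) p
  · exact M.ext.satAt_lift (.neg (.ax α)) p
  all_goals exact M.satAt_freshLit _ p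

/-- In `M.ext` every literal is equivalent to its sentence, so the defining conjuncts become
tautologies. -/
theorem StandStr.satAt_defs_ext [Nonempty Δ] (M : StandStr σ Δ P) (φ : Sent σ) (p : P) :
    ∀ ψ ∈ φ.defs, M.ext.SatAt p ψ := by
  induction φ with
  | ax α => simp [Sent.defs]
  | neg φ ih => simp [Sent.defs]
  | and φ ψ ih ih' | or φ ψ ih ih' =>
    simp only [Sent.defs, List.mem_cons, List.mem_append]
    rintro χ (rfl | h | h)
    · simp only [StandStr.SatAt, M.satAt_lit_ext]
      tauto
    · exact ih _ h
    · exact ih' _ h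
  | box e φ ih | dia e φ ih =>
    simp only [Sent.defs, List.mem_cons]
    rintro χ (rfl | h)
    · simp only [StandStr.SatAt, M.satAt_lit_ext, ← M.ext.expr_reduct, M.reduct_ext]
      tauto
    · exact ih _ h

theorem StandStr.SatAt.modus_ponens {M : StandStr σ Δ P} {φ ψ : Sent σ} {p : P}
    (h : M.SatAt p (.or (.neg φ) ψ)) (hφ : M.SatAt p φ) : M.SatAt p ψ :=
  Or.resolve_left h (not_not.2 hφ)

/-- The conjuncts define literals in one direction only, which suffices in negation normal form.
They hold at all precisifications, so the induction can pass through modalities. -/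
theorem StandStr.satAt_reduct_of_lit [Nonempty Δ] (M : StandStr σ.ext Δ P) (φ : Sent σ)
    (hφ : φ.IsNNF) (h : ∀ p, ∀ ψ ∈ φ.defs, M.SatAt p ψ) (p : P) (hp : M.SatAt p φ.lit) :
    M.reduct.SatAt p φ := by
  induction φ generalizing p with
  | ax α => exact (M.satAt_lift (.ax α) p).1 hp
  | neg φ ih =>
    cases φ with
    | ax α => exact (M.satAt_lift (.neg (.ax α)) p).1 hp
    | _ => exact hφ.elim
  | and φ ψ ih ih' =>
    have h1 := StandStr.SatAt.modus_ponens (h p _ List.mem_cons_self) hp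
    exact ⟨ih hφ.1 (fun p χ hχ => h p χ (by simp [Sent.defs, hχ])) p h1.1,
      ih' hφ.2 (fun p χ hχ => h p χ (by simp [Sent.defs, hχ])) p h1.2⟩
  | or φ ψ ih ih' =>
    have h1 := StandStr.SatAt.modus_ponens (h p _ List.mem_cons_self) hp
    exact h1.imp (ih hφ.1 (fun p χ hχ => h p χ (by simp [Sent.defs, hχ])) p)
      (ih' hφ.2 (fun p χ hχ => h p χ (by simp [Sent.defs, hχ])) p)
  | box e φ ih =>
    have h1 := StandStr.SatAt.modus_ponens (h p _ List.mem_cons_self) hp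
    intro q hq
    rw [M.expr_reduct] at hq
    exact ih hφ (fun p χ hχ => h p χ (by simp [Sent.defs, hχ])) q (h1 q hq)
  | dia e φ ih =>
    obtain ⟨q, hq, h1⟩ := StandStr.SatAt.modus_ponens (h p _ List.mem_cons_self) hp
    refine ⟨q, ?_, ih hφ (fun p χ hχ => h p χ (by simp [Sent.defs, hχ])) q h1⟩
    rwa [M.expr_reduct]

theorem StandStr.satAt_normal_ext [Nonempty Δ] (M : StandStr σ Δ P) (φ : Sent σ)
    (h : ∀ p, M.SatAt p φ) (p : P) : M.ext.SatAt p φ.normal := by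
  have h' : M.SatAt p (φ.nnf true) := (M.satAt_nnf φ true p).2 (h p)
  rw [Sent.normal]
  split_ifs
  · exact (M.ext.satAt_lift _ p).2 h'
  · exact (M.ext.satAt_foldl_and _ _ p).2 ⟨(M.satAt_lit_ext _ p).2 h', M.satAt_defs_ext _ p⟩

theorem StandStr.satAt_reduct_of_normal [Nonempty Δ] (M : StandStr σ.ext Δ P) (φ : Sent σ)
    (h : ∀ p, M.SatAt p φ.normal) (p : P) : M.reduct.SatAt p φ := by
  suffices M.reduct.SatAt p (φ.nnf true) from (M.reduct.satAt_nnf φ true p).1 this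
  rw [Sent.normal] at h
  split_ifs at h
  · exact (M.satAt_lift _ p).1 (h p)
  · have h := fun p => (M.satAt_foldl_and _ _ p).1 (h p)
    exact M.satAt_reduct_of_lit _ (φ.isNNF_nnf true) (fun p => (h p).2) p (h p).1

/-! ## Small models -/

/-- The subsentences of the form `◇_e ψ`. -/
def Sent.dias : Sent σ → Set (StExpr × Sent σ)
  | .ax _ => ∅
  | .neg φ => φ.dias
  | .and φ ψ => φ.dias ∪ ψ.dias
  | .or φ ψ => φ.dias ∪ ψ.dias
  | .box _ φ => φ.dias
  | .dia e φ => {(e, φ)} ∪ φ.dias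

/-- The modality of a normal form that a modal subsentence gives rise to. -/
def Sent.toDia : Sent σ → StExpr × Sent σ
  | .box e φ => (e, φ.nnf false)
  | .dia e φ => (e, φ.nnf true)
  | φ => (.base .star, φ)

theorem Sent.self_mem_sub (φ : Sent σ) : φ ∈ φ.sub := by
  cases φ <;> simp [Sent.sub]

/-- A box yields a diamond only at negative polarity and a diamond only at positive polarity. Hence
a subsentence accounts for at most one diamond, even if it occurs with both polarities. -/
theorem Sent.dias_nnf (φ : Sent σ) (b : Bool) : (φ.nnf b).dias ⊆ Sent.toDia '' φ.sub := by
  induction φ generalizing b with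
  | ax α => cases b <;> exact Set.empty_subset _
  | neg φ ih =>
    cases b <;> exact (ih _).trans (Set.image_mono Set.subset_union_right)
  | and φ ψ ih ih' | or φ ψ ih ih' =>
    cases b <;> exact Set.union_subset
      ((ih _).trans (Set.image_mono (Set.subset_union_left.trans Set.subset_union_right)))
      ((ih' _).trans (Set.image_mono (Set.subset_union_right.trans Set.subset_union_right)))
  | box e φ ih =>
    cases b
    · refine Set.union_subset ?_ ((ih _).trans (Set.image_mono Set.subset_union_right))
      rintro _ rfl
      exact ⟨.box e φ, Sent.self_mem_sub _, rfl⟩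
    · exact (ih _).trans (Set.image_mono Set.subset_union_right)
  | dia e φ ih =>
    cases b
    · exact (ih _).trans (Set.image_mono Set.subset_union_right)
    · refine Set.union_subset ?_ ((ih _).trans (Set.image_mono Set.subset_union_right))
      rintro _ rfl
      exact ⟨.dia e φ, Sent.self_mem_sub _, rfl⟩

theorem Sent.dias_lift (φ : Sent σ) :
    φ.lift.dias ⊆ (fun d => (d.1, d.2.lift)) '' φ.dias := by
  induction φ with
  | ax α => exact Set.empty_subset _
  | neg φ ih | box e φ ih => exact ih
  | and φ ψ ih ih' | or φ ψ ih ih' =>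
    rw [Sent.dias, Set.image_union]
    exact Set.union_subset_union ih ih'
  | dia e φ ih =>
    rw [Sent.dias, Set.image_union, Set.image_singleton]
    exact Set.union_subset_union subset_rfl ih

theorem Sent.dias_lit (φ : Sent σ) : φ.lit.dias = ∅ := by
  rcases φ with _ | (_ | _) | _ | _ | _ | _ <;> rfl

theorem Sent.dias_defs (φ : Sent σ) :
    ∀ ψ ∈ φ.defs, ψ.dias ⊆ (fun d => (d.1, d.2.lit)) '' φ.dias := by
  induction φ with
  | ax α => simp [Sent.defs]
  | neg φ ih => simp [Sent.defs]
  | and φ ψ ih ih' | or φ ψ ih ih' =>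
    simp only [Sent.defs, List.mem_cons, List.mem_append]
    rintro χ (rfl | h | h)
    · simp [Sent.dias, Sent.dias_lit]
    · exact (ih _ h).trans (Set.image_mono Set.subset_union_left)
    · exact (ih' _ h).trans (Set.image_mono Set.subset_union_right)
  | box e φ ih =>
    simp only [Sent.defs, List.mem_cons]
    rintro χ (rfl | h)
    · simp [Sent.dias, Sent.dias_lit]
    · exact ih _ h
  | dia e φ ih =>
    simp only [Sent.defs, List.mem_cons]
    rintro χ (rfl | h)
    · simp [Sent.dias, Sent.dias_lit]
    · exact (ih _ h).trans (Set.image_mono Set.subset_union_right)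

theorem Sent.dias_foldl_and (l : List (Sent σ)) (φ : Sent σ) (S : Set (StExpr × Sent σ))
    (h : φ.dias ⊆ S) (hl : ∀ ψ ∈ l, ψ.dias ⊆ S) : (l.foldl Sent.and φ).dias ⊆ S := by
  induction l generalizing φ with
  | nil => exact h
  | cons ψ l ih =>
    exact ih _ (Set.union_subset h (hl ψ (by simp))) fun χ hχ => hl χ (by simp [hχ])

/-- Limits the diamonds of the normal form by the number of subsentences of `φ`, although the normal
form may have more subsentences. -/
theorem Sent.dias_normal (φ : Sent σ) :
    ∃ f : Sent σ → StExpr × Sent σ.ext, φ.normal.dias ⊆ f '' φ.sub := by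
  rw [Sent.normal]
  split_ifs
  · refine ⟨(fun d => (d.1, d.2.lift)) ∘ Sent.toDia, ?_⟩
    rw [Set.image_comp]
    exact (Sent.dias_lift _).trans (Set.image_mono (φ.dias_nnf true))
  · refine ⟨(fun d => (d.1, d.2.lit)) ∘ Sent.toDia, ?_⟩
    rw [Set.image_comp]
    refine (Sent.dias_foldl_and _ _ _ ?_ (Sent.dias_defs _)).trans
      (Set.image_mono (φ.dias_nnf true))
    rw [Sent.dias_lit]
    exact Set.empty_subset _

theorem Sent.sub_finite (φ : Sent σ) : φ.sub.Finite := by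
  induction φ with
  | ax α => exact Set.finite_singleton _
  | neg φ ih | box e φ ih | dia e φ ih => exact (Set.finite_singleton _).union ih
  | and φ ψ ih ih' | or φ ψ ih ih' => exact (Set.finite_singleton _).union (ih.union ih')

theorem Sent.card_pos (φ : Sent σ) : 0 < φ.card :=
  (Set.ncard_pos φ.sub_finite).2 ⟨φ, φ.self_mem_sub⟩

universe w

/-- Change of the set of precisifications. -/
def StandStr.comap {Q : Type w} (M : StandStr σ Δ P) (f : Q → P) : StandStr σ Δ Q where
  stand s := f ⁻¹' M.stand s
  interp q := M.interp (f q)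
  rigid p q := M.rigid (f p) (f q)

theorem StandStr.expr_comap {Q : Type w} (M : StandStr σ Δ P) (f : Q → P) (e : StExpr) :
    (M.comap f).expr e = f ⁻¹' M.expr e := by
  induction e with
  | base s => cases s <;> rfl
  | _ e f he hf => simp only [StandStr.expr, he, hf]; rfl

/-- Boxes are inherited when precisifications are discarded, so only diamonds impose a condition on
the range of `f`. A witness does not depend on where the diamond is evaluated, hence one per diamond
is enough. -/
theorem StandStr.satAt_comap {Q : Type w} (M : StandStr σ Δ P) (f : Q → P) (φ : Sent σ)
    (hφ : φ.IsNNF)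
    (hf : ∀ d ∈ φ.dias, (∃ p ∈ M.expr d.1, M.SatAt p d.2) → ∃ q, f q ∈ M.expr d.1 ∧
      M.SatAt (f q) d.2)
    (q : Q) (h : M.SatAt (f q) φ) : (M.comap f).SatAt q φ := by
  induction φ generalizing q with
  | ax α => exact h
  | neg φ ih =>
    cases φ with
    | ax α => exact h
    | _ => exact hφ.elim
  | and φ ψ ih ih' =>
    exact ⟨ih hφ.1 (fun d hd => hf d (.inl hd)) q h.1,
      ih' hφ.2 (fun d hd => hf d (.inr hd)) q h.2⟩
  | or φ ψ ih ih' =>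
    exact h.imp (ih hφ.1 (fun d hd => hf d (.inl hd)) q)
      (ih' hφ.2 (fun d hd => hf d (.inr hd)) q)
  | box e φ ih =>
    intro q hq
    rw [M.expr_comap] at hq
    exact ih hφ hf q (h _ hq)
  | dia e φ ih =>
    obtain ⟨q', hq', h'⟩ := hf (e, φ) (.inl rfl) h
    refine ⟨q', ?_, ih hφ (fun d hd => hf d (.inr hd)) q' h'⟩
    rwa [M.expr_comap]

/-- A model of the normal form needs only as many precisifications as there are subsentences. -/
theorem StandStr.exists_small [Nonempty P] (M : StandStr σ.ext Δ P) (φ : Sent σ)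
    (h : ∀ p, M.SatAt p φ.normal) :
    ∃ N : StandStr σ.ext Δ (Fin φ.card), ∀ p, N.SatAt p φ.normal := by
  classical
  obtain ⟨f, hf⟩ := φ.dias_normal
  let p₀ : P := Classical.arbitrary P
  -- A diamond that holds nowhere needs no witness, and `p₀` is a filler.
  let w : StExpr × Sent σ.ext → P := fun d =>
    if h : ∃ p ∈ M.expr d.1, M.SatAt p d.2 then h.choose else p₀
  let l : List (Sent σ) := φ.sub_finite.toFinset.toList
  have hl : l.length = φ.card := by
    rw [Finset.length_toList, Sent.card, Set.ncard_eq_toFinset_card _ φ.sub_finite]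
  -- The new precisifications are indexed by the subsentences of `φ`, each sent to a witness for the
  -- diamond that `f` assigns to it. No point has to be kept for the sentence itself, as it holds
  -- everywhere.
  refine ⟨M.comap fun i => w (f (l.get (i.cast hl.symm))), fun i => ?_⟩
  refine M.satAt_comap _ _ φ.isNNF_normal (fun d hd hp => ?_) i (h _)
  obtain ⟨ψ, hψ, rfl⟩ := hf hd
  have : ψ ∈ l := by simpa [l] using hψ
  obtain ⟨j, rfl⟩ := List.get_of_mem this
  refine ⟨j.cast hl, ?_⟩
  have : w (f (l.get j)) = hp.choose := dif_pos hp
  simp only [Fin.cast_cast, Fin.cast_eq_self, this]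
  exact hp.choose_spec

end

end SROIQ

namespace SROIQ

/-! ## Semantics of the translation -/

section

variable {σ : Sig} {Δ : Type u} {P : Type v}

theorem Interp.mem_bigInf (I : Interp σ Δ) (l : List (Concept σ)) (x : Δ) :
    x ∈ I.concept (bigInf l) ↔ ∀ C ∈ l, x ∈ I.concept C := by
  induction l with
  | nil => exact iff_of_true trivial (by simp)
  | cons C l ih =>
    rw [List.forall_mem_cons, ← ih]
    rfl

theorem Interp.mem_bigSup (I : Interp σ Δ) (l : List (Concept σ)) (x : Δ) :
    x ∈ I.concept (bigSup l) ↔ ∃ C ∈ l, x ∈ I.concept C := by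
  induction l with
  | nil => exact iff_of_false id (by simp)
  | cons C l ih =>
    show x ∈ I.concept C ∨ x ∈ I.concept (bigSup l) ↔ _
    simp [ih]

theorem Interp.mem_exChain (I : Interp σ Δ) (rs : List (Role σ.Simp σ.NonSimp)) (C : Concept σ)
    (x : Δ) : x ∈ I.concept (exChain rs C) ↔ ∃ y, I.chain rs x y ∧ y ∈ I.concept C := by
  induction rs generalizing x with
  | nil => simp [exChain, Interp.chain]
  | cons r rs ih =>
    show (∃ z, I.role r x z ∧ z ∈ I.concept (exChain rs C)) ↔ _
    simp only [ih, Interp.chain]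
    constructor
    · rintro ⟨z, hz, y, hy, h⟩
      exact ⟨y, ⟨z, hz, hy⟩, h⟩
    · rintro ⟨y, ⟨z, hz, hy⟩, h⟩
      exact ⟨z, hz, y, hy, h⟩

theorem Interp.chain_append (I : Interp σ Δ) (rs ss : List (Role σ.Simp σ.NonSimp)) (x y : Δ) :
    I.chain (rs ++ ss) x y ↔ ∃ z, I.chain rs x z ∧ I.chain ss z y := by
  induction rs generalizing x with
  | nil => simp [Interp.chain]
  | cons r rs ih =>
    simp only [List.cons_append, Interp.chain, ih]
    constructor
    · rintro ⟨z, hz, w, hw, h⟩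
      exact ⟨w, ⟨z, hz, hw⟩, h⟩
    · rintro ⟨w, ⟨z, hz, hw⟩, h⟩
      exact ⟨z, hz, w, hw, h⟩

theorem Interp.mem_ex_univ (I : Interp σ Δ) (C : Concept σ) (x : Δ) :
    x ∈ I.concept (.ex .univ C) ↔ ∃ y, y ∈ I.concept C :=
  ⟨fun ⟨y, _, h⟩ => ⟨y, h⟩, fun ⟨y, h⟩ => ⟨y, trivial, h⟩⟩

theorem Interp.mem_all_univ (I : Interp σ Δ) (C : Concept σ) (x : Δ) :
    x ∈ I.concept (.all .univ C) ↔ ∀ y, y ∈ I.concept C :=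
  ⟨fun h y => h y trivial, fun h y _ => h y⟩

theorem Interp.mem_ex_univ_nominal (I : Interp σ Δ) (a : σ.Ind) (C : Concept σ) (x : Δ) :
    x ∈ I.concept (.ex .univ (.inf (.nominal a) C)) ↔ I.ind a ∈ I.concept C := by
  rw [I.mem_ex_univ]
  constructor
  · rintro ⟨y, hy, h⟩
    rw [← Set.mem_singleton_iff.1 hy]
    exact h
  · exact fun h => ⟨_, rfl, h⟩

/-- The translation of standpoint expressions. -/
theorem StandStr.mem_trans (M : StandStr σ Δ P) (J : Interp σ.trans Δ) (π : ℕ) (p : P)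
    (hstar : ∀ x, x ∈ J.con (.stand .star π))
    (hsym : ∀ s, (∀ x, x ∈ J.con (.stand (.sym s) π)) ↔ p ∈ M.stand s) (e : StExpr) (x : Δ) :
    x ∈ J.concept (e.trans σ π) ↔ p ∈ M.expr e := by
  induction e with
  | base s =>
    rw [StExpr.trans, J.mem_all_univ]
    cases s with
    | star => exact iff_of_true hstar trivial
    | sym s => exact hsym s
  | union e f he hf => exact or_congr he hf
  | inter e f he hf => exact and_congr he hf
  | diff e f he hf => exact and_congr he (not_congr hf)

/-! ### From models of the sentence to models of the translation -/

open Classical in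
/-- The interpretation given by a standpoint structure, with `g π` as the precisification number
`π`. -/
noncomputable def StandStr.toInterp (M : StandStr σ Δ P) (g : ℕ → P) [Nonempty Δ] :
    Interp σ.trans Δ where
  ind
    | .orig a => (M.interp (g 0)).ind a
    -- The end point of a pair that violates `ρ`, if there is one. It is quantified first because it
    -- is the point to be named.
    | .fresh ρ π =>
      if h : ∃ y x, (M.interp (g π)).chain ρ.body x y ∧ ¬ (M.interp (g π)).rname ρ.head x y
      then h.choose else Classical.arbitrary Δ
  con
    | .copy A π => (M.interp (g π)).con A
    | .stand .star _ => Set.univ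
    | .stand (.sym s) π => {_x | g π ∈ M.stand s}
  simp
    | .copy s π => (M.interp (g π)).simp s
    -- The identity where `ρ` holds and empty otherwise: in the first case guarding changes nothing,
    -- in the second the guarded axiom is vacuous.
    | .guard ρ π => fun x y => x = y ∧ (M.interp (g π)).Sat (.ria ρ)
  nonsimp
    | .copy r π => (M.interp (g π)).nonsimp r
    | .lower r π => (M.interp (g π)).nonsimp r

section

variable [Nonempty Δ] (M : StandStr σ Δ P) (g : ℕ → P) (π : ℕ)

theorem StandStr.ind_toInterp (a : σ.Ind) :
    (M.toInterp g).ind (.orig a) = (M.interp (g π)).ind a := M.rigid _ _ a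

theorem StandStr.rname_toInterp (r : RName σ.Simp σ.NonSimp) :
    (M.toInterp g).rname (RName.at π r) = (M.interp (g π)).rname r := by
  rcases r with _ | _ | _ <;> rfl

theorem StandStr.role_toInterp (r : Role σ.Simp σ.NonSimp) :
    (M.toInterp g).role (Role.at π r) = (M.interp (g π)).role r := by
  induction r with
  | name r => exact M.rname_toInterp g π r
  | inv r => ext x y; exact iff_of_eq (congrFun (congrFun (M.rname_toInterp g π r) y) x)
  | _ r s ihr ihs => ext x y; simp only [Role.at, Interp.role, ihr, ihs]

theorem StandStr.roleLower_toInterp (r : Role σ.Simp σ.NonSimp) :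
    (M.toInterp g).role (Role.lowerAt π r) = (M.interp (g π)).role r := by
  rcases r with (_ | _ | _) | _ | _ | _ | _
  case name.nonsimple.named => rfl
  all_goals exact M.role_toInterp g π _

theorem StandStr.chain_toInterp (rs : List (Role σ.Simp σ.NonSimp)) :
    (M.toInterp g).chain (rs.map (Role.at π)) = (M.interp (g π)).chain rs := by
  induction rs with
  | nil => rfl
  | cons r rs ih => ext x y; simp only [List.map_cons, Interp.chain, ih, M.role_toInterp]

theorem StandStr.chainLower_toInterp (rs : List (Role σ.Simp σ.NonSimp)) :
    (M.toInterp g).chain (rs.map (Role.lowerAt π)) = (M.interp (g π)).chain rs := by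
  induction rs with
  | nil => rfl
  | cons r rs ih => ext x y; simp only [List.map_cons, Interp.chain, ih, M.roleLower_toInterp]

/-- Lower approximations and copies coincide in `toInterp`, so the polarity has no effect. -/
theorem StandStr.replace_toInterp (C : Concept σ) (b : Bool) :
    (M.toInterp g).concept (C.replace π b) = (M.interp (g π)).concept C := by
  induction C generalizing b with
  | atom A | top | bot => cases b <;> rfl
  | nominal a => cases b <;> exact congrArg _ (M.ind_toInterp g π a)
  | self r => ext x; cases b <;> simp [Concept.replace, Interp.concept, M.role_toInterp]
  | neg C ih => cases b <;> simp [Concept.replace, Interp.concept, ih]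
  | inf C D ihC ihD | sup C D ihC ihD =>
    cases b <;> simp [Concept.replace, Interp.concept, ihC, ihD]
  | all r C ih | ex r C ih | atMost n r C ih | atLeast n r C ih =>
    ext x
    cases b <;>
      simp [Concept.replace, Interp.concept, ih, M.role_toInterp, M.roleLower_toInterp]

theorem StandStr.at_toInterp (C : Concept σ) :
    (M.toInterp g).concept (C.at π) = (M.interp (g π)).concept C := by
  ext x
  rw [Concept.at, M.replace_toInterp, Interp.concept_nnf]
  rfl

theorem StandStr.transPos_toInterp (α : Axm σ) (h : (M.interp (g π)).Sat α) (x : Δ) :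
    x ∈ (M.toInterp g).concept (α.transPos π) := by
  cases α with
  | inst C a =>
    rw [Axm.transPos, Interp.mem_ex_univ_nominal, M.at_toInterp, M.ind_toInterp g π]
    exact h
  | link r a b =>
    rw [Axm.transPos, Interp.mem_ex_univ_nominal, M.ind_toInterp g π]
    refine ⟨_, ?_, rfl⟩
    rw [M.roleLower_toInterp, M.ind_toInterp g π]
    exact h
  | eq a b =>
    rw [Axm.transPos, Interp.mem_ex_univ_nominal]
    show (M.toInterp g).ind (.orig a) = (M.toInterp g).ind (.orig b)
    rw [M.ind_toInterp g π, M.ind_toInterp g π]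
    exact h
  | ne a b =>
    rw [Axm.transPos, Interp.mem_ex_univ_nominal]
    show (M.toInterp g).ind (.orig a) ≠ (M.toInterp g).ind (.orig b)
    rw [M.ind_toInterp g π, M.ind_toInterp g π]
    exact h
  | gci C D =>
    rw [Axm.transPos, Interp.mem_all_univ, M.at_toInterp]
    exact fun y => not_or_of_imp (@h y)
  | ria ρ =>
    rw [Axm.transPos, Interp.mem_all_univ]
    exact fun y => ⟨rfl, h⟩

theorem StandStr.transNeg_toInterp (α : Axm σ) (h : ¬ (M.interp (g π)).Sat α) (x : Δ) :
    x ∈ (M.toInterp g).concept (α.transNeg π) := by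
  cases α with
  | inst C a =>
    rw [Axm.transNeg, Interp.mem_ex_univ_nominal, M.at_toInterp, M.ind_toInterp g π]
    exact h
  | link r a b =>
    rw [Axm.transNeg, Interp.mem_ex_univ_nominal, M.ind_toInterp g π]
    intro y hy hb
    rw [M.role_toInterp] at hy
    rw [Set.mem_singleton_iff.1 hb, M.ind_toInterp g π] at hy
    exact h hy
  | eq a b =>
    rw [Axm.transNeg, Interp.mem_ex_univ_nominal]
    show (M.toInterp g).ind (.orig a) ≠ (M.toInterp g).ind (.orig b)
    rw [M.ind_toInterp g π, M.ind_toInterp g π]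
    exact h
  | ne a b =>
    rw [Axm.transNeg, Interp.mem_ex_univ_nominal]
    show (M.toInterp g).ind (.orig a) = (M.toInterp g).ind (.orig b)
    rw [M.ind_toInterp g π, M.ind_toInterp g π]
    exact not_not.1 h
  | gci C D =>
    rw [Axm.transNeg, Interp.mem_ex_univ, M.at_toInterp]
    exact Set.not_subset.1 h
  | ria ρ =>
    have h' : ∃ y x, (M.interp (g π)).chain ρ.body x y ∧ ¬ (M.interp (g π)).rname ρ.head x y := by
      simp only [Interp.Sat, not_forall] at h
      obtain ⟨x, y, h, h'⟩ := h
      exact ⟨y, x, h, h'⟩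
    have hind : (M.toInterp g).ind (.fresh ρ π) = h'.choose := dif_pos h'
    rw [Axm.transNeg, Interp.mem_ex_univ]
    obtain ⟨y, hy, hy'⟩ := h'.choose_spec
    refine ⟨y, fun z hz hz' => ?_, (Interp.mem_exChain _ _ _ _).2 ⟨_, ?_, hind.symm⟩⟩
    · rw [Set.mem_singleton_iff.1 hz', hind] at hz
      exact hy' ((congrFun (congrFun (M.rname_toInterp g π ρ.head) y) h'.choose).mp hz)
    · rw [M.chainLower_toInterp]
      exact hy

theorem StandStr.mem_trans_toInterp (e : StExpr) (x : Δ) :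
    x ∈ (M.toInterp g).concept (e.trans σ π) ↔ g π ∈ M.expr e := by
  refine M.mem_trans (M.toInterp g) π (g π) (fun x => Set.mem_univ x) (fun s => ?_) e x
  exact ⟨fun h => h x, fun h _ => h⟩

/-- The numbers below `n` must reach every precisification, since the disjunction for a diamond has
to contain the witness. -/
theorem StandStr.transAt_toInterp (n : ℕ) (hg : ∀ p, ∃ π < n, g π = p) (φ : Sent σ)
    (hφ : φ.IsNNF) (h : M.SatAt (g π) φ) (x : Δ) :
    x ∈ (M.toInterp g).concept (φ.transAt n π) := by
  induction φ generalizing π with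
  | ax α => exact M.transPos_toInterp g π α h x
  | neg φ ih =>
    cases φ with
    | ax α => exact M.transNeg_toInterp g π α h x
    | _ => exact hφ.elim
  | and φ ψ ih ih' => exact ⟨ih π hφ.1 h.1, ih' π hφ.2 h.2⟩
  | or φ ψ ih ih' => exact h.imp (ih π hφ.1) (ih' π hφ.2)
  | box e φ ih =>
    rw [Sent.transAt, Interp.mem_bigInf]
    intro C hC
    obtain ⟨π, _, rfl⟩ := List.mem_map.1 hC
    refine not_or_of_imp fun he => ih π hφ (h _ ?_)
    rwa [M.mem_trans_toInterp] at he
  | dia e φ ih =>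
    obtain ⟨q, hq, h⟩ := h
    obtain ⟨π, hπ, rfl⟩ := hg q
    rw [Sent.transAt, Interp.mem_bigSup]
    exact ⟨_, List.mem_map.2 ⟨π, List.mem_range.2 hπ, rfl⟩,
      (M.mem_trans_toInterp g π e x).2 hq, ih π hφ h⟩

/-- A step along the guard stays in place and certifies that `ρ` holds; deleting it leaves an
instance of `ρ`. -/
theorem StandStr.guarded_toInterp (ρ : RIA σ.Simp σ.NonSimp)
    (ρ' : RIA (TSimp σ) (TNonSimp σ)) (h : ρ.guarded π = some ρ') :
    (M.toInterp g).Sat (.ria ρ') := by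
  rcases ρ with ⟨ws, _ | r | _⟩ | ⟨ws, _ | r | _⟩ | ⟨ws, _ | r | _⟩ | ⟨_ | r | _⟩ <;>
    simp only [RIA.guarded, Option.some.injEq, reduceCtorEq] at h <;> subst h
  · rintro x y ⟨_, ⟨rfl, hρ⟩, h⟩
    rw [M.chain_toInterp] at h
    exact hρ x y h
  · rintro x y ⟨_, ⟨rfl, hρ⟩, h⟩
    change (M.toInterp g).chain (ws.map (Role.at π) ++ _) x y at h
    rw [Interp.chain_append, M.chain_toInterp] at h
    obtain ⟨z, hz, hzy⟩ := h
    exact hρ x y ((Interp.chain_append _ _ _ _ _).2 ⟨z, hz, hzy⟩)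
  · rintro x y ⟨z, hz, h⟩
    rw [Interp.chain_append, M.chain_toInterp] at h
    obtain ⟨w, hw, v, ⟨rfl, hρ⟩, rfl⟩ := h
    exact hρ x _ ⟨z, hz, hw⟩
  · rintro x y ⟨_, ⟨rfl, hρ⟩, z, hz, w, hw, rfl⟩
    exact hρ x _ ⟨z, hz, _, hw, rfl⟩

theorem StandStr.sat_toInterp (n : ℕ) (hg : ∀ p, ∃ π < n, g π = p) (φ : Sent σ) (hφ : φ.IsNNF)
    (h : ∀ p, M.SatAt p φ) : ∀ α ∈ φ.transKB n, (M.toInterp g).Sat α := by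
  intro α hα
  simp only [Sent.transKB, List.mem_append, List.mem_flatMap, List.mem_map, List.mem_singleton,
    List.mem_filterMap] at hα
  rcases hα with (⟨π, _, r, _, rfl⟩ | ⟨π, _, ρ', ⟨ρ, _, h'⟩, rfl⟩) | rfl
  · rintro x y ⟨z, hz, rfl⟩
    exact hz
  · exact M.guarded_toInterp g π ρ ρ' h'
  · refine fun x _ => ⟨(Interp.mem_bigInf _ _ _).2 fun C hC => ?_,
      (Interp.mem_bigInf _ _ _).2 fun C hC => ?_⟩
    · obtain ⟨π, _, rfl⟩ := List.mem_map.1 hC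
      exact M.transAt_toInterp g π n hg φ hφ (h _) x
    · obtain ⟨π, _, rfl⟩ := List.mem_map.1 hC
      exact fun _ _ => trivial

end

/-! ### From models of the translation to models of the sentence -/

/-- The precisifications given by an interpretation. A non-simple role name is interpreted by its
lower approximation, or by the transitive closure thereof if its transitivity, being one of the
axioms `T`, is asserted. -/
def Interp.toStandStr (J : Interp σ.trans Δ) (T : List (RIA σ.Simp σ.NonSimp)) (n : ℕ) :
    StandStr σ Δ (Fin n) where
  stand s := {π | ∀ x, x ∈ J.con (.stand (.sym s) π)}
  interp π :=
    { ind := fun a => J.ind (.orig a)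
      con := fun A => J.con (.copy A π)
      simp := fun s => J.simp (.copy s π)
      nonsimp := fun r x y => J.nonsimp (.lower r π) x y ∨
        (.trans (.nonsimple (.named r)) ∈ T ∧
          ∀ z, J.simp (.guard (.trans (.nonsimple (.named r))) π) z z) ∧
        Relation.TransGen (J.nonsimp (.lower r π)) x y }
  rigid _ _ _ := rfl

section

variable (J : Interp σ.trans Δ) (T : List (RIA σ.Simp σ.NonSimp)) {n : ℕ}
  (π : Fin n)

theorem Interp.role_toStandStr_of_simple (w : Role σ.Simp σ.NonSimp) (h : w.Simple) :
    J.role (Role.at π w) = ((J.toStandStr T n).interp π).role w := by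
  induction w with
  | name r | inv r =>
    rcases r with _ | _ | _
    · rfl
    all_goals exact h.elim
  | _ r s ihr ihs => ext x y; simp only [Role.at, Interp.role, ihr h.1, ihs h.2]

variable {J T} (hT : ∀ ρ ∈ T, ∀ ρ', ρ.guarded π = some ρ' → J.Sat (.ria ρ'))

include hT in
-- The upper half of the sandwich. For the transitive closure, the last step of a path passes from
-- `r̲` to `r`, and the earlier ones are added from the back by `s_ρ ∘ r̲ ∘ r ⊑ r`. That axiom is
-- available because the closure is taken only when transitivity belongs to `T` and its guard is
-- reflexive.
theorem Interp.toStandStr_le {r : σ.NonSimp}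
    (hr : ∀ x y, J.nonsimp (.lower r π) x y → J.nonsimp (.copy r π) x y) (x y : Δ)
    (h : ((J.toStandStr T n).interp π).nonsimp r x y) : J.nonsimp (.copy r π) x y := by
  rcases h with h | ⟨⟨hT', hg⟩, h⟩
  · exact hr x y h
  · induction h using Relation.TransGen.head_induction_on with
    | single h => exact hr _ _ h
    | head h _ ih => exact hT _ hT' _ rfl _ _ ⟨_, hg _, _, h, _, ih, rfl⟩

variable {N : List σ.NonSimp}
  (hN : ∀ r ∈ N, ∀ x y, J.nonsimp (.lower r π) x y → J.nonsimp (.copy r π) x y)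

/-- The lower half of the sandwich, which needs no axioms. -/
theorem Interp.role_toStandStr_of_lower (w : Role σ.Simp σ.NonSimp) (h : w.Valid) (x y : Δ)
    (hw : J.role (Role.lowerAt π w) x y) : ((J.toStandStr T n).interp π).role w x y := by
  rcases h with h | ⟨_ | _, rfl⟩
  · rwa [w.lowerAt_of_simple _ h, J.role_toStandStr_of_simple T π w h] at hw
  · exact .inl hw
  · trivial

include hT hN in
theorem Interp.role_of_toStandStr (w : Role σ.Simp σ.NonSimp) (h : w.Valid)
    (hwN : w.nonsimples ⊆ N) (x y : Δ) (hw : ((J.toStandStr T n).interp π).role w x y) :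
    J.role (Role.at π w) x y := by
  rcases h with h | ⟨r | _, rfl⟩
  · rwa [J.role_toStandStr_of_simple T π w h]
  · exact Interp.toStandStr_le π hT (hN r (hwN (by simp [Role.nonsimples, RName.nonsimples])))
      x y hw
  · trivial

theorem Interp.chain_toStandStr_of_lower (ws : List (Role σ.Simp σ.NonSimp))
    (h : ∀ w ∈ ws, w.Valid) (x y : Δ) (hw : J.chain (ws.map (Role.lowerAt π)) x y) :
    ((J.toStandStr T n).interp π).chain ws x y := by
  induction ws generalizing x with
  | nil => exact hw
  | cons w ws ih =>
    obtain ⟨z, hz, hw⟩ := hw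
    exact ⟨z, Interp.role_toStandStr_of_lower π w (h w (by simp)) x z hz,
      ih (fun w hw => h w (by simp [hw])) z hw⟩

include hT hN in
theorem Interp.chain_of_toStandStr (ws : List (Role σ.Simp σ.NonSimp)) (h : ∀ w ∈ ws, w.Valid)
    (hwN : ∀ w ∈ ws, w.nonsimples ⊆ N) (x y : Δ)
    (hw : ((J.toStandStr T n).interp π).chain ws x y) : J.chain (ws.map (Role.at π)) x y := by
  induction ws generalizing x with
  | nil => exact hw
  | cons w ws ih =>
    obtain ⟨z, hz, hw⟩ := hw
    exact ⟨z, Interp.role_of_toStandStr π hT hN w (h w (by simp)) (hwN w (by simp)) x z hz,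
      ih (fun w hw => h w (by simp [hw])) (fun w hw => hwN w (by simp [hw])) z hw⟩

include hT hN in
/-- Translated concepts are sandwiched. -/
theorem Interp.concept_toStandStr (C : Concept σ) (h : C.Valid) (hC : C.nonsimples ⊆ N) :
    J.concept (C.replace π true) ⊆ ((J.toStandStr T n).interp π).concept C ∧
      ((J.toStandStr T n).interp π).concept C ⊆ J.concept (C.replace π false) := by
  induction C with
  | atom A | nominal a | top | bot => exact ⟨subset_rfl, subset_rfl⟩
  | self r =>
    simp only [Concept.replace, Interp.concept, J.role_toStandStr_of_simple T π r h]
    exact ⟨subset_rfl, subset_rfl⟩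
  | neg C ih =>
    exact ⟨Set.compl_subset_compl.2 (ih h hC).2, Set.compl_subset_compl.2 (ih h hC).1⟩
  | inf C D ihC ihD =>
    obtain ⟨hC, hD⟩ := List.append_subset.1 hC
    exact ⟨Set.inter_subset_inter (ihC h.1 hC).1 (ihD h.2 hD).1,
      Set.inter_subset_inter (ihC h.1 hC).2 (ihD h.2 hD).2⟩
  | sup C D ihC ihD =>
    obtain ⟨hC, hD⟩ := List.append_subset.1 hC
    exact ⟨Set.union_subset_union (ihC h.1 hC).1 (ihD h.2 hD).1,
      Set.union_subset_union (ihC h.1 hC).2 (ihD h.2 hD).2⟩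
  | all r C ih =>
    obtain ⟨hr, hC⟩ := List.append_subset.1 hC
    exact ⟨fun x hx y hy => (ih h.2 hC).1
      (hx y (Interp.role_of_toStandStr π hT hN r h.1 hr x y hy)),
      fun x hx y hy => (ih h.2 hC).2 (hx y (Interp.role_toStandStr_of_lower π r h.1 x y hy))⟩
  | ex r C ih =>
    obtain ⟨hr, hC⟩ := List.append_subset.1 hC
    exact ⟨fun x ⟨y, hy, hx⟩ => ⟨y, Interp.role_toStandStr_of_lower π r h.1 x y hy,
      (ih h.2 hC).1 hx⟩, fun x ⟨y, hy, hx⟩ =>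
      ⟨y, Interp.role_of_toStandStr π hT hN r h.1 hr x y hy, (ih h.2 hC).2 hx⟩⟩
  | atMost m r C ih =>
    obtain ⟨hr, hC⟩ := List.append_subset.1 hC
    simp only [Concept.replace, Interp.concept, J.role_toStandStr_of_simple T π r h.1]
    -- The role is simple and hence interpreted exactly. The bound is antitone in the filler, so
    -- each inclusion uses the opposite half of the induction hypothesis.
    exact ⟨fun x hx => le_trans (Set.encard_le_encard
        (Set.ofPred_subset_ofPred.2 fun y hy => ⟨(ih h.2 hC).2 hy.1, hy.2⟩)) hx,
      fun x hx => le_trans (Set.encard_le_encard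
        (Set.ofPred_subset_ofPred.2 fun y hy => ⟨(ih h.2 hC).1 hy.1, hy.2⟩)) hx⟩
  | atLeast m r C ih =>
    obtain ⟨hr, hC⟩ := List.append_subset.1 hC
    simp only [Concept.replace, Interp.concept, J.role_toStandStr_of_simple T π r h.1]
    exact ⟨fun x hx => le_trans hx (Set.encard_le_encard
        (Set.ofPred_subset_ofPred.2 fun y hy => ⟨(ih h.2 hC).1 hy.1, hy.2⟩)),
      fun x hx => le_trans hx (Set.encard_le_encard
        (Set.ofPred_subset_ofPred.2 fun y hy => ⟨(ih h.2 hC).2 hy.1, hy.2⟩))⟩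

theorem Concept.nonsimples_nnf (C : Concept σ) (b : Bool) :
    (C.nnf b).nonsimples ⊆ C.nonsimples := by
  induction C generalizing b with
  | atom A | nominal a | top | bot | self r => cases b <;> exact List.Subset.refl _
  | neg C ih => cases b <;> exact ih _
  | inf C D ihC ihD | sup C D ihC ihD =>
    cases b <;> exact List.append_subset.2 ⟨List.Subset.trans (ihC _) (List.subset_append_left _ _),
      List.Subset.trans (ihD _) (List.subset_append_right _ _)⟩
  | all r C ih | ex r C ih | atMost n r C ih =>
    cases b <;> exact List.append_subset.2 ⟨List.subset_append_left _ _,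
      List.Subset.trans (ih _) (List.subset_append_right _ _)⟩
  | atLeast n r C ih =>
    cases b
    · cases n
      · exact List.nil_subset _
      · exact List.append_subset.2 ⟨List.subset_append_left _ _,
          List.Subset.trans (ih _) (List.subset_append_right _ _)⟩
    · cases n <;> exact List.append_subset.2 ⟨List.subset_append_left _ _,
        List.Subset.trans (ih _) (List.subset_append_right _ _)⟩

include hT hN in
theorem Interp.at_toStandStr (C : Concept σ) (h : C.Valid) (hC : C.nonsimples ⊆ N) :
    J.concept (C.at π) ⊆ ((J.toStandStr T n).interp π).concept C := fun x hx => by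
  have := (Interp.concept_toStandStr π hT hN _ (C.valid_nnf true h)
    (List.Subset.trans (C.nonsimples_nnf true) hC)).1 hx
  exact (Interp.concept_nnf _ C true x).1 this

include hT hN in
-- The roles `r₁, …, rₙ` are bounded above by their copies, so the guarded axiom applies to them and
-- delivers `r̲`. In the second and third shape the head also occurs on the left, possibly as a path
-- of `r̲`-steps, and the rest of the chain is absorbed into the adjacent step. Transitivity holds
-- by taking the closure.
theorem Interp.sat_ria_toStandStr {prec : NName σ.NonSimp → NName σ.NonSimp → Prop}
    (ρ : RIA σ.Simp σ.NonSimp) (h : ρ.Valid prec) (hρN : ρ.nonsimples ⊆ N) (hρ : ρ ∈ T)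
    (hg : ∀ z, J.simp (.guard ρ π) z z) : ((J.toStandStr T n).interp π).Sat (.ria ρ) := by
  have hT' := hT ρ hρ
  have hw : ∀ w ∈ ρ.body, w.nonsimples ⊆ N := fun w hw r hr =>
    hρN (List.mem_append_left _ (List.mem_flatMap.2 ⟨w, hw, hr⟩))
  have hv := h.body
  obtain ⟨k, hk⟩ := h.exists_head
  rcases k with r | _
  swap
  · intro x y _
    rw [hk]
    trivial
  rcases ρ with ⟨ws, _⟩ | ⟨ws, _⟩ | ⟨ws, _⟩ | _ <;> cases hk
  · intro x y hxy
    have := Interp.chain_of_toStandStr π hT hN _ hv hw x y hxy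
    exact .inl (hT' _ rfl x y ⟨x, hg x, this⟩)
  · have key : ∀ x z, ((J.toStandStr T n).interp π).chain ws x z → ∀ y,
        J.nonsimp (.lower r π) z y → J.nonsimp (.lower r π) x y := by
      intro x z hxz y hzy
      have := Interp.chain_of_toStandStr π hT hN _ (fun w hw => hv w (List.mem_append_left _ hw))
        (fun w h => hw w (List.mem_append_left _ h)) x z hxz
      exact hT' _ rfl x y ((Interp.chain_append _ (_ :: _) _ _ _).2
        ⟨z, ⟨x, hg x, this⟩, y, hzy, rfl⟩)
    intro x y hxy
    obtain ⟨z, hxz, _, hzy, rfl⟩ := (Interp.chain_append _ _ _ _ _).1 hxy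
    rcases hzy with hzy | ⟨ht, hzy⟩
    · exact .inl (key x z hxz _ hzy)
    -- The first step of the path absorbs `r₁ ∘ … ∘ rₙ`; the other steps are kept.
    · refine .inr ⟨ht, ?_⟩
      obtain ⟨w, hzw, hwy⟩ := Relation.TransGen.head'_iff.1 hzy
      exact Relation.TransGen.head' (key x z hxz w hzw) hwy
  · have key : ∀ z y, ((J.toStandStr T n).interp π).chain ws z y → ∀ x,
        J.nonsimp (.lower r π) x z → J.nonsimp (.lower r π) x y := by
      intro z y hzy x hxz
      have := Interp.chain_of_toStandStr π hT hN _ (fun w hw => hv w (List.mem_cons_of_mem _ hw))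
        (fun w h => hw w (List.mem_cons_of_mem _ h)) z y hzy
      exact hT' _ rfl x y ⟨z, hxz, (Interp.chain_append _ _ _ _ _).2 ⟨y, this, y, hg y, rfl⟩⟩
    rintro x y ⟨z, hxz, hzy⟩
    rcases hxz with hxz | ⟨ht, hxz⟩
    · exact .inl (key z y hzy x hxz)
    -- Symmetrically, here the last step absorbs the chain.
    · refine .inr ⟨ht, ?_⟩
      obtain ⟨w, hxw, hwz⟩ := Relation.TransGen.tail'_iff.1 hxz
      exact Relation.TransGen.tail' hxw (key z y hzy w hwz)
  · have ht : ∀ x y, ((J.toStandStr T n).interp π).nonsimp r x y →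
        Relation.TransGen (J.nonsimp (.lower r π)) x y := by
      rintro x y (h | ⟨_, h⟩)
      · exact .single h
      · exact h
    rintro x y ⟨z, hxz, _, hzy, rfl⟩
    exact .inr ⟨⟨hρ, hg⟩, (ht x z hxz).trans (ht z _ hzy)⟩

include hT hN in
theorem Interp.sat_toStandStr_of_transPos {prec : NName σ.NonSimp → NName σ.NonSimp → Prop}
    (α : Axm σ) (h : α.Valid prec) (hα : α.nonsimples ⊆ N) (hT' : ∀ ρ, α = .ria ρ → ρ ∈ T)
    (x : Δ) (hx : x ∈ J.concept (α.transPos π)) : ((J.toStandStr T n).interp π).Sat α := by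
  cases α with
  | inst C a =>
    rw [Axm.transPos, Interp.mem_ex_univ_nominal] at hx
    exact Interp.at_toStandStr π hT hN C h hα hx
  | link r a b =>
    rw [Axm.transPos, Interp.mem_ex_univ_nominal] at hx
    obtain ⟨y, hy, rfl⟩ := hx
    exact Interp.role_toStandStr_of_lower π r h _ _ hy
  | eq a b | ne a b =>
    rw [Axm.transPos, Interp.mem_ex_univ_nominal] at hx
    exact hx
  | gci C D =>
    rw [Axm.transPos, Interp.mem_all_univ] at hx
    exact fun y hy => (Interp.at_toStandStr π hT hN (.sup (.neg C) D) h hα (hx y)).resolve_left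
      (not_not.2 hy)
  | ria ρ =>
    rw [Axm.transPos, Interp.mem_all_univ] at hx
    exact Interp.sat_ria_toStandStr π hT hN ρ h hα (hT' ρ rfl) hx

include hT hN in
-- Both halves of the sandwich preserve violations: a chain of lower approximations is a chain of
-- the new roles, and where the copy of the head has no edge the new head has none.
theorem Interp.not_sat_toStandStr_of_transNeg {prec : NName σ.NonSimp → NName σ.NonSimp → Prop}
    (α : Axm σ) (h : α.Valid prec) (hα : α.nonsimples ⊆ N)
    (x : Δ) (hx : x ∈ J.concept (α.transNeg π)) : ¬ ((J.toStandStr T n).interp π).Sat α := by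
  cases α with
  | inst C a =>
    rw [Axm.transNeg, Interp.mem_ex_univ_nominal] at hx
    exact Interp.at_toStandStr π hT hN (.neg C) h hα hx
  | link r a b =>
    rw [Axm.transNeg, Interp.mem_ex_univ_nominal] at hx
    exact fun h' => hx _ (Interp.role_of_toStandStr π hT hN r h hα _ _ h') rfl
  | eq a b =>
    rw [Axm.transNeg, Interp.mem_ex_univ_nominal] at hx
    exact hx
  | ne a b =>
    rw [Axm.transNeg, Interp.mem_ex_univ_nominal] at hx
    exact not_not.2 hx
  | gci C D =>
    rw [Axm.transNeg, Interp.mem_ex_univ] at hx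
    obtain ⟨y, hy⟩ := hx
    have := Interp.at_toStandStr π hT hN (.inf C (.neg D)) h hα hy
    exact fun h' => this.2 (h' this.1)
  | ria ρ =>
    rw [Axm.transNeg, Interp.mem_ex_univ] at hx
    obtain ⟨y, hy, hy'⟩ := hx
    obtain ⟨_, hc, rfl⟩ := (Interp.mem_exChain _ _ _ _).1 hy'
    intro hs
    have hc := hs _ _ (Interp.chain_toStandStr_of_lower π _ (RIA.Valid.body h) _ _ hc)
    obtain ⟨k, hk⟩ := RIA.Valid.exists_head h
    refine hy _ (Interp.role_of_toStandStr π hT hN (.name ρ.head) (.inr ⟨k, by rw [hk]⟩)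
      (fun r hr => hα (List.mem_append_right _ hr)) _ _ hc) rfl

end

theorem Interp.satAt_toStandStr {prec : NName σ.NonSimp → NName σ.NonSimp → Prop}
    {J : Interp σ.trans Δ} {T : List (RIA σ.Simp σ.NonSimp)} {N : List σ.NonSimp} {n : ℕ}
    (hT : ∀ π < n, ∀ ρ ∈ T, ∀ ρ', ρ.guarded π = some ρ' → J.Sat (.ria ρ'))
    (hN : ∀ π < n, ∀ r ∈ N, ∀ x y, J.nonsimp (.lower r π) x y → J.nonsimp (.copy r π) x y)
    (hstar : ∀ π < n, ∀ x, x ∈ J.con (.stand .star π))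
    (φ : Sent σ) (h : φ.Valid prec) (hφN : φ.nonsimples ⊆ N) (hφT : φ.posRIAs ⊆ T) (x : Δ)
    (π : Fin n) (hx : x ∈ J.concept (φ.transAt n π)) : (J.toStandStr T n).SatAt π φ := by
  -- Standpoint expressions need an equivalence: boxes use one direction, diamonds the other.
  have hst : ∀ e : StExpr, ∀ π : Fin n, x ∈ J.concept (e.trans σ π) ↔
      π ∈ (J.toStandStr T n).expr e := fun e π =>
    (J.toStandStr T n).mem_trans J π π (hstar π π.2) (fun s => Iff.rfl) e x
  induction φ generalizing π with
  | ax α =>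
    refine Interp.sat_toStandStr_of_transPos π (hT π π.2) (hN π π.2) α h hφN ?_ x hx
    rintro ρ rfl
    exact hφT (by simp [Sent.posRIAs])
  | neg φ ih =>
    cases φ with
    | ax α => exact Interp.not_sat_toStandStr_of_transNeg π (hT π π.2) (hN π π.2) α h hφN x hx
    | _ => exact hx.elim
  | and φ ψ ih ih' =>
    obtain ⟨hN1, hN2⟩ := List.append_subset.1 hφN
    obtain ⟨hT1, hT2⟩ := List.append_subset.1 hφT
    exact ⟨ih h.1 hN1 hT1 π hx.1, ih' h.2 hN2 hT2 π hx.2⟩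
  | or φ ψ ih ih' =>
    obtain ⟨hN1, hN2⟩ := List.append_subset.1 hφN
    obtain ⟨hT1, hT2⟩ := List.append_subset.1 hφT
    exact hx.imp (ih h.1 hN1 hT1 π) (ih' h.2 hN2 hT2 π)
  | box e φ ih =>
    rw [Sent.transAt, Interp.mem_bigInf] at hx
    intro q hq
    refine ih h hφN hφT q ((hx _ (List.mem_map.2 ⟨q, List.mem_range.2 q.2, rfl⟩)).resolve_left ?_)
    exact not_not.2 ((hst e q).2 hq)
  | dia e φ ih =>
    rw [Sent.transAt, Interp.mem_bigSup] at hx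
    obtain ⟨C, hC, hx⟩ := hx
    obtain ⟨q, hq, rfl⟩ := List.mem_map.1 hC
    rw [List.mem_range] at hq
    exact ⟨⟨q, hq⟩, (hst e ⟨q, hq⟩).1 hx.1, ih h hφN hφT ⟨q, hq⟩ hx.2⟩

/-- The set `T` consists of the unnegated role inclusion axioms, for which the knowledge base
contains the guarded versions. A point of the domain is needed to unfold the inclusion `⊤ ⊑ …`. -/
theorem Interp.exists_standStr [Nonempty Δ] {prec : NName σ.NonSimp → NName σ.NonSimp → Prop}
    (J : Interp σ.trans Δ) (n : ℕ) (φ : Sent σ) (h : φ.Valid prec)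
    (hJ : ∀ α ∈ φ.transKB n, J.Sat α) :
    ∀ p, (J.toStandStr φ.posRIAs n).SatAt p φ := by
  obtain ⟨x⟩ := ‹Nonempty Δ›
  have hc := hJ _ (List.mem_append_right _ (List.mem_singleton_self _)) (Set.mem_univ x)
  have h1 := (Interp.mem_bigInf _ _ _).1 hc.1
  have h2 := (Interp.mem_bigInf _ _ _).1 hc.2
  refine fun π => Interp.satAt_toStandStr (N := φ.nonsimples) (fun π hπ ρ hρ ρ' h' => ?_)
    (fun π hπ r hr y z hyz => ?_) (fun π hπ => ?_) φ h (List.Subset.refl _) (List.Subset.refl _) x π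
    (h1 _ (List.mem_map.2 ⟨π, List.mem_range.2 π.2, rfl⟩))
  · exact hJ _ (List.mem_append_left _ (List.mem_append_right _ (List.mem_flatMap.2
      ⟨π, List.mem_range.2 hπ, List.mem_map.2 ⟨ρ', List.mem_filterMap.2 ⟨ρ, hρ, h'⟩, rfl⟩⟩)))
  · exact hJ _ (List.mem_append_left _ (List.mem_append_left _ (List.mem_flatMap.2
      ⟨π, List.mem_range.2 hπ, List.mem_map.2 ⟨r, hr, rfl⟩⟩))) y z ⟨z, hyz, rfl⟩
  · have := h2 _ (List.mem_map.2 ⟨π, List.mem_range.2 hπ, rfl⟩)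
    exact (Interp.mem_all_univ _ _ _).1 this

theorem satisfiable_standpointTrans {prec : NName σ.NonSimp → NName σ.NonSimp → Prop}
    (φ : Sent σ) (h : φ.Valid prec) :
    Sent.Satisfiable.{u, v} φ ↔ KB.Satisfiable.{u} (standpointTrans φ) := by
  have : NeZero φ.card := ⟨φ.card_pos.ne'⟩
  constructor
  · rintro ⟨Δ, P, _, _, M, hM⟩
    obtain ⟨N, hN⟩ := M.ext.exists_small φ (M.satAt_normal_ext φ hM)
    -- The numbering is extended to all of `ℕ` by reduction modulo `φ.card`; below that bound it is
    -- the identity.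
    refine ⟨Δ, ‹_›, N.toInterp fun π => Fin.ofNat φ.card π,
      N.sat_toInterp _ φ.card (fun p => ⟨p, p.2, ?_⟩) φ.normal φ.isNNF_normal hN⟩
    exact Fin.ofNat_val_eq_self p
  · rintro ⟨Δ, _, J, hJ⟩
    have := Interp.exists_standStr (σ := σ.ext) (prec := prec) J φ.card φ.normal
      (φ.valid_normal h) hJ
    -- The finite set of precisifications is lifted to the universe prescribed for them;
    -- `satAt_comap` transfers the normal form because `ULift.down` is onto.
    refine ⟨Δ, ULift (Fin φ.card), ‹_›, ⟨⟨0⟩⟩,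
      ((Interp.toStandStr (σ := σ.ext) J φ.normal.posRIAs φ.card).comap ULift.down).reduct,
      StandStr.satAt_reduct_of_normal _ φ fun p => ?_⟩
    exact StandStr.satAt_comap _ _ _ φ.isNNF_normal (fun d _ ⟨q, hq, hq'⟩ => ⟨⟨q⟩, hq, hq'⟩) p
      (this p.down)

end

end SROIQ

theorem mainTheorem4 :
    (∀ (prec : NName ℕ → NName ℕ → Prop), IsStrictOrder (NName ℕ) prec →
      ∀ φ : Sent baseSig, φ.Valid prec →
        KB.Valid (transPrec prec) (standpointTrans φ) ∧
        (Sent.Satisfiable.{u, v} φ ↔ KB.Satisfiable.{u} (standpointTrans φ))) ∧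
    (∃ q : Polynomial ℕ, ∀ φ : Sent baseSig,
      (outputEnc (standpointTrans φ)).size ≤ q.eval (inputEnc φ).size) ∧
    PolyTimeComputable inputEnc outputEnc (standpointTrans (σ := baseSig)) := by
  refine ⟨fun prec hprec φ hφ => ⟨valid_standpointTrans (σ := baseSig) hprec φ hφ,
    satisfiable_standpointTrans (σ := baseSig) φ hφ⟩, ?_, polyTimeComputable_standpointTrans⟩
  -- The time bound includes the size of the output, so the same polynomial bounds the size.
  obtain ⟨p, q, h⟩ := polyTimeComputable_standpointTrans
  refine ⟨q, fun φ => ?_⟩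
  obtain ⟨t, _, h⟩ := h φ
  omega
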